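/- **Proposition (global $S^1$-fibration).** Conventions. Let $(M,g)$ be a smooth Riemannian $3$-manifold (Hausdorff, possibly with boundary; neither completeness nor compactness is assumed), let $B(0,r)\subset\mathbb R^2$ be the open Euclidean disk, and let $g_0$ be the product of the metric of length $1$ on $S^1$ and the Euclidean metric of $\mathbb R^2$. For $\epsilon>0$ an *$S^1$-product structure with $\epsilon$-control* in $M$ is a smooth embedding $\varphi\colon S^1\times B(0,\epsilon^{-1})\to M$ for which there is a constant $\lambda>0$ such that $\varphi^*(\lambda g)$ is within $\epsilon$ of $g_0$ in the $C^{[1/\epsilon]}$-topology, i.e. $|\nabla_{g_0}^k(\varphi^*(\lambda g)-g_0)|\le\epsilon$ everywhere for $0\le k\le[1/\epsilon]$ (operator norms). It is *centered at $x$* if $x\in\varphi(S^1\times\{0\})$; its *circles* are the curves $\varphi(S^1\times\{y\})$, $|y|<\epsilon^{-1}$. A smooth $S^1$-fibration on an open set $V\subset M$ is a smooth locally trivial bundle $p\colon V\to B$ with fiber $S^1$ over a smooth surface $B$ (Hausdorff, second countable, without boundary). A fiber $F$ contained in $U=\varphi(S^1\times B(0,\epsilon^{-1}))$ is *within $\epsilon'$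 of vertical* in $U$ if at each point of $F$ the $g$-angle between the tangent line of $F$ and the tangent line of the circle of $\varphi$ through that point is at most $\epsilon'$, and $F\subset\varphi\bigl(S^1\times\{y\in B(0,\epsilon^{-1}):|y-y_0|\le\epsilon'\}\bigr)$ for some $y_0\in B(0,\epsilon^{-1})$. Statement. For every $\epsilon'>0$ there is $\epsilon_1=\epsilon_1(\epsilon')>0$ such that the following holds for all $0<\epsilon<\epsilon_1$ and all $(M,g)$ as above. Let $K\subset M$ be a compact subset such that each $x\in K$ is the center of an $S^1$-product structure with $\epsilon$-control. Then there are an open subset $V\subset M$ containing $K$ and a smooth $S^1$-fibration $p\colon V\to B$ such that every fiber $F$ of $p$ has the following properties. 1. If $\varphi$ is any $S^1$-product structure with $\epsilon$-control in $M$ whose image $U$ contains $F$, then $F$ is within $\epsilon'$ of vertical in $U$, and $F$ generates the fundamental group of $U$ (the map $\pi_1(F)\to\pi_1(U)$ induced by the inclusion is surjective). 2. If $\varphi$ is any $S^1$-product structure with $\epsilon$-control centered at a point of $F$, then the diameter of $F$ (for the Riemannian distance of $M$) is at most twice the $g$-length of any circle of $\varphi$. -/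

import Mathlib

open Set Manifold
open scoped ContDiff Topology

universe u v

noncomputable section

namespace CircleCollapse

/-- The Euclidean plane. -/
abbrev Plane : Type := EuclideanSpace ℝ (Fin 2)

/-- The Euclidean space `ℝ³ = ℝ × ℝ²`, with coordinates `q 0` (written `t`) and `(q 1, q 2)`: the
universal cover of the product of the circle of length one with the plane. The Euclidean inner
product is the lift of the product metric `g₀`. -/
abbrev Cover : Type := EuclideanSpace ℝ (Fin 3)

/-- The `ℝ²`-component of a point of `ℝ × ℝ²`. -/
def planePart (q : Cover) : Plane := !₂[q 1, q 2]

/-- The open set `S¹ × B(0, r)`. -/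
def circleTimesBall (r : ℝ) : Set (Circle × Plane) := univ ×ˢ Metric.ball 0 r

/-- The lift `(t, y) ↦ φ (exp (2 π i t), y)` of a map `φ` on `S¹ × ℝ²` to the universal cover.
The circle has length one in the coordinate `t`. -/
def lift {M : Type*} (φ : Circle × Plane → M) (q : Cover) : M :=
  φ (Circle.exp (2 * Real.pi * q 0), planePart q)

/-- The product metric `g₀` in the coordinates of the universal cover. -/
def productMetric : Cover →L[ℝ] Cover →L[ℝ] ℝ := innerSL ℝ (E := Cover)

/-- The unit tangent vector `∂/∂t` of the circle direction. -/
def circleDirection : Cover := EuclideanSpace.single 0 1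

/-- Two fields of bilinear forms on `ℝ³` are within `ε` in the `C^N`-topology on the open set `s`:
at each point of `s`, all derivatives of order at most `N` of the difference have norm at most
`ε`. -/
def IsCloseInCN (N : ℕ) (ε : ℝ) (s : Set Cover) (g₁ g₂ : Cover → Cover →L[ℝ] Cover →L[ℝ] ℝ) :
    Prop :=
  ∀ k ≤ N, ∀ q ∈ s, ‖iteratedFDeriv ℝ k (fun q' => g₁ q' - g₂ q') q‖ ≤ ε

section Riemannian

open Bundle

variable {H : Type*} [TopologicalSpace H] (I : ModelWithCorners ℝ (EuclideanSpace ℝ (Fin 3)) H)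
  {M : Type*} [EMetricSpace M] [ChartedSpace H M]
  [RiemannianBundle (fun x : M => TangentSpace I x)]

/-- The pullback of the Riemannian metric of `M` by a map `f` from `ℝ × ℝ²`, as a field of bilinear
forms: `(u, v) ↦ ⟨df u, df v⟩`. -/
def pullbackMetric (f : Cover → M) (q : Cover) : Cover →L[ℝ] Cover →L[ℝ] ℝ :=
  (innerSL ℝ (E := TangentSpace I (f q))).bilinearComp
    (mfderiv 𝓘(ℝ, Cover) I f q) (mfderiv 𝓘(ℝ, Cover) I f q)

/-- `φ` is an `S¹`-product structure with `ε`-control in `M`: a smooth embedding of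
`S¹ × B(0, ε⁻¹)` in `M` for which there is `c > 0` such that `φ^*(c g)` is within `ε` of the
product metric `g₀` in the `C^N`-topology, where `N = ⌊1/ε⌋`. As `g₀` is flat, its covariant
derivatives are the derivatives in the coordinates of the universal cover. The values of `φ` outside
`S¹ × B(0, ε⁻¹)` play no role. -/
structure IsProductStructure (ε : ℝ) (φ : Circle × Plane → M) : Prop where
  contMDiffOn : ContMDiffOn ((𝓡 1).prod (𝓡 2)) I ∞ φ (circleTimesBall ε⁻¹)
  isEmbedding : Topology.IsEmbedding ((circleTimesBall ε⁻¹).domRestrict φ)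
  injective_mfderiv : ∀ p ∈ circleTimesBall ε⁻¹,
    Function.Injective (mfderiv ((𝓡 1).prod (𝓡 2)) I φ p)
  exists_scale : ∃ c : ℝ, 0 < c ∧
    IsCloseInCN ⌊1 / ε⌋₊ ε {q | ‖planePart q‖ < ε⁻¹}
      (fun q => c • pullbackMetric I (lift φ) q) (fun _ => productMetric)

/-- `φ` is an `S¹`-product structure with `ε`-control centered at `x`. -/
def IsProductStructureAt (ε : ℝ) (φ : Circle × Plane → M) (x : M) : Prop :=
  IsProductStructure I ε φ ∧ ∃ z : Circle, φ (z, 0) = x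

/-- The length, in the metric of `M`, of the circle `φ (S¹ × {y})`. -/
def circleLength (φ : Circle × Plane → M) (y : Plane) : ENNReal :=
  pathELength I (fun t : ℝ => φ (Circle.exp (2 * Real.pi * t), y)) 0 1

/-- A map `p` from an open subset `V` of `M` to a surface `B` is a smooth `S¹`-fibration if it is a
smooth locally trivial bundle with fiber `S¹`: every point of `B` has an open neighborhood `W` with
a diffeomorphism `p⁻¹(W) ≃ W × S¹` whose first component is `p`. -/
def IsSmoothCircleFibration (V : TopologicalSpace.Opens M) {B : Type*} [TopologicalSpace B]
    [ChartedSpace Plane B] (p : V → B) : Prop :=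
  ∀ b : B, ∃ e : Trivialization Circle p, b ∈ e.baseSet ∧
    ContMDiffOn I ((𝓡 2).prod (𝓡 1)) ∞ e e.source ∧
    ContMDiffOn ((𝓡 2).prod (𝓡 1)) I ∞ e.toOpenPartialHomeomorph.symm e.target

/-- The fiber of `p : V → B` over `b`, as a subset of `M`. -/
def fiber {V : TopologicalSpace.Opens M} {B : Type*} (p : V → B) (b : B) : Set M :=
  Subtype.val '' (p ⁻¹' {b})

/-- The fiber of `p : V → B` over `b` is within `ε'` of vertical in the product structure `φ`:
at each of its points the angle (for the metric of `M`) between the tangent line of the fiber, which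
is the kernel of the differential of `p`, and the tangent line of the circle factor of `φ` through
that point is at most `ε'`, and the fiber lies within `ε'` of a circle factor `φ (S¹ × {y₀})`, in
the product metric `g₀`. -/
def IsNearlyVertical (ε ε' : ℝ) (φ : Circle × Plane → M) {V : TopologicalSpace.Opens M}
    {B : Type*} [TopologicalSpace B] [ChartedSpace Plane B] (p : V → B) (b : B) : Prop :=
  (∀ (q : Cover) (hV : lift φ q ∈ V), ‖planePart q‖ < ε⁻¹ → p ⟨lift φ q, hV⟩ = b →
    ∀ v : TangentSpace I (⟨lift φ q, hV⟩ : V), mfderiv I (𝓡 2) p ⟨lift φ q, hV⟩ v = 0 → v ≠ 0 →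
      let w : TangentSpace I (lift φ q) :=
        mfderiv I I (Subtype.val : V → M) ⟨lift φ q, hV⟩ v
      let t : TangentSpace I (lift φ q) := mfderiv 𝓘(ℝ, Cover) I (lift φ) q circleDirection
      min (InnerProductGeometry.angle w t) (Real.pi - InnerProductGeometry.angle w t) ≤ ε') ∧
  ∃ y₀ ∈ Metric.ball (0 : Plane) ε⁻¹,
    fiber p b ⊆ φ '' (univ ×ˢ (Metric.ball 0 ε⁻¹ ∩ Metric.closedBall y₀ ε'))

end Riemannian

/-- A circle `F ⊆ U` generates the fundamental group of `U`: as `π₁(F)` is generated by the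
class of `F`, this says that the inclusion induces a surjection of fundamental groups. -/
def GeneratesFundamentalGroup {X : Type*} [TopologicalSpace X] {F U : Set X} (h : F ⊆ U) : Prop :=
  ∀ x : F, Function.Surjective
    (FundamentalGroup.map (⟨Set.inclusion h, continuous_inclusion h⟩ : C(F, U)) x)

end CircleCollapse

end

/-! Every tube is unrolled to the universal cover ℝ × ℝ² of its domain, where the rescaled metric is
`C¹`-close to the Euclidean one; only the orders 0 and 1 of the control are used. Where two tubes
overlap, the change of coordinates pulls back one such metric to a constant multiple s² of another.
Koszul's formula bounds its second derivative by a multiple of ε (`norm_second_fderiv_le`), so on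
bounded regions it is almost affine. A circle of the first tube, followed once in the second, ends
at an integral shift of its starting point, and this integer cannot be 0 because the differential is
almost s times an isometry. Hence s is at least about 1, and by symmetry s is close to 1
(`FlatTube.scale_ge`, `FlatTube.scale_le`). The integer is then ±1, and the transition is close to
the product of ±1 and an almost isometry of the plane (`FlatTube.exists_transition`). Once it is cut
off to be defined on the whole cover, the construction of the fibers needs no metric any more
(`TubeFamily`).

A fibration is recorded by the sets F x, which locally are level sets of a map h that is `C¹`-close
to the projection to the plane and is normalized to be the identity on the slice {0} × ℝ². To extend
it over one more tube, the projection of that tube is interpolated, by means of a cutoff, with the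
point where the old fiber crosses the slice: where the cutoff is 1 the new level sets are the old
fibers, where it is 0 the projection is unchanged (`IsFibration.exists_modification`,
`IsFibration.extend`). Each extension multiplies the error by a constant, so the number of
extensions must not depend on M, K or ε. Therefore a separated subfamily of the tubes is coloured so
that tubes of one colour are disjoint and can be treated at once; packing in the plane bounds the
number of colours. The total error is δ = `fibrationRatio` * (10 ^ 7 * ε).

The base B is the leaf space of the resulting foliation by circles (`CircleFoliation`). For the
properties of the fibers, a fiber is lifted to an arbitrary tube that contains it
(`FlatTube.exists_leaf_lift`). The lift is shifted by ±1 after one turn, so the fiber generates the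
fundamental group; its planar coordinate moves by at most 12 ε + 3 δ and its tangent is almost the
circle direction, so the fiber is nearly vertical. The bound on the diameter compares the length of
a leaf with that of a circle, using that the ratio of the scales of the two tubes is close to 1. -/

namespace CircleCollapse

noncomputable section

/-! ### The cover ℝ × ℝ² and periodic maps close to its projection to the plane -/

/-- The projection `ℝ × ℝ² → ℝ²` as a continuous linear map. -/
def planeL : Cover →L[ℝ] Plane :=
  LinearMap.toContinuousLinearMap
    { toFun := planePart
      map_add' := fun x y => by ext i; fin_cases i <;> simp [planePart]
      map_smul' := fun c x => by ext i; fin_cases i <;> simp [planePart] }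

/-- The inclusion of `ℝ²` as the slice `{0} × ℝ²`. -/
def sliceL : Plane →L[ℝ] Cover :=
  LinearMap.toContinuousLinearMap
    { toFun := fun y => !₂[0, y 0, y 1]
      map_add' := fun x y => by ext i; fin_cases i <;> simp
      map_smul' := fun c x => by ext i; fin_cases i <;> simp }

/-- The coordinate `t` as a continuous linear form. -/
def heightL : Cover →L[ℝ] ℝ := EuclideanSpace.proj 0

theorem heightL_apply (q : Cover) : heightL q = q 0 := rfl

@[simp] theorem planeL_sliceL (y : Plane) : planeL (sliceL y) = y := by
  ext i; fin_cases i <;> simp [planeL, sliceL, planePart]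

@[simp] theorem sliceL_zero_coord (y : Plane) : (sliceL y) 0 = 0 := by
  simp [sliceL]

@[simp] theorem circleDirection_zero_coord : circleDirection 0 = 1 := by
  simp [circleDirection]

@[simp] theorem planeL_circleDirection : planeL circleDirection = 0 := by
  ext i; fin_cases i <;> simp [planeL, planePart, circleDirection]

@[simp] theorem norm_circleDirection : ‖circleDirection‖ = 1 := by
  simp [circleDirection]

theorem cover_decomp (q : Cover) : q 0 • circleDirection + sliceL (planeL q) = q := by
  ext i; fin_cases i <;> simp [planeL, planePart, circleDirection, sliceL]

theorem cover_norm_sq (q : Cover) : ‖q‖ ^ 2 = (q 0) ^ 2 + ‖planeL q‖ ^ 2 := by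
  simp [EuclideanSpace.norm_sq_eq, planeL, planePart, Fin.sum_univ_succ]


theorem norm_planeL_apply_le (q : Cover) : ‖planeL q‖ ≤ ‖q‖ := by
  have := cover_norm_sq q
  exact abs_le_of_sq_le_sq' (by nlinarith [sq_nonneg (q 0)]) (norm_nonneg _) |>.2

theorem norm_planeL_le : ‖planeL‖ ≤ 1 :=
  ContinuousLinearMap.opNorm_le_bound _ zero_le_one fun q => by
    simpa using norm_planeL_apply_le q

@[simp] theorem norm_sliceL_apply (y : Plane) : ‖sliceL y‖ = ‖y‖ := by
  have := cover_norm_sq (sliceL y)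
  simp only [sliceL_zero_coord, planeL_sliceL] at this
  exact (sq_eq_sq₀ (norm_nonneg _) (norm_nonneg _)).1 (by linarith)

theorem norm_sliceL_le : ‖sliceL‖ ≤ 1 :=
  ContinuousLinearMap.opNorm_le_bound _ zero_le_one fun q => by simp

theorem abs_height_le (q : Cover) : |q 0| ≤ ‖q‖ := by
  have := cover_norm_sq q
  exact abs_le_of_sq_le_sq (by nlinarith [sq_nonneg ‖planeL q‖]) (norm_nonneg _)

theorem cover_norm_le (q : Cover) : ‖q‖ ≤ |q 0| + ‖planeL q‖ := by
  have := cover_norm_sq q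
  refine abs_le_of_sq_le_sq' ?_ (by positivity) |>.2
  rw [this, add_sq, sq_abs]
  have := mul_nonneg (abs_nonneg (q 0)) (norm_nonneg (planeL q))
  nlinarith

theorem cover_ext {q q' : Cover} (h0 : q 0 = q' 0) (h1 : planeL q = planeL q') : q = q' := by
  rw [← cover_decomp q, ← cover_decomp q', h0, h1]

/-- A function on the cover that is invariant under the shift by `e₀` is invariant under all
integral shifts. -/
theorem shift_int {X : Type*} {f : Cover → X} (hf : ∀ q, f (q + circleDirection) = f q)
    (q : Cover) (n : ℤ) : f (q + (n : ℝ) • circleDirection) = f q := by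
  induction n using Int.induction_on with
  | zero => simp
  | succ n ih =>
    rw [← ih, ← hf (q + ((n : ℤ) : ℝ) • circleDirection)]
    congr 1; push_cast; module
  | pred n ih =>
    rw [← ih, ← hf (q + ((-(n : ℤ) - 1 : ℤ) : ℝ) • circleDirection)]
    congr 1; push_cast; module

theorem planeL_shift (q : Cover) (a : ℝ) : planeL (q + a • circleDirection) = planeL q := by
  simp

/-- Smooth maps `ℝ × ℝ² → ℝ²`, invariant under the unit shift of `ℝ`, which are `C¹`-close to the
projection and equal to it on the slice `{0} × ℝ²`. -/
structure NearPlane (δ : ℝ) (h : Cover → Plane) : Prop where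
  contDiff : ContDiff ℝ ∞ h
  shift : ∀ q, h (q + circleDirection) = h q
  fderiv_le : ∀ q, ‖fderiv ℝ h q - planeL‖ ≤ δ
  slice : ∀ y, h (sliceL y) = y

namespace NearPlane

variable {δ : ℝ} {h : Cover → Plane}

theorem mono (H : NearPlane δ h) {δ' : ℝ} (hd : δ ≤ δ') : NearPlane δ' h :=
  ⟨H.contDiff, H.shift, fun q => (H.fderiv_le q).trans hd, H.slice⟩

theorem nonneg (H : NearPlane δ h) : 0 ≤ δ := (norm_nonneg _).trans (H.fderiv_le 0)

theorem differentiable (H : NearPlane δ h) : Differentiable ℝ h :=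
  H.contDiff.differentiable (by simp)

theorem sub_le (H : NearPlane δ h) (q q' : Cover) :
    ‖h q - h q' - planeL (q - q')‖ ≤ δ * ‖q - q'‖ := by
  have := Convex.norm_image_sub_le_of_norm_hasFDerivWithin_le' (f := h) (f' := fderiv ℝ h)
    (φ := planeL) (s := univ) (x := q') (y := q) (C := δ)
    (fun x _ => (H.differentiable x).hasFDerivAt.hasFDerivWithinAt)
    (fun x _ => H.fderiv_le x) convex_univ trivial trivial
  exact this

/-- An integral shift brings the height into [0, 1). There the slice, on which h agrees with the
projection, is at distance less than 1, and the derivative bound integrates to δ. -/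
theorem close (H : NearPlane δ h) (q : Cover) : ‖h q - planeL q‖ ≤ δ := by
  set q' : Cover := q + ((-⌊q 0⌋ : ℤ) : ℝ) • circleDirection with hq'
  have h1 : h q' = h q := shift_int H.shift q _
  have h2 : planeL q' = planeL q := planeL_shift _ _
  have h3 : q' 0 = Int.fract (q 0) := by
    simp only [hq', Int.fract, PiLp.add_apply, PiLp.smul_apply, circleDirection_zero_coord,
      smul_eq_mul, mul_one]
    push_cast; ring
  have h4 := H.sub_le q' (sliceL (planeL q'))
  rw [H.slice, map_sub, planeL_sliceL, sub_self, sub_zero, h1, h2] at h4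
  refine h4.trans ?_
  have h5 : q' - sliceL (planeL q) = q' 0 • circleDirection := by
    rw [sub_eq_iff_eq_add, ← h2, cover_decomp]
  rw [h5, norm_smul, norm_circleDirection, mul_one, h3, Real.norm_eq_abs,
    abs_of_nonneg (Int.fract_nonneg _)]
  exact mul_le_of_le_one_right H.nonneg (Int.fract_lt_one _).le

/-- The map `q ↦ (q₀, h q)` of the cover to itself. -/
def straighten (h : Cover → Plane) (q : Cover) : Cover := q 0 • circleDirection + sliceL (h q)

theorem straighten_zero_coord (q : Cover) : straighten h q 0 = q 0 := by
  simp [straighten]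

theorem planeL_straighten (q : Cover) : planeL (straighten h q) = h q := by
  simp [straighten]

theorem straighten_sub_le (H : NearPlane δ h) (q q' : Cover) :
    ‖straighten h q - straighten h q' - (q - q')‖ ≤ δ * ‖q - q'‖ := by
  have : straighten h q - straighten h q' - (q - q') =
      sliceL (h q - h q' - planeL (q - q')) := by
    refine cover_ext ?_ ?_
    · simp [straighten]
    · simp [straighten]
  rw [this, norm_sliceL_apply]
  exact H.sub_le q q'

/-- A perturbation of the identity with Lipschitz constant δ < 1 is a global homeomorphism. This
makes each level set of h a graph over the height axis. -/
theorem approximatesLinearOn (H : NearPlane δ h) :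
    ApproximatesLinearOn (straighten h)
      ((ContinuousLinearEquiv.refl ℝ Cover : Cover ≃L[ℝ] Cover) : Cover →L[ℝ] Cover) univ
      ⟨δ, H.nonneg⟩ := by
  intro q _ q' _
  exact H.straighten_sub_le q q'

theorem contDiff_straighten (H : NearPlane δ h) : ContDiff ℝ ∞ (straighten h) := by
  have h1 : ContDiff ℝ ∞ (fun q : Cover => q 0) := heightL.contDiff
  exact (h1.smul contDiff_const).add (sliceL.contDiff.comp H.contDiff)

/-- The diffeomorphism `q ↦ (q₀, h q)` of the cover. -/
def homeo (H : NearPlane δ h) (hδ : δ < 1) : Cover ≃ₜ Cover :=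
  H.approximatesLinearOn.toHomeomorph _ (Or.inr (by
    rw [ContinuousLinearEquiv.refl_symm, ContinuousLinearEquiv.coe_refl,
      ContinuousLinearMap.nnnorm_id, inv_one]
    exact_mod_cast hδ))

theorem homeo_apply (H : NearPlane δ h) (hδ : δ < 1) (q : Cover) :
    H.homeo hδ q = straighten h q := rfl

theorem homeo_symm_zero_coord (H : NearPlane δ h) (hδ : δ < 1) (q : Cover) :
    (H.homeo hδ).symm q 0 = q 0 := by
  conv_rhs => rw [← (H.homeo hδ).apply_symm_apply q, homeo_apply, straighten_zero_coord]

theorem apply_homeo_symm (H : NearPlane δ h) (hδ : δ < 1) (q : Cover) :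
    h ((H.homeo hδ).symm q) = planeL q := by
  conv_rhs => rw [← (H.homeo hδ).apply_symm_apply q, homeo_apply, planeL_straighten]

theorem eq_of_height (H : NearPlane δ h) (hδ : δ < 1) {q q' : Cover} (h0 : q 0 = q' 0)
    (h1 : h q = h q') : q = q' := by
  apply (H.homeo hδ).injective
  simp [homeo_apply, straighten, h0, h1]

theorem exists_height (H : NearPlane δ h) (hδ : δ < 1) (t : ℝ) (c : Plane) :
    ∃ q : Cover, q 0 = t ∧ h q = c :=
  ⟨(H.homeo hδ).symm (t • circleDirection + sliceL c), by simp [homeo_symm_zero_coord],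
    by simp [apply_homeo_symm]⟩

theorem homeo_symm_shift (H : NearPlane δ h) (hδ : δ < 1) (q : Cover) :
    (H.homeo hδ).symm (q + circleDirection) = (H.homeo hδ).symm q + circleDirection := by
  apply H.eq_of_height hδ
  · simp [homeo_symm_zero_coord]
  · simp [H.shift, apply_homeo_symm]

/-- The differential of `straighten h` is bounded below by 1 - δ, hence invertible, and the inverse
function theorem applies at each point. -/
theorem contDiff_homeo_symm (H : NearPlane δ h) (hδ : δ < 1) :
    ContDiff ℝ ∞ (H.homeo hδ).symm := by
  have hpos : ∀ q v, (1 - δ) * ‖v‖ ≤ ‖fderiv ℝ (straighten h) q v‖ := by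
    intro q v
    have hs : HasFDerivAt (straighten h)
        ((ContinuousLinearMap.smulRight heightL circleDirection) + sliceL.comp (fderiv ℝ h q)) q := by
      have h1 : HasFDerivAt (fun q : Cover => q 0 • circleDirection)
          (ContinuousLinearMap.smulRight heightL circleDirection) q :=
        (ContinuousLinearMap.smulRight heightL circleDirection).hasFDerivAt
      exact h1.add (sliceL.hasFDerivAt.comp q (H.differentiable q).hasFDerivAt)
    rw [hs.fderiv]
    have h2 : ((ContinuousLinearMap.smulRight heightL circleDirection) +
        sliceL.comp (fderiv ℝ h q)) v = v + sliceL ((fderiv ℝ h q - planeL) v) := by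
      have := cover_decomp v
      simp only [add_apply, ContinuousLinearMap.smulRight_apply, heightL_apply,
        ContinuousLinearMap.comp_apply, sub_apply, map_sub]
      calc v 0 • circleDirection + sliceL (fderiv ℝ h q v)
          = (v 0 • circleDirection + sliceL (planeL v)) +
            (sliceL (fderiv ℝ h q v) - sliceL (planeL v)) := by abel
        _ = _ := by rw [cover_decomp]
    rw [h2]
    have h3 : ‖sliceL ((fderiv ℝ h q - planeL) v)‖ ≤ δ * ‖v‖ := by
      rw [norm_sliceL_apply]
      exact ContinuousLinearMap.le_of_opNorm_le _ (H.fderiv_le q) v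
    have h4 := norm_sub_norm_le v (-sliceL ((fderiv ℝ h q - planeL) v))
    rw [norm_neg, sub_neg_eq_add] at h4
    linarith
  rw [contDiff_iff_contDiffAt]
  intro q
  have hinj : Function.Injective (fderiv ℝ (straighten h) ((H.homeo hδ).symm q)) := by
    rw [injective_iff_map_eq_zero]
    intro v hv
    have := hpos ((H.homeo hδ).symm q) v
    rw [hv, norm_zero] at this
    have : ‖v‖ ≤ 0 := by nlinarith [norm_nonneg v]
    simpa using this
  let e : Cover ≃L[ℝ] Cover := (LinearEquiv.ofInjectiveEndo
    (fderiv ℝ (straighten h) ((H.homeo hδ).symm q) : Cover →ₗ[ℝ] Cover) hinj).toContinuousLinearEquiv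
  have he : HasFDerivAt (H.homeo hδ) (e : Cover →L[ℝ] Cover) ((H.homeo hδ).symm q) := by
    have h1 : DifferentiableAt ℝ (straighten h) ((H.homeo hδ).symm q) :=
      (H.contDiff_straighten.differentiable (by simp)) _
    exact h1.hasFDerivAt
  exact (H.homeo hδ).toOpenPartialHomeomorph.contDiffAt_symm (mem_univ _) he
    H.contDiff_straighten.contDiffAt

end NearPlane

end

end CircleCollapse

/-! ### Transitions between tubes and charts of a fibration -/

namespace CircleCollapse

noncomputable section

/-- A smooth self-map of a finite-dimensional space that is uniformly `C¹`-close to an expanding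
linear map is a diffeomorphism. -/
theorem exists_smooth_inverse {E : Type*} [NormedAddCommGroup E] [NormedSpace ℝ E]
    [FiniteDimensional ℝ E] {g : E → E} (hg : ContDiff ℝ ∞ g) {A : E →L[ℝ] E} {a c : ℝ}
    (hc : 0 ≤ c) (hca : c < a) (hA : ∀ v, a * ‖v‖ ≤ ‖A v‖) (hgA : ∀ x, ‖fderiv ℝ g x - A‖ ≤ c) :
    ∃ G : E → E, ContDiff ℝ ∞ G ∧ (∀ x, G (g x) = x) ∧ ∀ x, g (G x) = x := by
  have : CompleteSpace E := FiniteDimensional.complete ℝ E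
  have ha : 0 < a := hc.trans_lt hca
  have mkEquiv : ∀ {b : ℝ} (_ : 0 < b) (B : E →L[ℝ] E), (∀ v, b * ‖v‖ ≤ ‖B v‖) →
      ∃ e : E ≃L[ℝ] E, (e : E →L[ℝ] E) = B := by
    intro b hb B hB
    have hinj : Function.Injective (B : E →ₗ[ℝ] E) := by
      rw [injective_iff_map_eq_zero]
      intro v hv
      have h1 := hB v
      rw [show B v = 0 from hv, norm_zero] at h1
      have : ‖v‖ ≤ 0 := by nlinarith [norm_nonneg v]
      simpa using this
    exact ⟨(LinearEquiv.ofInjectiveEndo (B : E →ₗ[ℝ] E) hinj).toContinuousLinearEquiv, by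
      ext v; rfl⟩
  obtain ⟨e, he⟩ := mkEquiv ha A hA
  have hd : Differentiable ℝ g := hg.differentiable (by simp)
  have happ : ApproximatesLinearOn g (e : E →L[ℝ] E) univ ⟨c, hc⟩ := by
    intro x _ y _
    rw [he]
    exact Convex.norm_image_sub_le_of_norm_hasFDerivWithin_le' (f := g) (f' := fderiv ℝ g)
      (φ := A) (s := univ) (x := y) (y := x) (C := c)
      (fun x _ => (hd x).hasFDerivAt.hasFDerivWithinAt)
      (fun x _ => hgA x) convex_univ trivial trivial
  have hsymm : ‖(e.symm : E →L[ℝ] E)‖ ≤ a⁻¹ := by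
    refine ContinuousLinearMap.opNorm_le_bound _ (by positivity) fun v => ?_
    have h1 := hA (e.symm v)
    rw [← he] at h1
    have h2 : a * ‖e.symm v‖ ≤ ‖v‖ := by simpa using h1
    rw [inv_mul_eq_div, le_div_iff₀ ha, mul_comm]
    exact h2
  have hlt : Subsingleton E ∨ (⟨c, hc⟩ : NNReal) < ‖(e.symm : E →L[ℝ] E)‖₊⁻¹ := by
    rcases subsingleton_or_nontrivial E with h | h
    · exact Or.inl h
    · right
      have hpos : 0 < ‖(e.symm : E →L[ℝ] E)‖ := e.symm.norm_pos
      have h3 : c < ‖(e.symm : E →L[ℝ] E)‖⁻¹ := by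
        refine hca.trans_le ?_
        rw [le_inv_comm₀ ha hpos]
        exact hsymm
      exact_mod_cast h3
  let H := happ.toHomeomorph g hlt
  have hH : ∀ x, H x = g x := fun x => rfl
  refine ⟨H.symm, ?_, fun x => by rw [← hH]; simp, fun x => by rw [← hH]; simp⟩
  rw [contDiff_iff_contDiffAt]
  intro q
  obtain ⟨e', he'⟩ := mkEquiv (sub_pos.2 hca) (fderiv ℝ g (H.symm q)) (by
    intro v
    have h1 : ‖(fderiv ℝ g (H.symm q) - A) v‖ ≤ c * ‖v‖ :=
      ContinuousLinearMap.le_of_opNorm_le _ (hgA _) v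
    have h2 := norm_sub_norm_le (A v) (-(fderiv ℝ g (H.symm q) - A) v)
    rw [norm_neg, sub_neg_eq_add] at h2
    have h3 : A v + (fderiv ℝ g (H.symm q) - A) v = fderiv ℝ g (H.symm q) v := by simp
    rw [h3] at h2
    linarith [hA v])
  have he'' : HasFDerivAt H (e' : E →L[ℝ] E) (H.symm q) := by
    rw [he']; exact (hd _).hasFDerivAt
  exact H.toOpenPartialHomeomorph.contDiffAt_symm (mem_univ _) he'' hg.contDiffAt

variable {M : Type*}

/-- Lifts to the cover of parametrized solid tori in `M`. -/
structure TubeChart [TopologicalSpace M] (Φ : Cover → M) : Prop where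
  shift : ∀ q, Φ (q + circleDirection) = Φ q
  inj : ∀ q q', ‖planeL q‖ < 200 → ‖planeL q'‖ < 200 → Φ q = Φ q' →
    ∃ n : ℤ, q' = q + (n : ℝ) • circleDirection
  continuousAt : ∀ q, ‖planeL q‖ < 200 → ContinuousAt Φ q

/-- A transition between two tubes, defined on the whole cover, which is `C¹`-close to the product
of `±1` and an almost isometric linear map of the plane. -/
structure Transition (κ : ℝ) (Φ₁ Φ₂ : Cover → M) (T : Cover → Cover) (A : Plane →L[ℝ] Plane) :
    Prop where
  contDiff : ContDiff ℝ ∞ T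
  shift : (∀ q, T (q + circleDirection) = T q + circleDirection) ∨
    (∀ q, T (q + circleDirection) = T q - circleDirection)
  surjective : Function.Surjective T
  comp_eq : ∀ q, ‖planeL q‖ < 200 → Φ₂ (T q) = Φ₁ q
  norm_fderiv_le : ∀ q, ‖fderiv ℝ T q‖ ≤ 2
  fderiv_close : ∀ q, ‖planeL.comp (fderiv ℝ T q) - A.comp planeL‖ ≤ κ
  lower : ∀ y, (1 - κ) * ‖y‖ ≤ ‖A y‖
  upper : ∀ y, ‖A y‖ ≤ (1 + κ) * ‖y‖

namespace Transition

variable {κ : ℝ} {Φ₁ Φ₂ : Cover → M} {T : Cover → Cover} {A : Plane →L[ℝ] Plane}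

theorem nonneg (H : Transition κ Φ₁ Φ₂ T A) : 0 ≤ κ := (norm_nonneg _).trans (H.fderiv_close 0)

theorem differentiable (H : Transition κ Φ₁ Φ₂ T A) : Differentiable ℝ T :=
  H.contDiff.differentiable (by simp)

theorem invariant_comp (H : Transition κ Φ₁ Φ₂ T A) {X : Type*} {f : Cover → X}
    (hf : ∀ q, f (q + circleDirection) = f q) (q : Cover) :
    f (T (q + circleDirection)) = f (T q) := by
  rcases H.shift with h | h
  · rw [h, hf]
  · rw [h, ← hf, sub_add_cancel]

theorem plane_sub_le (H : Transition κ Φ₁ Φ₂ T A) (q q' : Cover) :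
    ‖planeL (T q) - planeL (T q') - A (planeL (q - q'))‖ ≤ κ * ‖q - q'‖ := by
  have := Convex.norm_image_sub_le_of_norm_hasFDerivWithin_le' (f := fun q => planeL (T q))
    (f' := fun q => planeL.comp (fderiv ℝ T q))
    (φ := A.comp planeL) (s := univ) (x := q') (y := q) (C := κ)
    (fun x _ => (planeL.hasFDerivAt.comp x (H.differentiable x).hasFDerivAt).hasFDerivWithinAt)
    (fun x _ => H.fderiv_close x) convex_univ trivial trivial
  exact this

/-- The planar part of T is periodic, so the heights may be assumed to differ by less than 1; the
additive κ pays for this remaining difference. -/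
theorem plane_dist_le (H : Transition κ Φ₁ Φ₂ T A) (q q' : Cover) :
    ‖planeL (T q) - planeL (T q')‖ ≤ (1 + 2 * κ) * ‖planeL q - planeL q'‖ + κ := by
  have hper : ∀ q, planeL (T (q + circleDirection)) = planeL (T q) :=
    H.invariant_comp (f := fun q => planeL q) (by simp)
  set q₁ : Cover := q + ((-⌊q 0 - q' 0⌋ : ℤ) : ℝ) • circleDirection with hq₁
  have h1 : planeL (T q₁) = planeL (T q) := shift_int (f := fun q => planeL (T q)) hper q _
  have h2 : planeL q₁ = planeL q := planeL_shift _ _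
  have h3 : (q₁ - q') 0 = Int.fract (q 0 - q' 0) := by
    simp only [hq₁, Int.fract, PiLp.add_apply, PiLp.smul_apply, PiLp.sub_apply,
      circleDirection_zero_coord, smul_eq_mul, mul_one]
    push_cast; ring
  have h4 := H.plane_sub_le q₁ q'
  have h5 := cover_norm_le (q₁ - q')
  rw [h3, abs_of_nonneg (Int.fract_nonneg _), map_sub, h2] at h5
  rw [map_sub, h1, h2] at h4
  have h6 := norm_le_norm_add_norm_sub' (planeL (T q) - planeL (T q')) (A (planeL q - planeL q'))
  have h7 := H.upper (planeL q - planeL q')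
  have h8 := Int.fract_lt_one (q 0 - q' 0)
  have h9 : κ * ‖q₁ - q'‖ ≤ κ * (1 + ‖planeL q - planeL q'‖) :=
    mul_le_mul_of_nonneg_left (by linarith) H.nonneg
  linarith

/-- Between points of the slice there is no difference of heights, so the estimate is purely
multiplicative and stays useful at small distances. -/
theorem slice_dist_le (H : Transition κ Φ₁ Φ₂ T A) (y y' : Plane) :
    ‖planeL (T (sliceL y)) - planeL (T (sliceL y'))‖ ≤ (1 + 2 * κ) * ‖y - y'‖ := by
  have h4 := H.plane_sub_le (sliceL y) (sliceL y')
  rw [← map_sub sliceL, planeL_sliceL, norm_sliceL_apply] at h4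
  have h6 := norm_le_norm_add_norm_sub' (planeL (T (sliceL y)) - planeL (T (sliceL y')))
    (A (y - y'))
  linarith [H.upper (y - y')]

end Transition

/-- A chart of a fibration of `V ⊆ M`, the fiber through `x ∈ V` being `F x`, around the fiber
through `Φ q₀`: in the tube `Φ` the fibers are the level sets of `h`. -/
structure FibChart (Φ : Cover → M) (V : Set M) (F : M → Set M) (δ : ℝ) (q₀ : Cover)
    (h : Cover → Plane) (ρ : ℝ) : Prop where
  near : NearPlane δ h
  pos : 0 < ρ
  le_one : ρ ≤ 1
  chart : ∀ q, ‖h q - h q₀‖ < ρ → Φ q ∈ V ∧ F (Φ q) = Φ '' {q' | h q' = h q}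

theorem FibChart.fiber_eq {Φ : Cover → M} {V : Set M} {F : M → Set M} {δ : ℝ} {q₀ : Cover}
    {h : Cover → Plane} {ρ : ℝ} (H : FibChart Φ V F δ q₀ h ρ) :
    F (Φ q₀) = Φ '' {q' | h q' = h q₀} :=
  (H.chart q₀ (by simpa using H.pos)).2

/-- The level sets of a chart of a fibration are the level sets of a chart in any other tube. -/
theorem FibChart.transfer [TopologicalSpace M] {Φ₁ Φ₂ : Cover → M} {V : Set M} {F : M → Set M}
    {δ κ : ℝ} {q₁ q₂ : Cover} {h : Cover → Plane} {ρ : ℝ} {T : Cover → Cover}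
    {A : Plane →L[ℝ] Plane} (H₁ : TubeChart Φ₁)
    (HT : Transition κ Φ₂ Φ₁ T A) (H : FibChart Φ₁ V F δ q₁ h ρ) (hκ : κ ≤ δ)
    (hδ : δ ≤ 1 / 100) (hq₁ : ‖planeL q₁‖ < 100) (hq₂ : ‖planeL q₂‖ < 150)
    (hTq : ‖planeL (T q₂)‖ < 200) (he : Φ₁ q₁ = Φ₂ q₂) :
    ∃ h', FibChart Φ₂ V F (12 * δ) q₂ h' (ρ / 2) := by
  have hδ0 : 0 ≤ δ := H.near.nonneg
  have hκ0 : 0 ≤ κ := HT.nonneg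
  set g : Cover → Plane := fun q => h (T q) with hgdef
  have hgs : ContDiff ℝ ∞ g := H.near.contDiff.comp HT.contDiff
  have hgd : Differentiable ℝ g := hgs.differentiable (by simp)
  have hgshift : ∀ q, g (q + circleDirection) = g q := HT.invariant_comp H.near.shift
  have hgA : ∀ q, ‖fderiv ℝ g q - A.comp planeL‖ ≤ 3 * δ := by
    intro q
    have h1 : fderiv ℝ g q = (fderiv ℝ h (T q)).comp (fderiv ℝ T q) :=
      fderiv_comp q (H.near.differentiable _) (HT.differentiable q)
    have h2 : fderiv ℝ g q - A.comp planeL = (fderiv ℝ h (T q) - planeL).comp (fderiv ℝ T q) +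
        (planeL.comp (fderiv ℝ T q) - A.comp planeL) := by
      rw [h1, ContinuousLinearMap.sub_comp]; abel
    rw [h2]
    refine (norm_add_le _ _).trans ?_
    have h3 := (fderiv ℝ h (T q) - planeL).opNorm_comp_le (fderiv ℝ T q)
    have h4 := mul_le_mul (H.near.fderiv_le (T q)) (HT.norm_fderiv_le q) (norm_nonneg _) hδ0
    linarith [HT.fderiv_close q]
  -- The pulled back map g has the right level sets but is not the identity on the slice. Composing
  -- with the inverse of its restriction g₀ to the slice normalizes it without changing the level
  -- sets.
  set g₀ : Plane → Plane := fun y => g (sliceL y) with hg₀def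
  have hg₀s : ContDiff ℝ ∞ g₀ := hgs.comp sliceL.contDiff
  have hg₀d : ∀ y, fderiv ℝ g₀ y = (fderiv ℝ g (sliceL y)).comp sliceL := fun y =>
    ((hgd _).hasFDerivAt.comp y sliceL.hasFDerivAt).fderiv
  have hg₀A : ∀ y, ‖fderiv ℝ g₀ y - A‖ ≤ 3 * δ := by
    intro y
    have h1 : fderiv ℝ g₀ y - A = (fderiv ℝ g (sliceL y) - A.comp planeL).comp sliceL := by
      rw [hg₀d]; ext v; simp
    rw [h1]
    refine (ContinuousLinearMap.opNorm_comp_le _ _).trans ?_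
    have := mul_le_mul (hgA (sliceL y)) norm_sliceL_le (norm_nonneg _) (by linarith)
    linarith
  have hAlow : ∀ v, (1 / 2 : ℝ) * ‖v‖ ≤ ‖A v‖ := fun v =>
    (mul_le_mul_of_nonneg_right (by linarith) (norm_nonneg v)).trans (HT.lower v)
  obtain ⟨G, hGs, hG1, hG2⟩ := exists_smooth_inverse hg₀s (c := 3 * δ) (by linarith)
    (by linarith) hAlow hg₀A
  set h' : Cover → Plane := fun q => G (g q) with hh'def
  have hg₀h' : ∀ q, g₀ (h' q) = g q := fun q => hG2 _
  have hh's : ContDiff ℝ ∞ h' := hGs.comp hgs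
  have hh'd : Differentiable ℝ h' := hh's.differentiable (by simp)
  have hg₀diff : Differentiable ℝ g₀ := hg₀s.differentiable (by simp)
  have hnear : NearPlane (12 * δ) h' := by
    refine ⟨hh's, fun q => by simp only [hh'def, hgshift], fun q => ?_, fun y => hG1 y⟩
    have h1 : (fderiv ℝ g₀ (h' q)).comp (fderiv ℝ h' q) = fderiv ℝ g q := by
      rw [← fderiv_comp q (hg₀diff _) (hh'd q)]
      congr 1
      ext1 q; exact hg₀h' q
    refine ContinuousLinearMap.opNorm_le_bound _ (by linarith) fun v => ?_
    set w := (fderiv ℝ h' q - planeL) v with hw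
    -- Differentiating g₀ ∘ h' = g expresses A w through small terms: at most 3 δ from g, and 3 δ
    -- from g₀ applied to each of `planeL v` and w. Absorbing the term in w leaves the factor 1/2 on
    -- the left, whence 2 · 6 δ = 12 δ.
    have h2 : A w = (fderiv ℝ g q - A.comp planeL) v + (A - fderiv ℝ g₀ (h' q)) (planeL v)
        + (A - fderiv ℝ g₀ (h' q)) w := by
      rw [← h1, hw]; simp
    have h3 := ContinuousLinearMap.le_of_opNorm_le _ (hgA q) v
    have h4'' : ‖A - fderiv ℝ g₀ (h' q)‖ ≤ 3 * δ := by rw [norm_sub_rev]; exact hg₀A _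
    have h4 := ContinuousLinearMap.le_of_opNorm_le _ h4'' (planeL v)
    have h4' := ContinuousLinearMap.le_of_opNorm_le _ h4'' w
    have h5 := HT.lower w
    rw [h2] at h5
    have h6 := h5.trans ((norm_add_le _ _).trans (add_le_add_left (norm_add_le _ _) _))
    have h7 := mul_le_mul_of_nonneg_left (norm_planeL_apply_le v) hδ0
    have h8 : (1 / 2 : ℝ) * ‖w‖ ≤ (1 - κ - 3 * δ) * ‖w‖ :=
      mul_le_mul_of_nonneg_right (by linarith) (norm_nonneg w)
    linarith
  have hlevel : ∀ q q', h' q = h' q' ↔ g q = g q' := by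
    intro q q'
    constructor
    · intro h; rw [← hg₀h' q, h, hg₀h']
    · intro h; simp only [hh'def, h]
  -- T q₂ and q₁ lie over the same point of M, so they differ by an integral shift, which h ignores.
  have hgq : g q₂ = h q₁ := by
    obtain ⟨n, hn⟩ := H₁.inj q₁ (T q₂) (by linarith) hTq (by rw [he, HT.comp_eq q₂ (by linarith)])
    simp only [hgdef, hn]
    exact shift_int H.near.shift _ _
  have hbound : ∀ q, ‖h' q - h' q₂‖ < ρ / 2 → ‖planeL q‖ < 200 := by
    intro q hq
    have h1 := hnear.close q
    have h2 := hnear.close q₂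
    have h3 : planeL q = -(h' q - planeL q) + (h' q - h' q₂) + (h' q₂ - planeL q₂) + planeL q₂ := by
      abel
    rw [h3]
    have h4 := norm_add₄_le (a := -(h' q - planeL q)) (b := h' q - h' q₂) (c := h' q₂ - planeL q₂)
      (d := planeL q₂)
    rw [norm_neg] at h4
    linarith [H.le_one]
  refine ⟨h', hnear, by linarith [H.pos], by linarith [H.le_one], fun q hq => ?_⟩
  -- As g₀ is 2-Lipschitz, half the radius for h' stays within the radius ρ for h.
  have hlip : ‖g q - g q₂‖ ≤ 2 * ‖h' q - h' q₂‖ := by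
    rw [← hg₀h' q, ← hg₀h' q₂]
    refine Convex.norm_image_sub_le_of_norm_fderiv_le (𝕜 := ℝ) (s := univ) (fun x _ => hg₀diff x)
      (fun x _ => ?_) convex_univ trivial trivial
    have h1 : ‖A‖ ≤ 1 + κ := ContinuousLinearMap.opNorm_le_bound _ (by linarith) HT.upper
    have h2 := norm_le_norm_add_norm_sub' (fderiv ℝ g₀ x) A
    linarith [hg₀A x]
  have hch := H.chart (T q) (by
    have : ‖g q - g q₂‖ < ρ := by linarith
    rwa [hgq] at this)
  rw [HT.comp_eq q (hbound q hq)] at hch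
  refine ⟨hch.1, hch.2.trans ?_⟩
  ext x
  constructor
  · rintro ⟨p, hp, rfl⟩
    obtain ⟨q', rfl⟩ := HT.surjective p
    have h1 : h' q' = h' q := (hlevel _ _).2 hp
    refine ⟨q', h1, ?_⟩
    rw [HT.comp_eq]
    exact hbound q' (by rw [h1]; exact hq)
  · rintro ⟨q', hq', rfl⟩
    refine ⟨T q', (hlevel _ _).1 hq', ?_⟩
    rw [HT.comp_eq]
    exact hbound q' (by rw [show h' q' = h' q from hq']; exact hq)

end

end CircleCollapse

/-! ### Cutoff functions in the plane -/

namespace CircleCollapse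

noncomputable section

open MeasureTheory in
/-- A smooth cutoff function for a set in the plane with a gradient bound. -/
theorem exists_cutoff (S : Set Plane) {η : ℝ} (hη : 0 < η) :
    ∃ χ : Plane → ℝ, ContDiff ℝ ∞ χ ∧ (∀ y, |χ y| ≤ 1) ∧
      (∀ y ∈ Metric.thickening η S, χ y = 1) ∧
      (∀ y, χ y ≠ 0 → y ∈ Metric.thickening (4 * η) S) ∧ ∀ y, ‖fderiv ℝ χ y‖ ≤ η⁻¹ := by
  have hη0 : (0 : ℝ) ≤ η := hη.le
  -- A Lipschitz cutoff, equal to 1 on the 2 η-thickening and to 0 off the 3 η-thickening.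
  -- Convolution with a bump of radius η costs η on either side and preserves both the bounds and
  -- the Lipschitz constant η⁻¹.
  let u : Plane → ℝ := fun y => (thickenedIndicator hη (Metric.thickening (2 * η) S) y : ℝ)
  have hulip : LipschitzWith (η⁻¹).toNNReal u := by
    have h1 := lipschitzWith_thickenedIndicator hη (Metric.thickening (2 * η) S)
    refine LipschitzWith.of_dist_le_mul fun x y => ?_
    have h2 := h1.dist_le_mul x y
    refine h2.trans (mul_le_mul_of_nonneg_right ?_ dist_nonneg)
    rw [Real.toNNReal_inv]
  have huc : Continuous u := hulip.continuous
  have hu0 : ∀ y, 0 ≤ u y := fun y => NNReal.coe_nonneg _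
  have hu1 : ∀ y, u y ≤ 1 := fun y => by
    exact_mod_cast thickenedIndicator_le_one hη (Metric.thickening (2 * η) S) y
  let ρ : ContDiffBump (0 : Plane) := ⟨η / 2, η, by linarith, by linarith⟩
  have hρ : ρ.rOut = η := rfl
  let χ : Plane → ℝ := convolution (ρ.normed volume) u (ContinuousLinearMap.lsmul ℝ ℝ) volume
  have hχ : ∀ y, χ y = ∫ t, ρ.normed volume t * u (y - t) := fun y => rfl
  have hint : ∀ y, Integrable (fun t => ρ.normed volume t * u (y - t)) := by
    intro y
    refine (ρ.integrable_normed (μ := volume)).mono' (by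
      have h1 : Continuous (ρ.normed volume) := ρ.continuous_normed
      exact (h1.mul (huc.comp (continuous_const.sub continuous_id))).aestronglyMeasurable) ?_
    refine Filter.Eventually.of_forall fun t => ?_
    have h1 : 0 ≤ ρ.normed volume t := ρ.nonneg_normed t
    rw [Real.norm_eq_abs, abs_of_nonneg (mul_nonneg h1 (hu0 _))]
    exact mul_le_of_le_one_right h1 (hu1 _)
  have hbd : ∀ (w : Plane → ℝ) (C : ℝ), (∀ t, |w t| ≤ C) →
      |∫ t, ρ.normed volume t * w t| ≤ C := by
    intro w C hw
    have h1 : ‖∫ t, ρ.normed volume t * w t‖ ≤ ∫ t, ρ.normed volume t * C := by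
      refine norm_integral_le_of_norm_le ((ρ.integrable_normed (μ := volume)).mul_const C) ?_
      refine Filter.Eventually.of_forall fun t => ?_
      rw [norm_mul, Real.norm_eq_abs, Real.norm_eq_abs, abs_of_nonneg (ρ.nonneg_normed t)]
      exact mul_le_mul_of_nonneg_left (hw t) (ρ.nonneg_normed t)
    rwa [integral_mul_const, ρ.integral_normed, one_mul, Real.norm_eq_abs] at h1
  have hs : ContDiff ℝ ∞ χ :=
    HasCompactSupport.contDiff_convolution_left (n := ⊤) _ ρ.hasCompactSupport_normed
      ρ.contDiff_normed huc.locallyIntegrable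
  refine ⟨χ, hs, fun y => ?_, fun y hy => ?_, fun y hy => ?_, fun y => ?_⟩
  · rw [hχ]
    exact hbd _ _ fun t => by rw [abs_of_nonneg (hu0 _)]; exact hu1 _
  · obtain ⟨z, hz, hyz⟩ := Metric.mem_thickening_iff.1 hy
    have h1 : ∀ x ∈ Metric.ball y ρ.rOut, u x = 1 := by
      intro x hx
      have : x ∈ Metric.thickening (2 * η) S := by
        refine Metric.mem_thickening_iff.2 ⟨z, hz, ?_⟩
        have := dist_triangle x y z
        rw [hρ, Metric.mem_ball] at hx
        linarith
      have := thickenedIndicator_one hη _ this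
      exact (congrArg NNReal.toReal this).trans (by simp)
    have h2 : χ y = u y := ρ.normed_convolution_eq_right fun x hx => by
      rw [h1 x hx, h1 y (Metric.mem_ball_self ρ.rOut_pos)]
    rw [h2, h1 y (Metric.mem_ball_self ρ.rOut_pos)]
  · by_contra hcon
    apply hy
    have h1 : ∀ x ∈ Metric.ball y ρ.rOut, u x = 0 := by
      intro x hx
      have : x ∉ Metric.thickening η (Metric.thickening (2 * η) S) := by
        intro hx'
        obtain ⟨z, hz, hxz⟩ := Metric.mem_thickening_iff.1 hx'
        obtain ⟨w, hw, hzw⟩ := Metric.mem_thickening_iff.1 hz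
        refine hcon (Metric.mem_thickening_iff.2 ⟨w, hw, ?_⟩)
        have h1 := dist_triangle y x w
        have h2 := dist_triangle x z w
        rw [hρ, Metric.mem_ball, dist_comm] at hx
        linarith
      have := thickenedIndicator_zero hη _ this
      exact (congrArg NNReal.toReal this).trans (by simp)
    have h2 : χ y = u y := ρ.normed_convolution_eq_right fun x hx => by
      rw [h1 x hx, h1 y (Metric.mem_ball_self ρ.rOut_pos)]
    rw [h2, h1 y (Metric.mem_ball_self ρ.rOut_pos)]
  · have hlip : LipschitzWith (η⁻¹).toNNReal χ := by
      refine LipschitzWith.of_dist_le_mul fun x y => ?_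
      rw [Real.dist_eq, hχ, hχ, ← integral_sub (hint x) (hint y)]
      simp_rw [← mul_sub]
      refine hbd _ _ fun t => ?_
      have := hulip.dist_le_mul (x - t) (y - t)
      rwa [Real.dist_eq, dist_sub_right] at this
    have := norm_fderiv_le_of_lipschitz ℝ hlip (x₀ := y)
    rwa [Real.coe_toNNReal _ (by positivity)] at this

end

end CircleCollapse

/-! ### Fibrations in a family of tubes, and modification of a projection -/

namespace CircleCollapse

noncomputable section

variable {M : Type*} {J : Type*}

/-- A family of tubes any two of which, where they meet, are related by a transition. -/
structure TubeFamily [TopologicalSpace M] (κ : ℝ) (Φ : J → Cover → M) : Prop where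
  tube : ∀ j, TubeChart (Φ j)
  transition : ∀ j k q₁ q₂, ‖planeL q₁‖ < 200 → ‖planeL q₂‖ < 200 → Φ j q₁ = Φ k q₂ →
    ∃ T A, Transition κ (Φ j) (Φ k) T A ∧ T q₁ = q₂

/-- The sets `F x`, `x ∈ V`, are the fibers of a fibration of `V` that is `C¹`-close to the circle
factors of the tubes of the family. -/
def IsFibration (Φ : J → Cover → M) (δ : ℝ) (V : Set M) (F : M → Set M) : Prop :=
  ∀ x ∈ V, ∃ j q h ρ, ‖planeL q‖ < 10 ∧ Φ j q = x ∧ FibChart (Φ j) V F δ q h ρ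

/-- One period of a level set is compact and depends continuously on the level, so disjointness from
a closed set persists for nearby levels. It shows that deleting the fibers which meet a closed set
leaves a fibration. -/
theorem FibChart.exists_avoid [TopologicalSpace M] {Φ : Cover → M} (hΦ : TubeChart Φ) {V : Set M} {F : M → Set M}
    {δ : ℝ} {q₀ : Cover} {h : Cover → Plane} {ρ : ℝ} (H : FibChart Φ V F δ q₀ h ρ) (hδ : δ < 1)
    (hq₀ : ‖planeL q₀‖ < 150) {S : Set M} (hS : IsClosed S)
    (hd : Disjoint (Φ '' {q' | h q' = h q₀}) S) :
    ∃ ρ' > 0, ρ' ≤ ρ ∧ ∀ q, ‖h q - h q₀‖ < ρ' → Disjoint (Φ '' {q' | h q' = h q}) S := by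
  let P : Plane → ℝ → Cover := fun c t =>
    (H.near.homeo hδ).symm (t • circleDirection + sliceL c)
  have hP : Continuous fun z : Plane × ℝ => P z.1 z.2 :=
    (H.near.homeo hδ).symm.continuous.comp
      ((continuous_snd.smul continuous_const).add (sliceL.continuous.comp continuous_fst))
  have hhP : ∀ c t, h (P c t) = c := fun c t => by simp [P, H.near.apply_homeo_symm]
  have hP0 : ∀ c t, P c t 0 = t := fun c t => by simp [P, H.near.homeo_symm_zero_coord]
  have hev : ∀ᶠ c in 𝓝 (h q₀), ∀ t ∈ Icc (0 : ℝ) 1, Φ (P c t) ∉ S := by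
    refine isCompact_Icc.eventually_forall_of_forall_eventually fun t _ => ?_
    have h1 : ‖planeL (P (h q₀) t)‖ < 200 := by
      have h2 := H.near.close (P (h q₀) t)
      have h3 := H.near.close q₀
      rw [hhP] at h2
      have h4 : planeL (P (h q₀) t) = -(h q₀ - planeL (P (h q₀) t)) + (h q₀ - planeL q₀) +
        planeL q₀ := by abel
      rw [h4]
      have h5 := norm_add₃_le (a := -(h q₀ - planeL (P (h q₀) t))) (b := h q₀ - planeL q₀)
        (c := planeL q₀)
      rw [norm_neg] at h5
      linarith
    have h2 : ContinuousAt (fun z : Plane × ℝ => Φ (P z.1 z.2)) (h q₀, t) :=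
      ContinuousAt.comp (f := fun z : Plane × ℝ => P z.1 z.2) (x := (h q₀, t))
        (hΦ.continuousAt _ h1) hP.continuousAt
    refine h2.eventually (hS.isOpen_compl.mem_nhds ?_)
    intro hmem
    exact Set.disjoint_left.1 hd ⟨P (h q₀) t, hhP _ _, rfl⟩ hmem
  obtain ⟨r, hr, hball⟩ := Metric.eventually_nhds_iff.1 hev
  refine ⟨min r ρ, lt_min hr H.pos, min_le_right _ _, fun q hq => ?_⟩
  rw [Set.disjoint_left]
  rintro _ ⟨q', hq', rfl⟩ hmem
  have h1 := hball (y := h q) (by rw [dist_eq_norm]; exact hq.trans_le (min_le_left _ _))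
    (Int.fract (q' 0)) ⟨Int.fract_nonneg _, (Int.fract_lt_one _).le⟩
  apply h1
  have h2 : P (h q) (Int.fract (q' 0)) = q' + ((-⌊q' 0⌋ : ℤ) : ℝ) • circleDirection := by
    apply H.near.eq_of_height hδ
    · rw [hP0]
      simp only [Int.fract, PiLp.add_apply, PiLp.smul_apply, circleDirection_zero_coord,
        smul_eq_mul, mul_one]
      push_cast; ring
    · rw [hhP, shift_int H.near.shift]
      exact hq'.symm
  rw [h2, shift_int hΦ.shift]
  exact hmem

section

variable {κ : ℝ} {Φ : J → Cover → M} {δ : ℝ} {V : Set M} {F : M → Set M}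

theorem IsFibration.mem_self (H : IsFibration Φ δ V F) {x : M} (hx : x ∈ V) : x ∈ F x := by
  obtain ⟨j, q, h, ρ, -, rfl, hc⟩ := H x hx
  rw [hc.fiber_eq]
  exact ⟨q, rfl, rfl⟩

theorem IsFibration.fiber_eq (H : IsFibration Φ δ V F) {x y : M} (hx : x ∈ V) (hy : y ∈ F x) :
    y ∈ V ∧ F y = F x := by
  obtain ⟨j, q, h, ρ, -, rfl, hc⟩ := H x hx
  rw [hc.fiber_eq] at hy ⊢
  obtain ⟨q', hq', rfl⟩ := hy
  have hq'' : h q' = h q := hq'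
  have := hc.chart q' (by rw [hq'']; simpa using hc.pos)
  rwa [hq''] at this

/-- By `FibChart.transfer` the fibers are level sets in every tube of the family, not only in the
tube that comes with the definition, at the cost of a factor 12. -/
theorem IsFibration.exists_chart [TopologicalSpace M] (hΦ : TubeFamily κ Φ) (H : IsFibration Φ δ V F) (hκ : κ ≤ δ)
    (hδ : δ ≤ 1 / 100) (k : J) {q : Cover} (hq : ‖planeL q‖ < 150) (hx : Φ k q ∈ V) :
    ∃ h ρ, FibChart (Φ k) V F (12 * δ) q h ρ := by
  obtain ⟨j, q₁, h, ρ, hq₁, he, hc⟩ := H _ hx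
  obtain ⟨T, A, hT, hTq⟩ := hΦ.transition k j q q₁ (by linarith) (by linarith) he.symm
  obtain ⟨h', hh'⟩ := hc.transfer (hΦ.tube j) hT hκ hδ (by linarith) hq
    (by rw [hTq]; linarith) he
  exact ⟨h', _, hh'⟩

/-- In a tube, the projection to the plane can be modified near the fibers of a given fibration
through the part of the slice where `χ = 1`, so that these fibers become level sets. -/
theorem IsFibration.exists_modification [TopologicalSpace M] (hΦ : TubeFamily κ Φ) (H : IsFibration Φ δ V F)
    (hκ : κ ≤ δ) (hδ : δ ≤ 1 / 100) (k : J) {η : ℝ} (hη : 0 < η) (hη1 : η ≤ 1 / 10)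
    {χ : Plane → ℝ} (hχ : ContDiff ℝ ∞ χ) (hχ1 : ∀ y, |χ y| ≤ 1)
    (hχd : ∀ y, ‖fderiv ℝ χ y‖ ≤ η⁻¹)
    (hχs : ∀ y ∈ tsupport χ, ‖y‖ ≤ 12 ∧ Φ k (sliceL y) ∈ V) :
    ∃ f, NearPlane (36 * δ / η) f ∧ ∀ y q, χ y = 1 → ‖planeL q‖ < 50 →
      Φ k q ∈ F (Φ k (sliceL y)) → f q = y := by
  classical
  rcases lt_or_ge δ 0 with hneg | hδ0
  · refine ⟨fun q => planeL q, ?_, ?_⟩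
    · exfalso
      obtain ⟨T, A, hT, -⟩ := hΦ.transition k k 0 0 (by simp) (by simp) rfl
      linarith [hT.nonneg]
    · exfalso
      obtain ⟨T, A, hT, -⟩ := hΦ.transition k k 0 0 (by simp) (by simp) rfl
      linarith [hT.nonneg]
  have hcs : IsCompact (tsupport χ) :=
    (isCompact_closedBall (0 : Plane) 12).of_isClosed_subset (isClosed_tsupport χ)
      fun y hy => by simpa using (hχs y hy).1
  have hslice : ∀ y ∈ tsupport χ, ‖planeL (sliceL y)‖ < 150 := fun y hy => by
    rw [planeL_sliceL]; linarith [(hχs y hy).1]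
  have hchart : ∀ y ∈ tsupport χ, ∃ h ρ, FibChart (Φ k) V F (12 * δ) (sliceL y) h ρ :=
    fun y hy => H.exists_chart hΦ hκ hδ k (hslice y hy) (hχs y hy).2
  -- R q y: the fiber that crosses the slice at y, a point of the support of χ, passes through q. In
  -- a chart, y can only be h q (`huniq`, `hcenter`), and conversely h q qualifies when it lies in
  -- the support (`hconv`).
  let R : Cover → Plane → Prop := fun q y =>
    y ∈ tsupport χ ∧ ‖planeL q‖ < 50 ∧ Φ k q ∈ F (Φ k (sliceL y))
  have hbd : ∀ {h : Cover → Plane}, NearPlane (12 * δ) h → ∀ q, ‖h q‖ < 20 → ‖planeL q‖ < 50 := by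
    intro h hn q hq
    have h1 := hn.close q
    have h2 := norm_le_norm_add_norm_sub' (planeL q) (h q)
    rw [norm_sub_rev] at h2
    linarith
  have huniq : ∀ y₀ ∈ tsupport χ, ∀ h ρ, FibChart (Φ k) V F (12 * δ) (sliceL y₀) h ρ →
      ∀ q, ‖h q - y₀‖ < ρ → ∀ y, R q y → h q = y := by
    rintro y₀ hy₀ h ρ hc q hq y ⟨hy, hq50, hqF⟩
    have h1 := H.fiber_eq (hχs y hy).2 hqF
    have h2 := H.mem_self (hχs y hy).2
    have h3 := (hc.chart q (by rwa [hc.near.slice])).2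
    rw [← h1.2, h3] at h2
    obtain ⟨p, hp, hpy⟩ := h2
    have hp' : h p = h q := hp
    obtain ⟨n, hn⟩ := (hΦ.tube k).inj p (sliceL y) (by
      have : ‖planeL p‖ < 50 := by
        refine hbd hc.near p ?_
        rw [hp']
        have h4 := norm_le_norm_add_norm_sub' (h q) y₀
        linarith [(hχs y₀ hy₀).1, hc.le_one]
      linarith) (by linarith [hslice y hy]) hpy
    rw [← hc.near.slice y, hn, shift_int hc.near.shift, hp']
  have hcenter : ∀ y₀ ∈ tsupport χ, ∀ h ρ, FibChart (Φ k) V F (12 * δ) (sliceL y₀) h ρ →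
      ∀ q, R q y₀ → h q = y₀ := by
    rintro y₀ hy₀ h ρ hc q ⟨-, hq50, hqF⟩
    rw [hc.fiber_eq, hc.near.slice] at hqF
    obtain ⟨p, hp, hpq⟩ := hqF
    have hp' : h p = y₀ := hp
    obtain ⟨n, hn⟩ := (hΦ.tube k).inj p q (by
      have : ‖planeL p‖ < 50 := hbd hc.near p (by rw [hp']; linarith [(hχs y₀ hy₀).1])
      linarith) (by linarith) hpq
    rw [hn, shift_int hc.near.shift, hp']
  have hconv : ∀ y₀ ∈ tsupport χ, ∀ h ρ, FibChart (Φ k) V F (12 * δ) (sliceL y₀) h ρ →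
      ∀ q, ‖h q - y₀‖ < ρ → h q ∈ tsupport χ → R q (h q) := by
    rintro y₀ hy₀ h ρ hc q hq hs
    have h1 := (hc.chart (sliceL (h q)) (by rwa [hc.near.slice, hc.near.slice])).2
    rw [hc.near.slice] at h1
    refine ⟨hs, hbd hc.near q (by linarith [(hχs _ hs).1]), ?_⟩
    rw [h1]
    exact ⟨q, rfl, rfl⟩
  -- Interpolation between the projection of q and the slice point y of its fiber, with weight χ y.
  -- As y is constant along a fiber, the fibers with χ y = 1 become level sets. The choice of y is
  -- immaterial because y is unique.
  let f : Cover → Plane := fun q =>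
    if hq : ∃ y, R q y then planeL q + χ hq.choose • (hq.choose - planeL q) else planeL q
  have hlocal : ∀ y₀ ∈ tsupport χ, ∀ h ρ, FibChart (Φ k) V F (12 * δ) (sliceL y₀) h ρ →
      ∀ q, ‖h q - y₀‖ < ρ → f q = planeL q + χ (h q) • (h q - planeL q) := by
    intro y₀ hy₀ h ρ hc q hq
    by_cases hR : ∃ y, R q y
    · have h1 := huniq y₀ hy₀ h ρ hc q hq _ hR.choose_spec
      simp only [f, dif_pos hR, ← h1]
    · have h1 : χ (h q) = 0 := by
        by_contra hne
        exact hR ⟨_, hconv y₀ hy₀ h ρ hc q hq (subset_tsupport _ hne)⟩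
      simp only [f, dif_neg hR, h1, zero_smul, add_zero]
  have hval : ∀ q y, R q y → f q = planeL q + χ y • (y - planeL q) := by
    intro q y hR
    obtain ⟨h, ρ, hc⟩ := hchart y hR.1
    have h1 := hcenter y hR.1 h ρ hc q hR
    rw [hlocal y hR.1 h ρ hc q (by rw [h1]; simpa using hc.pos), h1]
  have hRshift : ∀ q y, R (q + circleDirection) y ↔ R q y := by
    intro q y
    simp only [R, (hΦ.tube k).shift, map_add, planeL_circleDirection, add_zero]
  have hpos : (0 : ℝ) ≤ 36 * δ / η := by positivity
  -- Locally f is either the formula in a chart or the plain projection. The second case needs that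
  -- no fiber through the support of χ comes near q, which follows from the compactness of the
  -- support.
  have hev : ∀ q, (∃ y₀ ∈ tsupport χ, ∃ h ρ, FibChart (Φ k) V F (12 * δ) (sliceL y₀) h ρ ∧
      f =ᶠ[𝓝 q] fun q => planeL q + χ (h q) • (h q - planeL q)) ∨
      f =ᶠ[𝓝 q] fun q => planeL q := by
    intro q
    by_cases hR : ∃ y, R q y
    · left
      obtain ⟨y₀, hR⟩ := hR
      obtain ⟨h, ρ, hc⟩ := hchart y₀ hR.1
      refine ⟨y₀, hR.1, h, ρ, hc, ?_⟩
      have h1 : ∀ᶠ q' in 𝓝 q, ‖h q' - y₀‖ < ρ := by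
        have h2 : Continuous fun q' => ‖h q' - y₀‖ :=
          (hc.near.contDiff.continuous.sub continuous_const).norm
        have h3 : ‖h q - y₀‖ < ρ := by
          rw [hcenter y₀ hR.1 h ρ hc q hR]
          simpa using hc.pos
        exact h2.continuousAt.eventually (gt_mem_nhds h3)
      filter_upwards [h1] with q' hq'
      exact hlocal y₀ hR.1 h ρ hc q' hq'
    · right
      have h1 : ∀ᶠ q' in 𝓝 q, ∀ y ∈ tsupport χ, ¬ R q' y := by
        refine hcs.eventually_forall_of_forall_eventually fun y₀ hy₀ => ?_
        obtain ⟨h, ρ, hc⟩ := hchart y₀ hy₀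
        have hne : h q ≠ y₀ := fun he =>
          hR ⟨y₀, he ▸ hconv y₀ hy₀ h ρ hc q (by rw [he]; simpa using hc.pos) (by rwa [he])⟩
        have hcont : Continuous h := hc.near.contDiff.continuous
        have h2 : ∀ᶠ z : Cover × Plane in 𝓝 (q, y₀), h z.1 ≠ z.2 :=
          (isOpen_ne_fun (hcont.comp continuous_fst) continuous_snd).mem_nhds hne
        have h3 : ∀ᶠ z : Cover × Plane in 𝓝 (q, y₀), ‖z.2 - y₀‖ < ρ := by
          have h4 : Continuous fun z : Cover × Plane => ‖z.2 - y₀‖ :=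
            (continuous_snd.sub continuous_const).norm
          exact h4.continuousAt.eventually (gt_mem_nhds (by simpa using hc.pos))
        filter_upwards [h2, h3] with z hz2 hz3 hRz
        have h5 := (hc.chart (sliceL z.2) (by rwa [hc.near.slice, hc.near.slice])).2
        obtain ⟨-, hz50, hzF⟩ := hRz
        rw [h5, hc.near.slice] at hzF
        obtain ⟨p, hp, hpq⟩ := hzF
        have hp' : h p = z.2 := hp
        obtain ⟨n, hn⟩ := (hΦ.tube k).inj p z.1 (by
          have : ‖planeL p‖ < 50 := hbd hc.near p (by
            rw [hp']
            have h4 := norm_le_norm_add_norm_sub' z.2 y₀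
            linarith [(hχs y₀ hy₀).1, hc.le_one])
          linarith) (by linarith) hpq
        exact hz2 (by rw [hn, shift_int hc.near.shift, hp'])
      filter_upwards [h1] with q' hq'
      have : ¬ ∃ y, R q' y := fun ⟨y, hy⟩ => hq' y hy.1 hy
      simp only [f, dif_neg this]
  refine ⟨f, ⟨?_, ?_, ?_, ?_⟩, ?_⟩
  · rw [contDiff_iff_contDiffAt]
    intro q
    rcases hev q with ⟨y₀, -, h, ρ, hc, he⟩ | he
    · refine ContDiffAt.congr_of_eventuallyEq ?_ he
      exact (planeL.contDiff.add ((hχ.comp hc.near.contDiff).smul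
        (hc.near.contDiff.sub planeL.contDiff))).contDiffAt
    · exact planeL.contDiff.contDiffAt.congr_of_eventuallyEq he
  · intro q
    by_cases hR : ∃ y, R q y
    · obtain ⟨y, hy⟩ := hR
      rw [hval q y hy, hval _ y ((hRshift q y).2 hy)]
      simp
    · have hR' : ¬ ∃ y, R (q + circleDirection) y := by simpa only [hRshift] using hR
      simp only [f, dif_neg hR, dif_neg hR']
      simp
  · intro q
    rcases hev q with ⟨y₀, -, h, ρ, hc, he⟩ | he
    · rw [he.fderiv_eq]
      have hhd := (hc.near.differentiable q).hasFDerivAt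
      have hχh := ((hχ.differentiable (by simp)) (h q)).hasFDerivAt.comp q hhd
      have hd : HasFDerivAt (fun q => planeL q + χ (h q) • (h q - planeL q)) _ q :=
        planeL.hasFDerivAt.add (hχh.smul (hhd.sub planeL.hasFDerivAt))
      rw [hd.fderiv, add_sub_cancel_left]
      refine (norm_add_le _ _).trans ?_
      -- The difference to `planeL` is χ (dh - `planeL`) + dχ ∘ dh ⊗ (h - `planeL`), where both dh -
      -- `planeL` and h - `planeL` are at most 12 δ. The first term is at most 12 δ and the second
      -- at most 24 δ / η; since η ≤ 1/10, the sum is below 36 δ / η.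
      have h1 : ‖χ (h q) • (fderiv ℝ h q - planeL)‖ ≤ 12 * δ := by
        rw [norm_smul]
        exact (mul_le_of_le_one_left (norm_nonneg _) (hχ1 _)).trans (hc.near.fderiv_le q)
      have h2 : ‖((fderiv ℝ χ (h q)).comp (fderiv ℝ h q)).smulRight (h q - planeL q)‖ ≤
          η⁻¹ * (1 + 12 * δ) * (12 * δ) := by
        rw [ContinuousLinearMap.norm_smulRight_apply]
        refine mul_le_mul ((ContinuousLinearMap.opNorm_comp_le _ _).trans
          (mul_le_mul (hχd _) ?_ (norm_nonneg _) (by positivity))) (hc.near.close q)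
          (norm_nonneg _) (by positivity)
        have h3 := norm_le_norm_add_norm_sub' (fderiv ℝ h q) planeL
        linarith [hc.near.fderiv_le q, norm_planeL_le]
      refine (add_le_add h1 h2).trans ?_
      rw [div_eq_inv_mul]
      have h3 : 1 ≤ η⁻¹ * (1 / 10) := by
        rw [inv_mul_eq_div, le_div_iff₀ hη]; linarith
      have h4 : 12 * δ ≤ η⁻¹ * (1 / 10) * (12 * δ) := le_mul_of_one_le_left (by positivity) h3
      have h5 : η⁻¹ * (1 + 12 * δ) * (12 * δ) ≤ η⁻¹ * 2 * (12 * δ) := by gcongr; linarith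
      have h6 : 0 ≤ η⁻¹ * δ := by positivity
      nlinarith
    · rw [he.fderiv_eq]
      have : fderiv ℝ (fun q => planeL q) q = planeL := planeL.hasFDerivAt.fderiv
      rw [this, sub_self, norm_zero]
      exact hpos
  · intro y
    by_cases hR : ∃ y', R (sliceL y) y'
    · obtain ⟨y', hy'⟩ := hR
      obtain ⟨h, ρ, hc⟩ := hchart y' hy'.1
      -- A slice point is itself the slice point of its fiber, so the interpolation does not move
      -- it.
      have h1 := hcenter y' hy'.1 h ρ hc _ hy'
      rw [hc.near.slice] at h1
      subst h1
      rw [hval _ _ hy']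
      simp
    · simp only [f, dif_neg hR, planeL_sliceL]
  · intro y q hy hq hqF
    have hR : R q y := ⟨subset_tsupport _ (by simp [hy]), hq, hqF⟩
    rw [hval q y hR, hy]
    simp

end

end

end CircleCollapse

/-! ### Extension of a fibration, colour by colour -/

namespace CircleCollapse

noncomputable section

variable {M : Type*} {J : Type*} {κ : ℝ} {Φ : J → Cover → M} {δ : ℝ} {V : Set M} {F : M → Set M}

/-- A fibration can be extended over a family of disjoint tubes, at the cost of a fixed factor in
the distance to the circle factors and of shrinking the domain. -/
theorem IsFibration.extend [TopologicalSpace M] [T2Space M] [Finite J] (hΦ : TubeFamily κ Φ)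
    (H : IsFibration Φ δ V F) (hκ : κ ≤ δ) {η r : ℝ} (hη : 0 < η) (hδη : 36 * δ / η ≤ 1 / 100)
    (hr : r + 10 * η ≤ 6) (hη1 : η ≤ 1 / 10) (D C : Set J)
    (hC : ∀ k ∈ C, ∀ k' ∈ C, k ≠ k' → ∀ q q', ‖planeL q‖ < 50 → ‖planeL q'‖ < 50 →
      Φ k q ≠ Φ k' q')
    (hV : ∀ j ∈ D, ∀ q, ‖planeL q‖ < r + 10 * η → Φ j q ∈ V) :
    ∃ V' F', IsFibration Φ (36 * δ / η) V' F' ∧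
      ∀ j ∈ D ∪ C, ∀ q, ‖planeL q‖ < r → Φ j q ∈ V' := by
  classical
  rcases isEmpty_or_nonempty J with hJ | ⟨⟨j₀⟩⟩
  · exact ⟨∅, F, fun x hx => hx.elim, fun j => (hJ.false j).elim⟩
  have hκ0 : 0 ≤ κ := by
    obtain ⟨T, A, hT, -⟩ := hΦ.transition j₀ j₀ 0 0 (by simp) (by simp) rfl
    exact hT.nonneg
  have hδ0 : 0 ≤ δ := hκ0.trans hκ
  have hδ3600 : 3600 * δ ≤ η := by
    rw [div_le_iff₀ hη] at hδη; linarith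
  have hδ : δ ≤ 1 / 100 := by linarith
  have hδδ : δ ≤ 36 * δ / η := by
    rw [le_div_iff₀ hη]; nlinarith
  -- The part of the slice of tube k covered by the tubes of D, with radius slightly larger than r.
  -- The old fibers have to be kept near it.
  let S : J → Set Plane := fun k =>
    {y | ‖y‖ ≤ 10 ∧ ∃ j ∈ D, ∃ q, ‖planeL q‖ < r + η ∧ Φ k (sliceL y) = Φ j q}
  choose χ hχ hχ1 hχS hχs hχd using fun k => exists_cutoff (S k) hη
  -- The support lies within 5 η of S k. Transitions are almost isometric along slices, so it stays
  -- in the tubes of D of radius r + η + 1.02 · 5 η < r + 10 η, where the old fibration is defined.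
  have hsupp : ∀ k, ∀ y ∈ tsupport (χ k), ‖y‖ ≤ 12 ∧ Φ k (sliceL y) ∈ V := by
    intro k y hy
    have h1 : y ∈ Metric.thickening (5 * η) (S k) := by
      refine Metric.cthickening_subset_thickening' (by linarith) (by linarith) (S k)
        (Metric.closure_thickening_subset_cthickening (4 * η) (S k) ?_)
      exact closure_mono (fun z hz => hχs k z hz) hy
    obtain ⟨y', ⟨hy'10, j, hj, q, hq, he⟩, hyy'⟩ := Metric.mem_thickening_iff.1 h1
    rw [dist_eq_norm] at hyy'
    have h2 : ‖y‖ ≤ 12 := by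
      have := norm_le_norm_add_norm_sub' y y'
      linarith
    refine ⟨h2, ?_⟩
    obtain ⟨T, A, hT, hTq⟩ := hΦ.transition k j (sliceL y') q (by
      rw [planeL_sliceL]; linarith) (by linarith) he
    rw [← hT.comp_eq _ (by rw [planeL_sliceL]; linarith)]
    refine hV j hj _ ?_
    have h3 := hT.slice_dist_le y y'
    rw [hTq] at h3
    have h4 := norm_le_norm_add_norm_sub' (planeL (T (sliceL y))) (planeL q)
    have h5 : (1 + 2 * κ) * ‖y - y'‖ ≤ (1 + 2 * (1 / 100)) * (5 * η) := by gcongr; linarith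
    linarith
  choose f hf hfχ using fun k => H.exists_modification hΦ hκ hδ k hη hη1 (hχ k) (hχ1 k) (hχd k)
    (hsupp k)
  have hf1 : ∀ k q, ‖f k q - planeL q‖ ≤ 1 / 100 := fun k q => ((hf k).close q).trans hδη
  have hf50 : ∀ k q, ‖f k q‖ < 7 → ‖planeL q‖ < 8 := fun k q hq => by
    have h2 := norm_le_norm_add_norm_sub' (planeL q) (f k q)
    rw [norm_sub_rev] at h2
    linarith [hf1 k q]
  -- The compact part of the slice where χ is not known to be 1. An old fiber is kept only if it
  -- avoids the images of these sets in all tubes; inside W such a fiber is automatically a level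
  -- set of the modified projection.
  let B : J → Set Plane := fun k => Metric.closedBall 0 8 \ Metric.thickening η (S k)
  have hBc : ∀ k, IsCompact (B k) := fun k =>
    (isCompact_closedBall _ _).diff Metric.isOpen_thickening
  let Z : Set M := ⋃ k, (fun y => Φ k (sliceL y)) '' B k
  have hZ : IsClosed Z := by
    refine isClosed_iUnion_of_finite fun k => ((hBc k).image_of_continuousOn ?_).isClosed
    intro y hy
    have h1 : ‖y‖ ≤ 8 := by simpa using hy.1
    exact (ContinuousAt.comp (f := fun y => sliceL y) (x := y) ((hΦ.tube k).continuousAt _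
      (by rw [planeL_sliceL]; linarith)) sliceL.continuous.continuousAt).continuousWithinAt
  let Vm : Set M := {x | x ∈ V ∧ Disjoint (F x) Z}
  let W : Set M := {x | ∃ k ∈ C, ∃ q, ‖f k q‖ < 7 ∧ Φ k q = x}
  -- The choices are harmless: the tubes of C are disjoint, which fixes the tube, and inside it the
  -- lift is unique up to an integral shift.
  let F' : M → Set M := fun x =>
    if hx : x ∈ W then Φ hx.choose '' {q' | f hx.choose q' = f hx.choose hx.choose_spec.2.choose}
    else F x
  have hF'W : ∀ k ∈ C, ∀ q, ‖f k q‖ < 7 → F' (Φ k q) = Φ k '' {q' | f k q' = f k q} := by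
    intro k hk q hq
    have hW : Φ k q ∈ W := ⟨k, hk, q, hq, rfl⟩
    simp only [F', dif_pos hW]
    obtain ⟨h1, h2⟩ := hW.choose_spec.2.choose_spec
    have h3 := hW.choose_spec.1
    generalize hW.choose_spec.2.choose = q₁ at *
    generalize hW.choose = k₁ at *
    have h4 : k₁ = k := by
      by_contra hne
      exact hC k₁ h3 k hk hne q₁ q (by linarith [hf50 _ _ h1]) (by linarith [hf50 _ _ hq]) h2
    subst h4
    obtain ⟨n, rfl⟩ := (hΦ.tube k₁).inj q₁ q (by linarith [hf50 _ _ h1])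
      (by linarith [hf50 _ _ hq]) h2
    rw [shift_int (hf k₁).shift]
  -- On the overlap of old and new domain both definitions of the fiber agree: a kept fiber crosses
  -- the slice at h q, outside B k, hence at a point where χ k = 1, and f k takes the constant value
  -- h q on it.
  have hF'V : ∀ x ∈ Vm, F' x = F x := by
    rintro x ⟨hxV, hxZ⟩
    by_cases hW : x ∈ W
    · obtain ⟨k, hk, q, hq, rfl⟩ := hW
      rw [hF'W k hk q hq]
      obtain ⟨h, ρ, hc⟩ := H.exists_chart hΦ hκ hδ k (by linarith [hf50 _ _ hq]) hxV
      have h12 : 12 * δ ≤ 1 / 100 := by linarith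
      have hFx := hc.fiber_eq
      have hy : ‖h q‖ ≤ 8 := by
        have h2 := norm_le_norm_add_norm_sub' (h q) (f k q)
        have h3 := norm_sub_le_norm_sub_add_norm_sub (h q) (planeL q) (f k q)
        rw [norm_sub_rev (planeL q)] at h3
        linarith [hf1 k q, hc.near.close q]
      have hmem : Φ k (sliceL (h q)) ∈ F (Φ k q) := by
        rw [hFx]; exact ⟨_, hc.near.slice _, rfl⟩
      have hth : h q ∈ Metric.thickening η (S k) := by
        by_contra hn
        exact Set.disjoint_left.1 hxZ hmem
          (mem_iUnion.2 ⟨k, h q, ⟨by simpa using hy, hn⟩, rfl⟩)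
      have hχq := hχS k _ hth
      have hFy := (H.fiber_eq hxV hmem).2
      have hsub : ∀ q', h q' = h q → f k q' = h q := by
        intro q' hq'
        refine hfχ k (h q) q' hχq ?_ ?_
        · have h1 := hc.near.close q'
          rw [hq', norm_sub_rev] at h1
          have h2 := norm_le_norm_add_norm_sub' (planeL q') (h q)
          linarith
        · rw [hFy, hFx]
          exact ⟨q', hq', rfl⟩
      have hfq := hsub q rfl
      rw [hFx, hfq]
      congr 1
      ext q'
      -- Level sets of h and of f k are both graphs over the height axis, so the inclusion of one in
      -- the other is an equality.
      refine ⟨fun hq' => ?_, fun hq' => hsub q' hq'⟩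
      obtain ⟨q'', h0, h1⟩ := hc.near.exists_height (by linarith) (q' 0) (h q)
      have h2 := hsub q'' h1
      have h3 : q'' = q' := (hf k).eq_of_height (by linarith) h0 (h2.trans (Eq.symm hq'))
      rw [← h3]; exact h1
    · simp only [F', dif_neg hW]
  refine ⟨Vm ∪ W, F', ?_, ?_⟩
  · rintro x (hx | ⟨k, hk, q, hq, rfl⟩)
    · obtain ⟨j, q, h, ρ, hq, rfl, hc⟩ := H x hx.1
      have hd := hx.2
      rw [hc.fiber_eq] at hd
      obtain ⟨ρ', hρ', hle, hav⟩ := hc.exists_avoid (hΦ.tube j) (by linarith) (by linarith) hZ hd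
      refine ⟨j, q, h, ρ', hq, rfl, hc.near.mono hδδ, hρ', hle.trans hc.le_one, fun q' hq' => ?_⟩
      obtain ⟨h1, h2⟩ := hc.chart q' (hq'.trans_le hle)
      have h3 : Φ j q' ∈ Vm := ⟨h1, by rw [h2]; exact hav q' hq'⟩
      exact ⟨Or.inl h3, (hF'V _ h3).trans h2⟩
    · have hlt := hf50 _ _ hq
      refine ⟨k, q, f k, min (7 - ‖f k q‖) 1, by linarith, rfl, hf k,
        lt_min (by linarith) one_pos, min_le_right _ _, fun q' hq' => ?_⟩
      have h1 : ‖f k q'‖ < 7 := by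
        have h2 := norm_le_norm_add_norm_sub' (f k q') (f k q)
        have h3 := hq'.trans_le (min_le_left _ _)
        linarith
      exact ⟨Or.inr ⟨k, hk, q', h1, rfl⟩, hF'W k hk q' h1⟩
  · rintro j (hj | hj) q hq
    · left
      have hxV : Φ j q ∈ V := hV j hj q (by linarith)
      refine ⟨hxV, ?_⟩
      obtain ⟨h, ρ, hc⟩ := H.exists_chart hΦ hκ hδ j (q := q) (by linarith) hxV
      rw [hc.fiber_eq, Set.disjoint_left]
      rintro _ ⟨q', hq', rfl⟩ hmem
      obtain ⟨k, y, ⟨hy8, hyn⟩, hy⟩ := mem_iUnion.1 hmem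
      have hq'' : h q' = h q := hq'
      refine hyn (Metric.self_subset_thickening hη _ ?_)
      have hy8' : ‖y‖ ≤ 8 := by simpa using hy8
      -- The planar coordinate of a fiber varies by at most 24 δ ≤ η, so a fiber that meets the
      -- r-tube of j stays in its (r + η)-tube. Hence all its slice points of norm at most 8 belong
      -- to the sets S k and none to B k.
      refine ⟨by linarith, j, hj, q', ?_, hy⟩
      have h1 := hc.near.close q'
      have h2 := hc.near.close q
      rw [hq'', norm_sub_rev] at h1
      have h3 := norm_le_norm_add_norm_sub' (planeL q') (h q)
      have h4 := norm_le_norm_add_norm_sub' (h q) (planeL q)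
      linarith
    · right
      refine ⟨j, hj, q, ?_, rfl⟩
      have h2 := norm_le_norm_add_norm_sub' (f j q) (planeL q)
      linarith [hf1 j q]

/-- Iterated extension of a fibration over the tubes of a finitely coloured family. -/
theorem exists_isFibration [TopologicalSpace M] [T2Space M] [Finite J] (m : ℕ)
    (hΦ : TubeFamily κ Φ) (hκ0 : 0 ≤ κ) (hκ : (360 * (m + 1 : ℝ)) ^ (m + 1) * κ ≤ 1 / 100)
    (color : J → ℕ) (hm : ∀ j, color j ≤ m)
    (hC : ∀ k k', color k = color k' → k ≠ k' → ∀ q q', ‖planeL q‖ < 50 → ‖planeL q'‖ < 50 →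
      Φ k q ≠ Φ k' q') :
    ∃ V F, IsFibration Φ ((360 * (m + 1 : ℝ)) ^ (m + 1) * κ) V F ∧
      ∀ j q, ‖planeL q‖ < 5 → Φ j q ∈ V := by
  have hm1 : (1 : ℝ) ≤ m + 1 := by
    have : (0 : ℝ) ≤ m := by positivity
    linarith
  -- The radius shrinks from 6 to 5 in m + 1 steps of length 1 / (m + 1) = 10 η. With this η the
  -- factor 36 / η of one extension is 360 (m + 1).
  have key : ∀ c : ℕ, c ≤ m + 1 → ∃ V F, IsFibration Φ ((360 * (m + 1 : ℝ)) ^ c * κ) V F ∧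
      ∀ j, color j < c → ∀ q, ‖planeL q‖ < 6 - c / (m + 1) → Φ j q ∈ V := by
    intro c
    induction c with
    | zero =>
      intro _
      exact ⟨∅, fun _ => ∅, fun x hx => hx.elim, fun j hj => (Nat.not_lt_zero _ hj).elim⟩
    | succ c ih =>
      intro hc
      obtain ⟨V, F, hF, hV⟩ := ih (by omega)
      have h10 : (10 : ℝ) * (1 / (10 * (m + 1))) = 1 / (m + 1) := by
        field_simp
      have hpow : 36 * ((360 * (m + 1 : ℝ)) ^ c * κ) / (1 / (10 * (m + 1))) =
          (360 * (m + 1 : ℝ)) ^ (c + 1) * κ := by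
        rw [pow_succ]
        field_simp
        ring
      have hbase : (1 : ℝ) ≤ 360 * (m + 1) := by linarith
      obtain ⟨V', F', hF', hV'⟩ := hF.extend hΦ
        (le_mul_of_one_le_left hκ0 (one_le_pow₀ hbase)) (η := 1 / (10 * (m + 1)))
        (r := 6 - (c + 1 : ℕ) / (m + 1)) (by positivity)
        (by
          rw [hpow]
          refine le_trans ?_ hκ
          gcongr)
        (by
          rw [h10]
          have : ((c + 1 : ℕ) : ℝ) / (m + 1) = c / (m + 1) + 1 / (m + 1) := by
            push_cast; ring
          have h0 : (0 : ℝ) ≤ c / (m + 1) := by positivity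
          linarith)
        (by
          rw [div_le_div_iff₀ (by positivity) (by norm_num)]
          linarith)
        {j | color j < c} {j | color j = c}
        (fun k hk k' hk' hne => hC k k' (Eq.trans hk (Eq.symm hk')) hne)
        (fun j hj q hq => hV j hj q (by
          rw [h10] at hq
          have : ((c + 1 : ℕ) : ℝ) / (m + 1) = c / (m + 1) + 1 / (m + 1) := by
            push_cast; ring
          linarith))
      rw [hpow] at hF'
      refine ⟨V', F', hF', fun j hj q hq => hV' j ?_ q hq⟩
      rcases Nat.lt_succ_iff_lt_or_eq.1 hj with h | h
      · exact Or.inl h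
      · exact Or.inr h
  obtain ⟨V, F, hF, hV⟩ := key (m + 1) le_rfl
  refine ⟨V, F, hF, fun j q hq => hV j (Nat.lt_succ_of_le (hm j)) q ?_⟩
  have : ((m + 1 : ℕ) : ℝ) / (m + 1) = 1 := by
    push_cast; exact div_self (by positivity)
  rw [this]
  linarith

end

end CircleCollapse

/-! ### Almost isometries of almost flat metrics are almost affine -/

namespace CircleCollapse

noncomputable section

section Koszul

theorem productMetric_apply (u v : Cover) : productMetric u v = inner ℝ u v := rfl

theorem abs_form_sub_inner_le {b : Cover →L[ℝ] Cover →L[ℝ] ℝ} {ε : ℝ} (hb : ‖b - productMetric‖ ≤ ε)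
    (u v : Cover) : |b u v - inner ℝ u v| ≤ ε * ‖u‖ * ‖v‖ := by
  have h1 := (b - productMetric).le_opNorm₂ u v
  have h2 : (b - productMetric) u v = b u v - inner ℝ u v := by simp [productMetric_apply]
  rw [h2, Real.norm_eq_abs] at h1
  exact h1.trans (by gcongr)

theorem le_form_self {b : Cover →L[ℝ] Cover →L[ℝ] ℝ} {ε : ℝ} (hb : ‖b - productMetric‖ ≤ ε) (u : Cover) :
    (1 - ε) * ‖u‖ ^ 2 ≤ b u u := by
  have h1 := (abs_le.1 (abs_form_sub_inner_le hb u u)).1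
  rw [real_inner_self_eq_norm_sq] at h1
  nlinarith

theorem form_self_le {b : Cover →L[ℝ] Cover →L[ℝ] ℝ} {ε : ℝ} (hb : ‖b - productMetric‖ ≤ ε) (u : Cover) :
    b u u ≤ (1 + ε) * ‖u‖ ^ 2 := by
  have h1 := (abs_le.1 (abs_form_sub_inner_le hb u u)).2
  rw [real_inner_self_eq_norm_sq] at h1
  nlinarith

/-- A linear map that pulls back an almost Euclidean form to a multiple of an almost Euclidean form
is almost a homothety. -/
theorem norm_apply_le_of_form {a b : Cover →L[ℝ] Cover →L[ℝ] ℝ} {ε s : ℝ} {D : Cover →L[ℝ] Cover}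
    (hε0 : 0 ≤ ε) (hε : ε ≤ 1 / 100) (hs : 0 < s)
    (ha : ‖a - productMetric‖ ≤ ε) (hb : ‖b - productMetric‖ ≤ ε)
    (hD : ∀ u v, b (D u) (D v) = s ^ 2 * a u v) (u : Cover) :
    (1 - 2 * ε) * s * ‖u‖ ≤ ‖D u‖ ∧ ‖D u‖ ≤ (1 + 2 * ε) * s * ‖u‖ := by
  have h1 := le_form_self hb (D u)
  have h2 := form_self_le hb (D u)
  have h3 := le_form_self ha u
  have h4 := form_self_le ha u
  rw [hD] at h1 h2
  have hs2 : 0 ≤ s ^ 2 := sq_nonneg s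
  have hsu : 0 ≤ s ^ 2 * ‖u‖ ^ 2 := by positivity
  have he2 : ε ^ 2 ≤ ε * (1 / 100) := by rw [pow_two]; gcongr
  have he3 : ε ^ 3 ≤ ε * (1 / 100) := by
    rw [pow_succ']; exact mul_le_mul_of_nonneg_left (by linarith) hε0
  have h5 : s ^ 2 * a u u ≤ (1 + ε) * (s ^ 2 * ‖u‖ ^ 2) := by nlinarith
  have h6 : (1 - ε) * (s ^ 2 * ‖u‖ ^ 2) ≤ s ^ 2 * a u u := by nlinarith
  constructor
  · refine abs_le_of_sq_le_sq' ?_ (norm_nonneg _) |>.2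
    have h7 : (1 - 2 * ε) ^ 2 * (1 + ε) ≤ 1 - ε := by ring_nf; linarith
    have h8 : (1 + ε) * ((1 - 2 * ε) * s * ‖u‖) ^ 2 ≤ (1 + ε) * ‖D u‖ ^ 2 := by
      have h9 := mul_le_mul_of_nonneg_right h7 hsu
      nlinarith
    exact le_of_mul_le_mul_left h8 (by linarith)
  · refine abs_le_of_sq_le_sq' ?_ (by positivity) |>.2
    have h7 : 1 + ε ≤ (1 + 2 * ε) ^ 2 * (1 - ε) := by ring_nf; linarith [sq_nonneg ε]
    have h8 : (1 - ε) * ‖D u‖ ^ 2 ≤ (1 - ε) * ((1 + 2 * ε) * s * ‖u‖) ^ 2 := by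
      have h9 := mul_le_mul_of_nonneg_right h7 hsu
      nlinarith
    exact le_of_mul_le_mul_left h8 (by linarith)

/-- The algebraic part of the Koszul formula. -/
theorem norm_le_of_koszul {b : Cover →L[ℝ] Cover →L[ℝ] ℝ} {ε s : ℝ} {D : Cover →L[ℝ] Cover}
    {D2 : Cover →L[ℝ] Cover →L[ℝ] Cover} (hε0 : 0 ≤ ε) (hε : ε ≤ 1 / 100) (hs : 0 < s)
    (hb : ‖b - productMetric‖ ≤ ε) (hDsymm : ∀ w u, D2 w u = D2 u w)
    (hD : ∀ u, (1 - 2 * ε) * s * ‖u‖ ≤ ‖D u‖)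
    (hSb : ∀ w u v, |b (D2 w u) (D v) + b (D2 w v) (D u)| ≤
      (16 / 5) * ε * s ^ 2 * (‖w‖ * ‖u‖ * ‖v‖)) :
    ‖D2‖ ≤ 5 * ε * s := by
  refine ContinuousLinearMap.opNorm_le_bound₂ _ (by positivity) fun w u => ?_
  have hDinj : Function.Injective (D : Cover →ₗ[ℝ] Cover) := by
    rw [injective_iff_map_eq_zero]
    intro v hv
    have h1 := hD v
    rw [show D v = 0 from hv, norm_zero] at h1
    have h2 : 0 < (1 - 2 * ε) * s := by apply mul_pos _ hs; linarith
    have : ‖v‖ ≤ 0 := by nlinarith [norm_nonneg v]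
    simpa using this
  obtain ⟨v, hv⟩ := (LinearMap.injective_iff_surjective.1 hDinj) (D2 w u)
  have hv' : D v = D2 w u := hv
  set X := D2 w u with hX
  have h1 := le_form_self hb X
  -- Koszul's cyclic sum: by the symmetry of `D2` all terms cancel except two copies of b X (D v),
  -- and v was chosen with D v = X. The constants are 3/2 · 16/5 = 24/5, times 50/49 for s ‖v‖
  -- against ‖X‖ and 100/99 for b against the norm; the product is below 5.
  have h2 : 2 * b X X = (b (D2 w u) (D v) + b (D2 w v) (D u)) +
      (b (D2 u v) (D w) + b (D2 u w) (D v)) -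
      (b (D2 v w) (D u) + b (D2 v u) (D w)) := by
    rw [hDsymm u w, hDsymm v w, hDsymm v u, hv', ← hX]
    ring
  have h3 := (abs_le.1 (hSb w u v)).2
  have h4 := (abs_le.1 (hSb u v w)).2
  have h5 := (abs_le.1 (hSb v w u)).1
  have h6 : b X X ≤ (24 / 5) * ε * s ^ 2 * (‖w‖ * ‖u‖ * ‖v‖) := by
    have e1 : ‖u‖ * ‖v‖ * ‖w‖ = ‖w‖ * ‖u‖ * ‖v‖ := by ring
    have e2 : ‖v‖ * ‖w‖ * ‖u‖ = ‖w‖ * ‖u‖ * ‖v‖ := by ring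
    rw [e1] at h4
    rw [e2] at h5
    linarith
  have h7 : 49 / 50 * (s * ‖v‖) ≤ ‖X‖ := by
    rw [← hv']
    refine le_trans ?_ (hD v)
    rw [mul_assoc]
    gcongr
    linarith
  have h8 : 99 / 100 * ‖X‖ ^ 2 ≤ (1 - ε) * ‖X‖ ^ 2 := by gcongr; linarith
  have h9 : (24 / 5) * ε * s ^ 2 * (‖w‖ * ‖u‖ * ‖v‖) ≤
      (24 / 5) * ε * s * (‖w‖ * ‖u‖) * (50 / 49 * ‖X‖) := by
    have h10 : s * ‖v‖ ≤ 50 / 49 * ‖X‖ := by linarith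
    calc (24 / 5) * ε * s ^ 2 * (‖w‖ * ‖u‖ * ‖v‖)
        = (24 / 5) * ε * s * (‖w‖ * ‖u‖) * (s * ‖v‖) := by ring
      _ ≤ _ := by gcongr
  have h11 : ‖X‖ * ‖X‖ ≤ (5 * ε * s * ‖w‖ * ‖u‖) * ‖X‖ := by
    have h12 : 0 ≤ ε * s * ‖w‖ * ‖u‖ * ‖X‖ := by positivity
    have h13 : (24 / 5) * ε * s * (‖w‖ * ‖u‖) * (50 / 49 * ‖X‖) =
      240 / 49 * (ε * s * ‖w‖ * ‖u‖ * ‖X‖) := by ring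
    have h14 : (5 * ε * s * ‖w‖ * ‖u‖) * ‖X‖ = 5 * (ε * s * ‖w‖ * ‖u‖ * ‖X‖) := by ring
    rw [h14, ← pow_two]
    linarith
  rcases (norm_nonneg X).eq_or_lt with h0 | h0
  · rw [← h0]; positivity
  · exact le_of_mul_le_mul_right h11 h0


/-- If a map pulls back a metric that is `C¹`-close to the Euclidean one to a constant multiple
`s² ≤ 4` of another such metric, then its second derivative is small compared to `s`. -/
theorem norm_second_fderiv_le {a b : Cover → Cover →L[ℝ] Cover →L[ℝ] ℝ} {ε s : ℝ}
    {T : Cover → Cover} {q : Cover}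
    (hε0 : 0 ≤ ε) (hε : ε ≤ 1 / 100) (hs : 0 < s) (hs2 : s ≤ 2)
    (ha : ‖a q - productMetric‖ ≤ ε) (hb : ‖b (T q) - productMetric‖ ≤ ε)
    (had : DifferentiableAt ℝ a q) (hbd : DifferentiableAt ℝ b (T q))
    (ha' : ∀ w, ‖fderiv ℝ a q w‖ ≤ ε * ‖w‖) (hb' : ∀ w, ‖fderiv ℝ b (T q) w‖ ≤ ε * ‖w‖)
    (hsymm : ∀ u v, b (T q) u v = b (T q) v u) (hT : ContDiffAt ℝ 2 T q)
    (hpull : ∀ᶠ p in 𝓝 q, ∀ u v, b (T p) (fderiv ℝ T p u) (fderiv ℝ T p v) = s ^ 2 * a p u v) :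
    ‖fderiv ℝ (fderiv ℝ T) q‖ ≤ 5 * ε * s := by
  set D := fderiv ℝ T q with hDdef
  set D2 := fderiv ℝ (fderiv ℝ T) q with hD2def
  set B := fderiv ℝ b (T q) with hBdef
  have hTd : DifferentiableAt ℝ T q := hT.differentiableAt (by norm_num)
  have hT2 : DifferentiableAt ℝ (fderiv ℝ T) q :=
    (hT.fderiv_right (m := 1) (by norm_num)).differentiableAt (by norm_num)
  have hDsymm : ∀ w u, D2 w u = D2 u w := by
    intro w u
    refine second_derivative_symmetric_of_eventually (𝕜 := ℝ) (f := T) (f' := fderiv ℝ T) ?_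
      hT2.hasFDerivAt w u
    filter_upwards [hT.eventually (by simp)] with p hp
    exact (hp.differentiableAt (by norm_num)).hasFDerivAt
  have hbound := fun u => norm_apply_le_of_form hε0 hε hs ha hb hpull.self_of_nhds u
  -- The derivative of the pull-back identity in the direction w, solved for the terms with second
  -- derivatives of T.
  have hS : ∀ w u v, b (T q) (D2 w u) (D v) + b (T q) (D2 w v) (D u) =
      s ^ 2 * fderiv ℝ a q w u v - B (D w) (D u) (D v) := by
    intro w u v
    have h1 : HasFDerivAt (fun p => b (T p) (fderiv ℝ T p u) (fderiv ℝ T p v)) _ q :=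
      (((hbd.hasFDerivAt.comp q hTd.hasFDerivAt).clm_apply
        (hT2.hasFDerivAt.clm_apply (hasFDerivAt_const u q))).clm_apply
        (hT2.hasFDerivAt.clm_apply (hasFDerivAt_const v q)))
    have h2 : HasFDerivAt (fun p => s ^ 2 * a p u v) _ q :=
      ((had.hasFDerivAt.clm_apply (hasFDerivAt_const u q)).clm_apply
        (hasFDerivAt_const v q)).const_mul (s ^ 2)
    have h3 : (fun p => b (T p) (fderiv ℝ T p u) (fderiv ℝ T p v)) =ᶠ[𝓝 q]
        fun p => s ^ 2 * a p u v := by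
      filter_upwards [hpull] with p hp using hp u v
    have h4 := (h2.congr_of_eventuallyEq h3).unique h1
    have h5 := DFunLike.congr_fun h4 w
    simp at h5
    rw [hsymm (D2 w v) (D u)]
    linarith
  have hSb : ∀ w u v, |b (T q) (D2 w u) (D v) + b (T q) (D2 w v) (D u)| ≤
      (16 / 5) * ε * s ^ 2 * (‖w‖ * ‖u‖ * ‖v‖) := by
    intro w u v
    rw [hS]
    have h1 : |fderiv ℝ a q w u v| ≤ ε * ‖w‖ * ‖u‖ * ‖v‖ := by
      have h2 := (fderiv ℝ a q w).le_opNorm₂ u v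
      rw [Real.norm_eq_abs] at h2
      refine h2.trans ?_
      gcongr
      exact ha' w
    have h3 : |B (D w) (D u) (D v)| ≤ ε * ‖D w‖ * ‖D u‖ * ‖D v‖ := by
      have h2 := (B (D w)).le_opNorm₂ (D u) (D v)
      rw [Real.norm_eq_abs] at h2
      refine h2.trans ?_
      gcongr
      exact hb' (D w)
    have h4 : ∀ u, ‖D u‖ ≤ 51 / 50 * s * ‖u‖ := fun u => (hbound u).2.trans (by
      gcongr; linarith)
    have h5 : |B (D w) (D u) (D v)| ≤
        ε * (51 / 50 * s * ‖w‖) * (51 / 50 * s * ‖u‖) * (51 / 50 * s * ‖v‖) := by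
      refine h3.trans ?_
      gcongr <;> exact h4 _
    have h6 : |s ^ 2 * fderiv ℝ a q w u v| ≤ s ^ 2 * (ε * ‖w‖ * ‖u‖ * ‖v‖) := by
      rw [abs_mul, abs_of_nonneg (sq_nonneg s)]
      gcongr
    refine (abs_sub _ _).trans ((add_le_add h6 h5).trans ?_)
    have h7 : 0 ≤ ε * s ^ 2 * (‖w‖ * ‖u‖ * ‖v‖) := by positivity
    have h8 : ε * (51 / 50 * s * ‖w‖) * (51 / 50 * s * ‖u‖) * (51 / 50 * s * ‖v‖) =
      (51 / 50) ^ 3 * s * (ε * s ^ 2 * (‖w‖ * ‖u‖ * ‖v‖)) := by ring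
    rw [h8]
    -- The derivative of b contributes s³, and s ≤ 2 turns this into s². The constant 16/5 bounds 1
    -- + 2 (51/50)³.
    have h9 : (51 / 50) ^ 3 * s * (ε * s ^ 2 * (‖w‖ * ‖u‖ * ‖v‖)) ≤
        (51 / 50) ^ 3 * 2 * (ε * s ^ 2 * (‖w‖ * ‖u‖ * ‖v‖)) := by gcongr
    nlinarith
  exact norm_le_of_koszul hε0 hε hs hb hDsymm (fun u => (hbound u).1) hSb

end Koszul

end

end CircleCollapse

/-! ### Pull-backs of the metric of M to the cover -/

namespace CircleCollapse

noncomputable section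

open Bundle

variable {H : Type*} [TopologicalSpace H] {I : ModelWithCorners ℝ (EuclideanSpace ℝ (Fin 3)) H}
  {M : Type*} [EMetricSpace M] [ChartedSpace H M]

/-- A smooth map with injective differential from `ℝ³` to a `3`-manifold, possibly with boundary,
has a smooth local inverse. -/
theorem exists_local_inverse [IsManifold I ∞ M] {f : Cover → M} {q : Cover} (hf : ContMDiffAt 𝓘(ℝ, Cover) I ∞ f q)
    (hinj : Function.Injective (mfderiv 𝓘(ℝ, Cover) I f q)) :
    ∃ S : M → Cover, ContMDiffAt I 𝓘(ℝ, Cover) ∞ S (f q) ∧ S (f q) = q ∧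
      (∀ᶠ p in 𝓝 q, S (f p) = p) ∧ ∀ᶠ x in 𝓝 (f q), f (S x) = x := by
  set ψ : Cover → Cover := extChartAt I (f q) ∘ f with hψ
  have hψs : ContDiffAt ℝ ∞ ψ q := contMDiffAt_iff_contDiffAt.1 (contMDiffAt_iff_target.1 hf).2
  have hfd : MDifferentiableAt 𝓘(ℝ, Cover) I f q := hf.mdifferentiableAt (by simp)
  have hext : MDifferentiableAt I 𝓘(ℝ, Cover) (extChartAt I (f q)) (f q) :=
    mdifferentiableAt_extChartAt (mem_chart_source H (f q))
  have hcomp := mfderiv_comp q hext hfd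
  have hψinj : Function.Injective (fderiv ℝ ψ q) := by
    rw [← mfderiv_eq_fderiv, hψ, hcomp]
    exact (isInvertible_mfderiv_extChartAt (mem_extChartAt_source (I := I) (f q))).injective.comp
      hinj
  let e : Cover ≃L[ℝ] Cover := (LinearEquiv.ofInjectiveEndo
    (fderiv ℝ ψ q : Cover →ₗ[ℝ] Cover) hψinj).toContinuousLinearEquiv
  have he : HasFDerivAt ψ (e : Cover →L[ℝ] Cover) q :=
    (hψs.differentiableAt (by simp)).hasFDerivAt
  let Ψ := hψs.toOpenPartialHomeomorph ψ he (by simp)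
  have hsrc : q ∈ Ψ.source := hψs.mem_toOpenPartialHomeomorph_source he (by simp)
  have htgt : ψ q ∈ Ψ.target := hψs.image_mem_toOpenPartialHomeomorph_target he (by simp)
  have hΨ : ∀ p, Ψ p = ψ p := fun p => rfl
  have hsymmq : Ψ.symm (ψ q) = q := Ψ.left_inv hsrc
  have hsymm : ContDiffAt ℝ ∞ Ψ.symm (ψ q) :=
    Ψ.contDiffAt_symm htgt (by rw [hsymmq]; exact he) (by rw [hsymmq]; exact hψs)
  refine ⟨Ψ.symm ∘ extChartAt I (f q), ?_, hsymmq, ?_, ?_⟩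
  · exact ContMDiffAt.comp (f q) hsymm.contMDiffAt contMDiffAt_extChartAt
  · filter_upwards [Ψ.open_source.mem_nhds hsrc] with p hp using Ψ.left_inv hp
  · have hcont : ContinuousAt (Ψ.symm ∘ extChartAt I (f q)) (f q) :=
      ContinuousAt.comp (Ψ.continuousAt_symm htgt) (continuousAt_extChartAt (f q))
    have h1 : ∀ᶠ x in 𝓝 (f q), extChartAt I (f q) x ∈ Ψ.target :=
      (continuousAt_extChartAt (f q)).eventually (Ψ.open_target.mem_nhds htgt)
    have h2 : ∀ᶠ x in 𝓝 (f q),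
        f ((Ψ.symm ∘ extChartAt I (f q)) x) ∈ (extChartAt I (f q)).source := by
      have h3 : ContinuousAt f ((Ψ.symm ∘ extChartAt I (f q)) (f q)) := by
        rw [show (Ψ.symm ∘ extChartAt I (f q)) (f q) = q from hsymmq]; exact hf.continuousAt
      refine (ContinuousAt.comp h3 hcont).eventually ?_
      have : (f ∘ (Ψ.symm ∘ extChartAt I (f q))) (f q) = f q := congrArg f hsymmq
      rw [this]
      exact extChartAt_source_mem_nhds (f q)
    filter_upwards [h1, h2, extChartAt_source_mem_nhds (I := I) (f q)] with x hx1 hx2 hx3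
    -- f (S x) and x have the same coordinates in an extended chart, which is injective on its
    -- source even if it takes values in a half-space. So no assumption on the boundary is needed.
    exact (extChartAt I (f q)).injOn hx2 hx3 (Ψ.right_inv hx1)

variable [RiemannianBundle (fun x : M => TangentSpace I x)]

theorem pullbackMetric_apply (f : Cover → M) (q u v : Cover) :
    pullbackMetric I f q u v = inner ℝ (mfderiv 𝓘(ℝ, Cover) I f q u : TangentSpace I (f q))
      (mfderiv 𝓘(ℝ, Cover) I f q v : TangentSpace I (f q)) := rfl

theorem pullbackMetric_symm (f : Cover → M) (q u v : Cover) :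
    pullbackMetric I f q u v = pullbackMetric I f q v u := by
  rw [pullbackMetric_apply, pullbackMetric_apply, real_inner_comm]

theorem pullbackMetric_congr {f g : Cover → M} {q : Cover} (h : f =ᶠ[𝓝 q] g) :
    pullbackMetric I f q = pullbackMetric I g q := by
  -- The tangent space depends on the base point. Written as a function of the base point and of a
  -- linear map into the fixed model space, the form allows both to be rewritten.
  let P : M → (Cover →L[ℝ] EuclideanSpace ℝ (Fin 3)) → Cover →L[ℝ] Cover →L[ℝ] ℝ := fun x D =>
    (innerSL ℝ (E := TangentSpace I x)).bilinearComp D D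
  have h1 : P (f q) (mfderiv 𝓘(ℝ, Cover) I f q) = P (g q) (mfderiv 𝓘(ℝ, Cover) I g q) := by
    have h2 := h.self_of_nhds
    have h3 : (mfderiv 𝓘(ℝ, Cover) I f q : Cover →L[ℝ] EuclideanSpace ℝ (Fin 3)) =
      mfderiv 𝓘(ℝ, Cover) I g q := h.mfderiv_eq
    rw [h3, h2]
  exact h1

theorem pullbackMetric_comp {f : Cover → M} {T : Cover → Cover} {q : Cover}
    (hf : MDifferentiableAt 𝓘(ℝ, Cover) I f (T q)) (hT : DifferentiableAt ℝ T q) (u v : Cover) :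
    pullbackMetric I (f ∘ T) q u v =
      pullbackMetric I f (T q) (fderiv ℝ T q u) (fderiv ℝ T q v) := by
  rw [pullbackMetric_apply, mfderiv_comp q hf hT.mdifferentiableAt, mfderiv_eq_fderiv]
  rfl

theorem contDiffOn_pullbackMetric [IsManifold I ∞ M] [IsContMDiffRiemannianBundle I ∞ (EuclideanSpace ℝ (Fin 3))
    (fun x : M => TangentSpace I x)] {f : Cover → M} {s : Set Cover} (hs : IsOpen s)
    (hf : ContMDiffOn 𝓘(ℝ, Cover) I ∞ f s) : ContDiffOn ℝ ∞ (pullbackMetric I f) s := by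
  rw [contDiffOn_clm_apply]
  intro u
  rw [contDiffOn_clm_apply]
  intro v q hq
  have hfq : ContMDiffAt 𝓘(ℝ, Cover) I ∞ f q := hf.contMDiffAt (hs.mem_nhds hq)
  have hsec : ∀ w : Cover, ContMDiffAt 𝓘(ℝ, Cover) (I.prod 𝓘(ℝ, EuclideanSpace ℝ (Fin 3))) ∞
      (fun p => (⟨f p, mfderiv 𝓘(ℝ, Cover) I f p w⟩ : TangentBundle I M)) q := by
    intro w
    have h1 := hfq.mfderiv_const (m := ∞) (by simp)
    have h2 : ContMDiffAt 𝓘(ℝ, Cover) (𝓘(ℝ, Cover).prod 𝓘(ℝ, Cover)) ∞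
        (fun p : Cover => (⟨p, w⟩ : TangentBundle 𝓘(ℝ, Cover) Cover)) q := by
      exact contMDiffAt_vectorSpace_iff_contDiffAt.2 contDiffAt_const
    exact ContMDiffAt.clm_apply_of_inCoordinates (b₁ := id) (b₂ := f)
      (ϕ := fun p => mfderiv 𝓘(ℝ, Cover) I f p) (v := fun _ => w) h1 h2 hfq
  have h3 : ContMDiffAt 𝓘(ℝ, Cover) 𝓘(ℝ) ∞ (fun p => pullbackMetric I f p u v) q :=
    ContMDiffAt.inner_bundle (hsec u) (hsec v)
  exact (contMDiffAt_iff_contDiffAt.1 h3).contDiffWithinAt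

end

end CircleCollapse

/-! ### Tubes with a fixed scale, and their local transitions -/

namespace CircleCollapse

noncomputable section

open Bundle

/-- The open solid cylinder of radius `r` in the cover. -/
def tube (r : ℝ) : Set Cover := {q | ‖planeL q‖ < r}

theorem mem_tube {r : ℝ} {q : Cover} : q ∈ tube r ↔ ‖planeL q‖ < r := Iff.rfl

theorem isOpen_tube (r : ℝ) : IsOpen (tube r) :=
  isOpen_lt planeL.continuous.norm continuous_const

theorem convex_tube (r : ℝ) : Convex ℝ (tube r) := by
  have : tube r = planeL ⁻¹' Metric.ball 0 r := by
    ext q; simp [tube]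
  rw [this]
  exact (convex_ball _ _).linear_preimage planeL.toLinearMap

/-- The covering `ℝ × ℝ² → S¹ × ℝ²`. -/
def coverMap (q : Cover) : Circle × Plane := (Circle.exp (2 * Real.pi * q 0), planeL q)

theorem lift_eq_comp {M : Type*} (φ : Circle × Plane → M) : lift φ = φ ∘ coverMap := rfl

theorem contMDiff_coverMap : ContMDiff 𝓘(ℝ, Cover) ((𝓡 1).prod (𝓡 2)) ∞ coverMap := by
  refine ContMDiff.prodMk ?_ planeL.contDiff.contMDiff
  refine contMDiff_circleExp.comp ?_
  exact (contDiff_const.mul heightL.contDiff).contMDiff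

theorem coverMap_mem {q : Cover} {r : ℝ} : coverMap q ∈ circleTimesBall r ↔ q ∈ tube r := by
  simp [circleTimesBall, coverMap, tube]

theorem coverMap_shift (q : Cover) : coverMap (q + circleDirection) = coverMap q := by
  have : 2 * Real.pi * (q + circleDirection) 0 = 2 * Real.pi * q 0 + 2 * Real.pi := by
    simp only [PiLp.add_apply, circleDirection_zero_coord]; ring
  simp only [coverMap, this, map_add, planeL_circleDirection, add_zero]
  rw [Circle.exp_add_two_pi]

theorem coverMap_eq_iff {q q' : Cover} :
    coverMap q = coverMap q' ↔ ∃ n : ℤ, q' = q + (n : ℝ) • circleDirection := by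
  constructor
  · intro h
    obtain ⟨h1, h2⟩ := Prod.ext_iff.1 h
    obtain ⟨m, hm⟩ := Circle.exp_eq_exp.1 h1
    refine ⟨-m, cover_ext ?_ (by rw [planeL_shift]; exact h2.symm)⟩
    simp only [PiLp.add_apply, PiLp.smul_apply, circleDirection_zero_coord, smul_eq_mul, mul_one]
    have hpi := Real.pi_pos
    push_cast
    have h3 : 2 * Real.pi * q 0 = 2 * Real.pi * (q' 0 + m) := by rw [hm]; ring
    have h4 := mul_left_cancel₀ (by positivity) h3
    linarith
  · rintro ⟨n, rfl⟩
    exact (shift_int (f := coverMap) coverMap_shift q n).symm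

theorem coverMap_surjective (z : Circle × Plane) : ∃ q, coverMap q = z := by
  obtain ⟨θ, hθ⟩ := Circle.exp_surjective z.1
  refine ⟨(θ / (2 * Real.pi)) • circleDirection + sliceL z.2, Prod.ext ?_ (by simp [coverMap])⟩
  rw [← hθ]
  simp only [coverMap, PiLp.add_apply, PiLp.smul_apply, circleDirection_zero_coord, smul_eq_mul,
    mul_one, sliceL_zero_coord, add_zero]
  congr 1
  have hpi := Real.pi_pos
  field_simp

theorem lift_shift {M : Type*} (φ : Circle × Plane → M) (q : Cover) :
    lift φ (q + circleDirection) = lift φ q := by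
  rw [lift_eq_comp, Function.comp_apply, coverMap_shift, Function.comp_apply]

theorem image_tube {M : Type*} (φ : Circle × Plane → M) (r : ℝ) :
    lift φ '' tube r = φ '' circleTimesBall r := by
  ext x
  constructor
  · rintro ⟨q, hq, rfl⟩
    exact ⟨coverMap q, coverMap_mem.2 hq, rfl⟩
  · rintro ⟨z, hz, rfl⟩
    obtain ⟨q, rfl⟩ := coverMap_surjective z
    exact ⟨q, coverMap_mem.1 hz, rfl⟩

theorem two_le_infty : (2 : WithTop ℕ∞) ≤ ∞ := by
  exact WithTop.coe_le_coe.2 le_top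

theorem norm_fderiv_apply_le_of_iteratedFDeriv {E : Type*} [NormedAddCommGroup E]
    [NormedSpace ℝ E] {g : Cover → E} {b : E} {q : Cover} {ε : ℝ}
    (h : ‖iteratedFDeriv ℝ 1 (fun q' => g q' - b) q‖ ≤ ε) (w : Cover) :
    ‖fderiv ℝ g q w‖ ≤ ε * ‖w‖ := by
  have h3 := (iteratedFDeriv ℝ 1 (fun q' => g q' - b) q).le_opNorm (fun _ => w)
  rw [iteratedFDeriv_one_apply, fderiv_sub_const] at h3
  refine h3.trans ?_
  simp only [Finset.univ_unique, Finset.prod_singleton]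
  gcongr

theorem differentiableAt_smul_of_contDiffOn {E : Type*} [NormedAddCommGroup E] [NormedSpace ℝ E]
    {g : Cover → E} {s : Set Cover} (hs : IsOpen s) (h : ContDiffOn ℝ ∞ g s) {q : Cover} (hq : q ∈ s) (c : ℝ) :
    DifferentiableAt ℝ (fun q' => c • g q') q :=
  ((h.contDiffAt (hs.mem_nhds hq)).differentiableAt (by simp)).const_smul c

variable {H : Type*} [TopologicalSpace H] {I : ModelWithCorners ℝ (EuclideanSpace ℝ (Fin 3)) H}
  {M : Type*} [EMetricSpace M] [ChartedSpace H M]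
  [RiemannianBundle (fun x : M => TangentSpace I x)]

variable (I) in
/-- A product structure with `ε`-control and a given scale factor `c` of the metric. -/
structure FlatTube (ε c : ℝ) (φ : Circle × Plane → M) : Prop extends IsProductStructure I ε φ where
  eps_pos : 0 < ε
  eps_le : ε ≤ 1 / 100
  pos : 0 < c
  isClose : IsCloseInCN ⌊1 / ε⌋₊ ε {q | ‖planePart q‖ < ε⁻¹}
    (fun q => c • pullbackMetric I (lift φ) q) (fun _ => productMetric)

theorem IsProductStructure.exists_flatTube {ε : ℝ} {φ : Circle × Plane → M}
    (h : IsProductStructure I ε φ) (h0 : 0 < ε) (h1 : ε ≤ 1 / 100) : ∃ c, FlatTube I ε c φ := by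
  obtain ⟨c, hc, hclose⟩ := h.exists_scale
  exact ⟨c, h, h0, h1, hc, hclose⟩

namespace FlatTube

variable {ε c : ℝ} {φ : Circle × Plane → M}

theorem inv_ge (h : FlatTube I ε c φ) : 100 ≤ ε⁻¹ := by
  rw [le_inv_comm₀ (by norm_num) h.eps_pos]
  linarith [h.eps_le]

theorem contMDiffOn_lift (h : FlatTube I ε c φ) :
    ContMDiffOn 𝓘(ℝ, Cover) I ∞ (lift φ) (tube ε⁻¹) :=
  h.contMDiffOn.comp contMDiff_coverMap.contMDiffOn fun _ hq => coverMap_mem.2 hq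

theorem contMDiffAt_lift (h : FlatTube I ε c φ) {q : Cover} (hq : q ∈ tube ε⁻¹) :
    ContMDiffAt 𝓘(ℝ, Cover) I ∞ (lift φ) q :=
  h.contMDiffOn_lift.contMDiffAt ((isOpen_tube _).mem_nhds hq)

theorem mdifferentiableAt_lift (h : FlatTube I ε c φ) {q : Cover} (hq : q ∈ tube ε⁻¹) :
    MDifferentiableAt 𝓘(ℝ, Cover) I (lift φ) q :=
  (h.contMDiffAt_lift hq).mdifferentiableAt (by simp)

theorem lift_eq_iff (h : FlatTube I ε c φ) {q q' : Cover} (hq : q ∈ tube ε⁻¹)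
    (hq' : q' ∈ tube ε⁻¹) :
    lift φ q = lift φ q' ↔ ∃ n : ℤ, q' = q + (n : ℝ) • circleDirection := by
  rw [← coverMap_eq_iff]
  constructor
  · intro he
    have h1 := h.isEmbedding.injective
      (a₁ := (⟨coverMap q, coverMap_mem.2 hq⟩ : circleTimesBall ε⁻¹))
      (a₂ := ⟨coverMap q', coverMap_mem.2 hq'⟩) he
    exact congrArg Subtype.val h1
  · intro he
    rw [lift_eq_comp, Function.comp_apply, he, Function.comp_apply]

/-- The rescaled pulled back metric. -/
def form (I : ModelWithCorners ℝ (EuclideanSpace ℝ (Fin 3)) H)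
    {M : Type*} [EMetricSpace M] [ChartedSpace H M]
    [RiemannianBundle (fun x : M => TangentSpace I x)] (c : ℝ) (φ : Circle × Plane → M)
    (q : Cover) : Cover →L[ℝ] Cover →L[ℝ] ℝ := c • pullbackMetric I (lift φ) q

theorem close (h : FlatTube I ε c φ) {q : Cover} (hq : q ∈ tube ε⁻¹) :
    ‖form I c φ q - productMetric‖ ≤ ε := by
  have := h.isClose 0 (Nat.zero_le _) q hq
  rwa [norm_iteratedFDeriv_zero] at this

theorem fderiv_close (h : FlatTube I ε c φ) {q : Cover} (hq : q ∈ tube ε⁻¹) (w : Cover) :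
    ‖fderiv ℝ (form I c φ) q w‖ ≤ ε * ‖w‖ := by
  have h1 : 1 ≤ ⌊1 / ε⌋₊ := Nat.le_floor (by
    rw [one_div]; push_cast; linarith [h.inv_ge])
  have h2 := h.isClose 1 h1 q hq
  exact norm_fderiv_apply_le_of_iteratedFDeriv h2 w

theorem differentiableAt_form [IsManifold I ∞ M]
    [IsContMDiffRiemannianBundle I ∞ (EuclideanSpace ℝ (Fin 3)) (fun x : M => TangentSpace I x)]
    (h : FlatTube I ε c φ) {q : Cover} (hq : q ∈ tube ε⁻¹) :
    DifferentiableAt ℝ (form I c φ) q := by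
  exact differentiableAt_smul_of_contDiffOn (isOpen_tube _)
    (contDiffOn_pullbackMetric (isOpen_tube _) h.contMDiffOn_lift) hq c

theorem form_apply (q u v : Cover) :
    form I c φ q u v = c * pullbackMetric I (lift φ) q u v := rfl

theorem injective_mfderiv_lift (h : FlatTube I ε c φ) {q : Cover} (hq : q ∈ tube ε⁻¹) :
    Function.Injective (mfderiv 𝓘(ℝ, Cover) I (lift φ) q) := by
  rw [injective_iff_map_eq_zero]
  intro (u : Cover) hu
  have h1 := le_form_self (h.close hq) u
  have h5 : form I c φ q u u = 0 := by
    rw [form_apply, pullbackMetric_apply]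
    erw [hu]
    simp
  rw [h5] at h1
  have h2 : (0 : ℝ) < 1 - ε := by linarith [h.eps_le]
  have h3 : ‖u‖ ^ 2 ≤ 0 := by nlinarith [sq_nonneg ‖u‖]
  have h4 : ‖u‖ = 0 := by nlinarith [norm_nonneg u]
  exact (norm_eq_zero (E := Cover)).1 h4

variable {c₁ c₂ : ℝ} {φ₁ φ₂ : Circle × Plane → M}

/-- T is the lift of φ₁ followed by a local inverse of the lift of φ₂. The last clause, that nearby
pairs over one point lie on the graph of T, makes the germ unique and lets germs be continued along
curves. -/
theorem exists_local_transition [IsManifold I ∞ M] (h₁ : FlatTube I ε c₁ φ₁)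
    (h₂ : FlatTube I ε c₂ φ₂) {q₁ q₂ : Cover} (hq₁ : q₁ ∈ tube ε⁻¹) (hq₂ : q₂ ∈ tube ε⁻¹)
    (he : lift φ₁ q₁ = lift φ₂ q₂) :
    ∃ T : Cover → Cover, ContDiffAt ℝ ∞ T q₁ ∧ T q₁ = q₂ ∧
      (∀ᶠ p in 𝓝 q₁, lift φ₂ (T p) = lift φ₁ p) ∧
      ∀ᶠ z in 𝓝 (q₁, q₂), lift φ₁ z.1 = lift φ₂ z.2 → z.2 = T z.1 := by
  obtain ⟨S, hS, hSq, hSl, hSr⟩ := exists_local_inverse (h₂.contMDiffAt_lift hq₂)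
    (h₂.injective_mfderiv_lift hq₂)
  rw [← he] at hS hSq hSr
  refine ⟨S ∘ lift φ₁, ?_, hSq, ?_, ?_⟩
  · exact contMDiffAt_iff_contDiffAt.1 (hS.comp q₁ (h₁.contMDiffAt_lift hq₁))
  · exact (h₁.contMDiffAt_lift hq₁).continuousAt.eventually hSr
  · have h3 : ∀ᶠ z : Cover × Cover in 𝓝 (q₁, q₂), S (lift φ₂ z.2) = z.2 :=
      (continuous_snd.tendsto (q₁, q₂)).eventually hSl
    filter_upwards [h3] with z hz1 hz2
    rw [Function.comp_apply, hz2, hz1]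

theorem scale_sq (h₁ : FlatTube I ε c₁ φ₁) (h₂ : FlatTube I ε c₂ φ₂) :
    Real.sqrt (c₂ / c₁) ^ 2 = c₂ / c₁ :=
  Real.sq_sqrt (div_nonneg h₂.pos.le h₁.pos.le)

theorem scale_pos (h₁ : FlatTube I ε c₁ φ₁) (h₂ : FlatTube I ε c₂ φ₂) :
    0 < Real.sqrt (c₂ / c₁) := Real.sqrt_pos.2 (div_pos h₂.pos h₁.pos)

theorem mfderiv_transition {T : Cover → Cover} {q : Cover} (h₂ : FlatTube I ε c₂ φ₂)
    (hTq : T q ∈ tube ε⁻¹) (hT : DifferentiableAt ℝ T q)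
    (he : ∀ᶠ p in 𝓝 q, lift φ₂ (T p) = lift φ₁ p) (u : Cover) :
    (mfderiv 𝓘(ℝ, Cover) I (lift φ₁) q u : EuclideanSpace ℝ (Fin 3)) =
      mfderiv 𝓘(ℝ, Cover) I (lift φ₂) (T q) (fderiv ℝ T q u) := by
  have h1 : lift φ₂ ∘ T =ᶠ[𝓝 q] lift φ₁ := he
  have h2 : (mfderiv 𝓘(ℝ, Cover) I (lift φ₁) q : Cover →L[ℝ] EuclideanSpace ℝ (Fin 3)) =
    mfderiv 𝓘(ℝ, Cover) I (lift φ₂ ∘ T) q := h1.mfderiv_eq.symm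
  rw [h2, mfderiv_comp q (h₂.mdifferentiableAt_lift hTq) hT.mdifferentiableAt, mfderiv_eq_fderiv]
  rfl

/-- Both forms are rescalings, by c₁ and c₂, of the pull-back of one metric on M, so their ratio is
the constant c₂ / c₁. -/
theorem form_transition (h₁ : FlatTube I ε c₁ φ₁) (h₂ : FlatTube I ε c₂ φ₂) {T : Cover → Cover}
    {q : Cover} (hTq : T q ∈ tube ε⁻¹) (hT : DifferentiableAt ℝ T q)
    (he : ∀ᶠ p in 𝓝 q, lift φ₂ (T p) = lift φ₁ p) (u v : Cover) :
    form I c₂ φ₂ (T q) (fderiv ℝ T q u) (fderiv ℝ T q v) =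
      Real.sqrt (c₂ / c₁) ^ 2 * form I c₁ φ₁ q u v := by
  have h1 : lift φ₂ ∘ T =ᶠ[𝓝 q] lift φ₁ := he
  have h3 := pullbackMetric_comp (h₂.mdifferentiableAt_lift hTq) hT u v
  rw [pullbackMetric_congr h1] at h3
  have h4 := h₁.pos.ne'
  rw [h₁.scale_sq h₂, form_apply, form_apply, ← h3]
  field_simp

theorem norm_fderiv_transition (h₁ : FlatTube I ε c₁ φ₁) (h₂ : FlatTube I ε c₂ φ₂)
    {T : Cover → Cover} {q : Cover} (hq : q ∈ tube ε⁻¹) (hTq : T q ∈ tube ε⁻¹)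
    (hT : DifferentiableAt ℝ T q) (he : ∀ᶠ p in 𝓝 q, lift φ₂ (T p) = lift φ₁ p) (u : Cover) :
    (1 - 2 * ε) * Real.sqrt (c₂ / c₁) * ‖u‖ ≤ ‖fderiv ℝ T q u‖ ∧
      ‖fderiv ℝ T q u‖ ≤ (1 + 2 * ε) * Real.sqrt (c₂ / c₁) * ‖u‖ :=
  norm_apply_le_of_form h₁.eps_pos.le h₁.eps_le (h₁.scale_pos h₂) (h₁.close hq) (h₂.close hTq)
    (h₁.form_transition h₂ hTq hT he) u

theorem norm_second_fderiv_transition [IsManifold I ∞ M]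
    [IsContMDiffRiemannianBundle I ∞ (EuclideanSpace ℝ (Fin 3)) (fun x : M => TangentSpace I x)]
    (h₁ : FlatTube I ε c₁ φ₁) (h₂ : FlatTube I ε c₂ φ₂) (hs : Real.sqrt (c₂ / c₁) ≤ 2)
    {T : Cover → Cover} {q : Cover} (hq : q ∈ tube ε⁻¹) (hTq : T q ∈ tube ε⁻¹)
    (hT : ContDiffAt ℝ ∞ T q) (he : ∀ᶠ p in 𝓝 q, lift φ₂ (T p) = lift φ₁ p) :
    ‖fderiv ℝ (fderiv ℝ T) q‖ ≤ 5 * ε * Real.sqrt (c₂ / c₁) := by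
  have hT2 : ContDiffAt ℝ 2 T q := hT.of_le two_le_infty
  refine norm_second_fderiv_le h₁.eps_pos.le h₁.eps_le (h₁.scale_pos h₂) hs (h₁.close hq)
    (h₂.close hTq) (h₁.differentiableAt_form hq) (h₂.differentiableAt_form hTq)
    (h₁.fderiv_close hq) (h₂.fderiv_close hTq) ?_ hT2 ?_
  · intro u v
    rw [form_apply, form_apply, pullbackMetric_symm]
  · filter_upwards [he.eventually_nhds, hT2.eventually (by simp),
      hT.continuousAt.eventually ((isOpen_tube _).mem_nhds hTq)] with p hp1 hp2 hp3
    exact h₁.form_transition h₂ hp3 (hp2.differentiableAt (by norm_num)) hp1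

/-- Curves in two tubes with the same image in `M`: in the second tube the curve is obtained from
the curve in the first tube by an almost constant linear map, almost a homothety. -/
theorem exists_curve_transition [IsManifold I ∞ M]
    [IsContMDiffRiemannianBundle I ∞ (EuclideanSpace ℝ (Fin 3)) (fun x : M => TangentSpace I x)]
    (h₁ : FlatTube I ε c₁ φ₁) (h₂ : FlatTube I ε c₂ φ₂) (hs : Real.sqrt (c₂ / c₁) ≤ 2)
    {τ ℓ : ℝ} {a b a' : ℝ → Cover} (ha : ∀ t ∈ Icc 0 τ, HasDerivWithinAt a (a' t) (Icc 0 τ) t)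
    (ha' : ∀ t ∈ Icc 0 τ, ‖a' t‖ ≤ ℓ) (hat : ∀ t ∈ Icc 0 τ, a t ∈ tube ε⁻¹)
    (hb : ContinuousOn b (Icc 0 τ)) (hbt : ∀ t ∈ Icc 0 τ, b t ∈ tube ε⁻¹)
    (he : ∀ t ∈ Icc 0 τ, lift φ₁ (a t) = lift φ₂ (b t)) :
    ∃ D : ℝ → Cover →L[ℝ] Cover, ∀ t ∈ Icc 0 τ,
      HasDerivWithinAt b (D t (a' t)) (Icc 0 τ) t ∧
      (∀ u, (1 - 2 * ε) * Real.sqrt (c₂ / c₁) * ‖u‖ ≤ ‖D t u‖ ∧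
        ‖D t u‖ ≤ (1 + 2 * ε) * Real.sqrt (c₂ / c₁) * ‖u‖) ∧
      ‖D t - D 0‖ ≤ 5 * ε * Real.sqrt (c₂ / c₁) * ℓ * t ∧
      ∀ u, (mfderiv 𝓘(ℝ, Cover) I (lift φ₁) (a t) u : EuclideanSpace ℝ (Fin 3)) =
        mfderiv 𝓘(ℝ, Cover) I (lift φ₂) (b t) (D t u) := by
  classical
  have hloc := fun t (ht : t ∈ Icc 0 τ) =>
    h₁.exists_local_transition h₂ (hat t ht) (hbt t ht) (he t ht)
  choose! T hT hTa hTe hTu using hloc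
  -- By uniqueness of the germ, b is locally the image of a under one smooth transition;
  -- differentiability of b follows from mere continuity.
  have hbT : ∀ t ∈ Icc 0 τ, ∀ᶠ t' in 𝓝[Icc 0 τ] t, b t' = T t (a t') := by
    intro t ht
    have h3 : ContinuousWithinAt (fun t' => (a t', b t')) (Icc 0 τ) t :=
      (ha t ht).continuousWithinAt.prodMk (hb t ht)
    filter_upwards [h3.eventually (hTu t ht), self_mem_nhdsWithin] with t' h4 h5
    exact h4 (he t' h5)
  have hTtube : ∀ t ∈ Icc 0 τ, T t (a t) ∈ tube ε⁻¹ := fun t ht => by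
    rw [hTa t ht]; exact hbt t ht
  have hTd : ∀ t ∈ Icc 0 τ, DifferentiableAt ℝ (T t) (a t) := fun t ht =>
    (hT t ht).differentiableAt (by simp)
  let D : ℝ → Cover →L[ℝ] Cover := fun t => fderiv ℝ (T t) (a t)
  -- The germs chosen at nearby times agree, so D is locally the differential of one fixed
  -- transition along a, and its derivative is controlled by the second derivative of that
  -- transition.
  have hD : ∀ t ∈ Icc 0 τ, ∀ᶠ t' in 𝓝[Icc 0 τ] t, D t' = fderiv ℝ (T t) (a t') := by
    intro t ht
    have h3 : ContinuousWithinAt (fun t' => (a t', b t')) (Icc 0 τ) t :=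
      (ha t ht).continuousWithinAt.prodMk (hb t ht)
    filter_upwards [h3.eventually (hTu t ht).eventually_nhds, self_mem_nhdsWithin] with t' h4 h5
    have h6 : ContinuousAt (fun p => (p, T t' p)) (a t') :=
      continuousAt_id.prodMk (hT t' h5).continuousAt
    have h7 : ∀ᶠ z in 𝓝 (a t', T t' (a t')), lift φ₁ z.1 = lift φ₂ z.2 → z.2 = T t z.1 := by
      rw [hTa t' h5]; exact h4
    have h8 : T t' =ᶠ[𝓝 (a t')] T t := by
      filter_upwards [h6.eventually h7, hTe t' h5] with p h9 h10
      exact h9 h10.symm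
    exact h8.fderiv_eq
  have hDd : ∀ t ∈ Icc 0 τ, HasDerivWithinAt D (fderiv ℝ (fderiv ℝ (T t)) (a t) (a' t))
      (Icc 0 τ) t := by
    intro t ht
    have h3 : DifferentiableAt ℝ (fderiv ℝ (T t)) (a t) :=
      ((hT t ht).fderiv_right (m := 1) two_le_infty).differentiableAt (by norm_num)
    have h4 := h3.hasFDerivAt.comp_hasDerivWithinAt t (ha t ht)
    exact h4.congr_of_eventuallyEq (hD t ht) rfl
  have h2D : ∀ t ∈ Icc 0 τ, ‖fderiv ℝ (fderiv ℝ (T t)) (a t) (a' t)‖ ≤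
      5 * ε * Real.sqrt (c₂ / c₁) * ℓ := by
    intro t ht
    have h3 := h₁.norm_second_fderiv_transition h₂ hs (hat t ht) (hTtube t ht) (hT t ht) (hTe t ht)
    refine (ContinuousLinearMap.le_of_opNorm_le _ h3 _).trans ?_
    have := h₁.eps_pos
    gcongr
    exact ha' t ht
  refine ⟨D, fun t ht => ⟨?_, ?_, ?_, ?_⟩⟩
  · exact ((hTd t ht).hasFDerivAt.comp_hasDerivWithinAt t (ha t ht)).congr_of_eventuallyEq
      (hbT t ht) (hTa t ht).symm
  · exact h₁.norm_fderiv_transition h₂ (hat t ht) (hTtube t ht) (hTd t ht) (hTe t ht)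
  · have h0 : (0 : ℝ) ∈ Icc 0 τ := ⟨le_rfl, ht.1.trans ht.2⟩
    have h3 := (convex_Icc 0 τ).norm_image_sub_le_of_norm_hasDerivWithin_le hDd h2D h0 ht
    rwa [sub_zero, Real.norm_eq_abs, abs_of_nonneg ht.1] at h3
  · intro u
    have h3 := h₂.mfderiv_transition (hTtube t ht) (hTd t ht) (hTe t ht) u
    rw [h3, hTa t ht]

end FlatTube

end

end CircleCollapse

/-! ### Lifting curves to a tube, and comparison of scales -/

namespace CircleCollapse

noncomputable section

open Bundle

/-- Only the circle factor needs covering theory; the planar coordinate is its own lift. -/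
theorem exists_coverMap_lift {A : Type*} [TopologicalSpace A] [SimplyConnectedSpace A]
    [LocallyPathConnectedSpace A] {g : A → Circle × Plane} (hg : Continuous g) {x₀ : A} {q₂ : Cover}
    (h : coverMap q₂ = g x₀) :
    ∃ b : A → Cover, Continuous b ∧ b x₀ = q₂ ∧ ∀ x, coverMap (b x) = g x := by
  obtain ⟨F, ⟨hF0, hF⟩, -⟩ := Circle.isCoveringMap_exp.existsUnique_continuousMap_lifts
    (⟨fun x => (g x).1, continuous_fst.comp hg⟩ : C(A, Circle)) x₀ (2 * Real.pi * q₂ 0)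
    (congrArg Prod.fst h)
  have hpi := Real.pi_pos
  refine ⟨fun x => (F x / (2 * Real.pi)) • circleDirection + sliceL (g x).2, ?_, ?_, fun x => ?_⟩
  · exact ((F.continuous.div_const _).smul continuous_const).add
      (sliceL.continuous.comp (continuous_snd.comp hg))
  · refine cover_ext ?_ ?_
    · simp only [PiLp.add_apply, PiLp.smul_apply, circleDirection_zero_coord, smul_eq_mul, mul_one,
        sliceL_zero_coord, add_zero, hF0]
      field_simp
    · simp [← congrArg Prod.snd h, coverMap]
  · refine Prod.ext ?_ (by simp [coverMap])
    have h1 := congrFun hF x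
    simp only [Function.comp_apply, ContinuousMap.coe_mk] at h1
    rw [← h1]
    simp only [coverMap, PiLp.add_apply, PiLp.smul_apply, circleDirection_zero_coord, smul_eq_mul,
      mul_one, sliceL_zero_coord, add_zero]
    congr 1
    field_simp

variable {H : Type*} [TopologicalSpace H] {I : ModelWithCorners ℝ (EuclideanSpace ℝ (Fin 3)) H}
  {M : Type*} [EMetricSpace M] [ChartedSpace H M]
  [RiemannianBundle (fun x : M => TangentSpace I x)]

namespace FlatTube

variable {ε c c₁ c₂ : ℝ} {φ φ₁ φ₂ : Circle × Plane → M}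

/-- Since φ is an embedding, a map into its image comes from a continuous map to S¹ × ball, which
then lifts to the cover. -/
theorem exists_lift (h : FlatTube I ε c φ) {A : Type*} [TopologicalSpace A]
    [SimplyConnectedSpace A] [LocallyPathConnectedSpace A] {p : A → M} (hp : Continuous p)
    (hpφ : ∀ x, p x ∈ lift φ '' tube ε⁻¹) {x₀ : A} {q₂ : Cover} (hq : q₂ ∈ tube ε⁻¹)
    (he : p x₀ = lift φ q₂) :
    ∃ b : A → Cover, Continuous b ∧ b x₀ = q₂ ∧ ∀ x, b x ∈ tube ε⁻¹ ∧ p x = lift φ (b x) := by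
  have h1 : ∀ x, ∃ z : circleTimesBall ε⁻¹, φ z = p x := by
    intro x
    obtain ⟨q, hq, hqx⟩ := hpφ x
    exact ⟨⟨coverMap q, coverMap_mem.2 hq⟩, hqx⟩
  choose z hz using h1
  have hzc : Continuous z := by
    rw [h.isEmbedding.isInducing.continuous_iff]
    convert hp using 1
    exact funext hz
  obtain ⟨b, hb, hb0, hbx⟩ := exists_coverMap_lift (continuous_subtype_val.comp hzc) (x₀ := x₀)
    (q₂ := q₂) (by
      have h2 := h.isEmbedding.injective (a₁ := z x₀) (a₂ := ⟨coverMap q₂, coverMap_mem.2 hq⟩)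
        ((hz x₀).trans he)
      rw [Function.comp_apply, h2])
  refine ⟨b, hb, hb0, fun x => ⟨coverMap_mem.1 ?_, ?_⟩⟩
  · rw [hbx]; exact (z x).2
  · rw [← hz, lift_eq_comp, Function.comp_apply, hbx, Function.comp_apply]

theorem exists_lift_Icc (h : FlatTube I ε c φ) {τ : ℝ} (hτ : 0 ≤ τ) {p : ℝ → M}
    (hp : ContinuousOn p (Icc 0 τ)) (hpφ : ∀ t ∈ Icc 0 τ, p t ∈ lift φ '' tube ε⁻¹) {q₂ : Cover}
    (hq : q₂ ∈ tube ε⁻¹) (he : p 0 = lift φ q₂) :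
    ∃ b : ℝ → Cover, ContinuousOn b (Icc 0 τ) ∧ b 0 = q₂ ∧
      ∀ t ∈ Icc 0 τ, b t ∈ tube ε⁻¹ ∧ p t = lift φ (b t) := by
  obtain ⟨b, hb, hb0, hbx⟩ := h.exists_lift (p := IccExtend hτ ((Icc 0 τ).domRestrict p))
    (continuousOn_iff_continuous_domRestrict.1 hp).Icc_extend' (fun t => hpφ _ (projIcc 0 τ hτ t).2)
    (x₀ := 0) hq (by rw [IccExtend_of_mem hτ _ ⟨le_rfl, hτ⟩]; exact he)
  refine ⟨b, hb.continuousOn, hb0, fun t ht => ⟨(hbx t).1, ?_⟩⟩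
  rw [← (hbx t).2, IccExtend_of_mem hτ _ ht]
  rfl

theorem exists_lift_convex (h : FlatTube I ε c φ) {s : Set Cover} (hs : IsOpen s)
    (hc : Convex ℝ s) {p : Cover → M}
    (hp : ContinuousOn p s) (hpφ : ∀ t ∈ s, p t ∈ lift φ '' tube ε⁻¹) {q₁ q₂ : Cover}
    (hq₁ : q₁ ∈ s) (hq : q₂ ∈ tube ε⁻¹) (he : p q₁ = lift φ q₂) :
    ∃ b : Cover → Cover, ContinuousOn b s ∧ b q₁ = q₂ ∧
      ∀ t ∈ s, b t ∈ tube ε⁻¹ ∧ p t = lift φ (b t) := by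
  classical
  have := hc.contractibleSpace ⟨q₁, hq₁⟩
  have := hs.locallyPathConnectedSpace
  obtain ⟨b, hb, hb0, hbx⟩ := h.exists_lift (A := s) (p := s.domRestrict p)
    (continuousOn_iff_continuous_domRestrict.1 hp) (fun t => hpφ _ t.2) (x₀ := ⟨q₁, hq₁⟩) hq he
  have h1 : ∀ t (ht : t ∈ s), (if ht : t ∈ s then b ⟨t, ht⟩ else 0) = b ⟨t, ht⟩ :=
    fun t ht => dif_pos ht
  refine ⟨fun t => if ht : t ∈ s then b ⟨t, ht⟩ else 0, ?_, ?_, fun t ht => ?_⟩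
  · rw [continuousOn_iff_continuous_domRestrict]
    convert hb using 1
    exact funext fun t => h1 t t.2
  · dsimp only
    rw [h1 q₁ hq₁, hb0]
  · dsimp only
    rw [h1 t ht]
    exact hbx ⟨t, ht⟩

theorem isOpen_image_lift [IsManifold I ∞ M] (h : FlatTube I ε c φ) {U : Set Cover}
    (hU : IsOpen U) (hUt : U ⊆ tube ε⁻¹) : IsOpen (lift φ '' U) := by
  rw [isOpen_iff_mem_nhds]
  rintro _ ⟨q, hq, rfl⟩
  obtain ⟨S, hS, hSq, -, hSr⟩ := exists_local_inverse (h.contMDiffAt_lift (hUt hq))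
    (h.injective_mfderiv_lift (hUt hq))
  have h1 : ∀ᶠ x in 𝓝 (lift φ q), S x ∈ U :=
    hS.continuousAt.eventually (hU.mem_nhds (by rwa [hSq]))
  filter_upwards [h1, hSr] with x hx1 hx2 using ⟨S x, hx1, hx2⟩

theorem isCompact_image_lift (h : FlatTube I ε c φ) {R : ℝ} (hR : R < ε⁻¹) :
    IsCompact (lift φ '' {q | ‖planeL q‖ ≤ R}) := by
  have h1 : lift φ '' {q | ‖planeL q‖ ≤ R} = φ '' (univ ×ˢ Metric.closedBall 0 R) := by
    ext x
    constructor
    · rintro ⟨q, hq, rfl⟩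
      exact ⟨coverMap q, ⟨mem_univ _, mem_closedBall_zero_iff.2 hq⟩, rfl⟩
    · rintro ⟨z, hz, rfl⟩
      obtain ⟨q, rfl⟩ := coverMap_surjective z
      exact ⟨q, mem_closedBall_zero_iff.1 hz.2, rfl⟩
  rw [h1]
  refine (isCompact_univ.prod (isCompact_closedBall _ _)).image_of_continuousOn ?_
  exact h.contMDiffOn.continuousOn.mono (prod_mono le_rfl (Metric.closedBall_subset_ball hR))

theorem sqrt_div_inv (h₁ : FlatTube I ε c₁ φ₁) (h₂ : FlatTube I ε c₂ φ₂) :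
    Real.sqrt (c₂ / c₁) * Real.sqrt (c₁ / c₂) = 1 := by
  have := h₁.pos; have := h₂.pos
  rw [← Real.sqrt_mul (by positivity)]
  have : c₂ / c₁ * (c₁ / c₂) = 1 := by field_simp
  rw [this, Real.sqrt_one]

/-- A curve in one tube which closes up after one turn closes up in another tube. -/
theorem exists_winding (h₁ : FlatTube I ε c₁ φ₁) (h₂ : FlatTube I ε c₂ φ₂)
    {ℓ : ℝ} {a b a' : ℝ → Cover}
    (ha : ∀ t ∈ Icc (0 : ℝ) 1, HasDerivWithinAt a (a' t) (Icc 0 1) t)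
    (ha' : ∀ t ∈ Icc (0 : ℝ) 1, ‖a' t‖ ≤ ℓ)
    (hbt : ∀ t ∈ Icc (0 : ℝ) 1, b t ∈ tube ε⁻¹)
    (he : ∀ t ∈ Icc (0 : ℝ) 1, lift φ₁ (a t) = lift φ₂ (b t))
    (ha1 : a 1 = a 0 + circleDirection) {D : ℝ → Cover →L[ℝ] Cover}
    (hD : ∀ t ∈ Icc (0 : ℝ) 1, HasDerivWithinAt b (D t (a' t)) (Icc 0 1) t)
    (hDt : ∀ t ∈ Icc (0 : ℝ) 1, ‖D t - D 0‖ ≤ 5 * ε * Real.sqrt (c₂ / c₁) * ℓ * t) :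
    ∃ m : ℤ, b 1 = b 0 + (m : ℝ) • circleDirection ∧
      ‖(m : ℝ) • circleDirection - D 0 circleDirection‖ ≤ 5 * ε * Real.sqrt (c₂ / c₁) * ℓ ^ 2 := by
  have i0 : (0 : ℝ) ∈ Icc (0 : ℝ) 1 := by simp
  have i1 : (1 : ℝ) ∈ Icc (0 : ℝ) 1 := by simp
  have hε := h₁.eps_pos
  have hs0 := h₁.scale_pos h₂
  have h1 : lift φ₂ (b 0) = lift φ₂ (b 1) := by
    rw [← he 0 i0, ← he 1 i1, ha1, lift_shift]
  obtain ⟨m, hm⟩ := (h₂.lift_eq_iff (hbt 0 i0) (hbt 1 i1)).1 h1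
  refine ⟨m, hm, ?_⟩
  have hℓ : 0 ≤ ℓ := (norm_nonneg _).trans (ha' 0 i0)
  -- The function b - D 0 ∘ a has the small derivative (D t - D 0) (a' t). Its increment over the
  -- turn is m times the circle direction minus the image of the circle direction under D 0.
  have h3 := (convex_Icc (0 : ℝ) 1).norm_image_sub_le_of_norm_hasDerivWithin_le
    (f := fun t => b t - D 0 (a t)) (f' := fun t => D t (a' t) - D 0 (a' t))
    (C := 5 * ε * Real.sqrt (c₂ / c₁) * ℓ ^ 2)
    (fun x hx => (hD x hx).sub ((D 0).hasFDerivAt.comp_hasDerivWithinAt x (ha x hx)))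
    (fun x hx => by
      rw [← sub_apply]
      refine (ContinuousLinearMap.le_of_opNorm_le _ (hDt x hx) _).trans ?_
      calc 5 * ε * Real.sqrt (c₂ / c₁) * ℓ * x * ‖a' x‖
          ≤ 5 * ε * Real.sqrt (c₂ / c₁) * ℓ * 1 * ℓ := by
            gcongr
            · exact hx.2
            · exact ha' x hx
        _ = _ := by ring) i0 i1
  simp only [hm, ha1, map_add, sub_zero, norm_one, mul_one] at h3
  refine le_of_eq_of_le (congrArg norm ?_) h3
  abel

section Curves

variable [IsManifold I ∞ M]
  [IsContMDiffRiemannianBundle I ∞ (EuclideanSpace ℝ (Fin 3)) (fun x : M => TangentSpace I x)]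

theorem norm_curve_transition_sub_le (h₁ : FlatTube I ε c₁ φ₁) (h₂ : FlatTube I ε c₂ φ₂)
    (hs : Real.sqrt (c₂ / c₁) ≤ 2)
    {τ ℓ : ℝ} {a b a' : ℝ → Cover} (ha : ∀ t ∈ Icc 0 τ, HasDerivWithinAt a (a' t) (Icc 0 τ) t)
    (ha' : ∀ t ∈ Icc 0 τ, ‖a' t‖ ≤ ℓ) (hat : ∀ t ∈ Icc 0 τ, a t ∈ tube ε⁻¹)
    (hb : ContinuousOn b (Icc 0 τ)) (hbt : ∀ t ∈ Icc 0 τ, b t ∈ tube ε⁻¹)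
    (he : ∀ t ∈ Icc 0 τ, lift φ₁ (a t) = lift φ₂ (b t)) {t : ℝ} (ht : t ∈ Icc 0 τ) :
    ‖b t - b 0‖ ≤ (1 + 2 * ε) * Real.sqrt (c₂ / c₁) * ℓ * t := by
  obtain ⟨D, hD⟩ := h₁.exists_curve_transition h₂ hs ha ha' hat hb hbt he
  have h0 : (0 : ℝ) ∈ Icc 0 τ := ⟨le_rfl, ht.1.trans ht.2⟩
  have h3 := (convex_Icc 0 τ).norm_image_sub_le_of_norm_hasDerivWithin_le
    (C := (1 + 2 * ε) * Real.sqrt (c₂ / c₁) * ℓ) (fun x hx => (hD x hx).1) (fun x hx => by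
      refine ((hD x hx).2.1 _).2.trans ?_
      have := h₁.eps_pos
      gcongr
      exact ha' x hx) h0 ht
  rwa [sub_zero, Real.norm_eq_abs, abs_of_nonneg ht.1] at h3

/-- A continuity argument: while the image of the segment stays in the second tube, its lift moves
by at most 2 s ‖v‖ and so stays in the part of radius R = ‖planeL q₂‖ + 3 s ‖v‖. The image of this
part is compact, hence closed, and is contained in the open image of the tube, so the segment cannot
escape. -/
theorem exists_segment_lift (h₁ : FlatTube I ε c₁ φ₁) (h₂ : FlatTube I ε c₂ φ₂)
    (hs : Real.sqrt (c₂ / c₁) ≤ 2) {q₁ q₂ v : Cover} (he : lift φ₁ q₁ = lift φ₂ q₂)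
    (ha : ∀ t ∈ Icc (0 : ℝ) 1, q₁ + t • v ∈ tube ε⁻¹)
    (hq₂ : ‖planeL q₂‖ + 3 * Real.sqrt (c₂ / c₁) * ‖v‖ < ε⁻¹) :
    ∃ b : ℝ → Cover, ContinuousOn b (Icc 0 1) ∧ b 0 = q₂ ∧ ∀ t ∈ Icc (0 : ℝ) 1,
      b t ∈ tube ε⁻¹ ∧ lift φ₁ (q₁ + t • v) = lift φ₂ (b t) ∧
        ‖b t - q₂‖ ≤ (1 + 2 * ε) * Real.sqrt (c₂ / c₁) * ‖v‖ * t := by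
  set s := Real.sqrt (c₂ / c₁) with hsdef
  have hs0 : 0 < s := h₁.scale_pos h₂
  have hε := h₁.eps_pos
  have hε1 := h₁.eps_le
  have hv := norm_nonneg v
  have hsv : 0 ≤ s * ‖v‖ := by positivity
  have hq₂t : q₂ ∈ tube ε⁻¹ := by rw [mem_tube]; linarith
  have hda : ∀ τ : ℝ, ∀ t ∈ Icc 0 τ,
      HasDerivWithinAt (fun t : ℝ => q₁ + t • v) v (Icc 0 τ) t := fun τ t _ => by
    simpa using (((hasDerivAt_id t).smul_const v).const_add q₁).hasDerivWithinAt
  have hca : ContinuousOn (fun t : ℝ => lift φ₁ (q₁ + t • v)) (Icc 0 1) :=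
    h₁.contMDiffOn_lift.continuousOn.comp (by fun_prop) ha
  have main : ∀ τ ∈ Icc (0 : ℝ) 1, (∀ t ∈ Icc 0 τ, lift φ₁ (q₁ + t • v) ∈ lift φ₂ '' tube ε⁻¹) →
      ∃ b : ℝ → Cover, ContinuousOn b (Icc 0 τ) ∧ b 0 = q₂ ∧ ∀ t ∈ Icc (0 : ℝ) τ,
      b t ∈ tube ε⁻¹ ∧ lift φ₁ (q₁ + t • v) = lift φ₂ (b t) ∧
        ‖b t - q₂‖ ≤ (1 + 2 * ε) * s * ‖v‖ * t := by
    intro τ hτ hin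
    have hsub : Icc 0 τ ⊆ Icc (0 : ℝ) 1 := Icc_subset_Icc_right hτ.2
    obtain ⟨b, hb, hb0, hbt⟩ := h₂.exists_lift_Icc hτ.1 (hca.mono hsub) hin hq₂t (by simpa using he)
    refine ⟨b, hb, hb0, fun t ht => ⟨(hbt t ht).1, (hbt t ht).2, ?_⟩⟩
    have h3 := h₁.norm_curve_transition_sub_le h₂ hs (hda τ) (fun t _ => le_rfl)
      (fun t ht => ha t (hsub ht)) hb (fun t ht => (hbt t ht).1) (fun t ht => (hbt t ht).2) ht
    rwa [hb0] at h3
  set R := ‖planeL q₂‖ + 3 * s * ‖v‖ with hR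
  set C : Set M := lift φ₂ '' {q | ‖planeL q‖ ≤ R} with hC
  have hCc : IsClosed C := (h₂.isCompact_image_lift hq₂).isClosed
  have hO : IsOpen (lift φ₂ '' tube ε⁻¹) := h₂.isOpen_image_lift (isOpen_tube _) le_rfl
  have hCO : C ⊆ lift φ₂ '' tube ε⁻¹ := image_mono fun q hq => lt_of_le_of_lt hq hq₂
  let p : ℝ → M := IccExtend zero_le_one
    ((Icc (0 : ℝ) 1).domRestrict fun t : ℝ => lift φ₁ (q₁ + t • v))
  have hp : Continuous p := (continuousOn_iff_continuous_domRestrict.1 hca).Icc_extend'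
  have hpt : ∀ t ∈ Icc (0 : ℝ) 1, p t = lift φ₁ (q₁ + t • v) := fun t ht => by
    simp only [p]; rw [IccExtend_of_mem _ _ ht]; rfl
  have hp0 : p 0 ∈ C := by
    rw [hpt 0 (by simp), zero_smul, add_zero, he]
    exact ⟨q₂, show ‖planeL q₂‖ ≤ R by rw [hR]; linarith, rfl⟩
  have hmainC : ∀ τ ∈ Icc (0 : ℝ) 1, (∀ t ∈ Icc 0 τ, p t ∈ lift φ₂ '' tube ε⁻¹) →
      ∀ t ∈ Icc 0 τ, p t ∈ C := by
    intro τ hτ hin t ht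
    have hsub : Icc 0 τ ⊆ Icc (0 : ℝ) 1 := Icc_subset_Icc_right hτ.2
    obtain ⟨b, -, -, hbt⟩ := main τ hτ fun t ht => by rw [← hpt t (hsub ht)]; exact hin t ht
    rw [hpt t (hsub ht)]
    refine ⟨b t, ?_, ((hbt t ht).2.1).symm⟩
    have h3 := (hbt t ht).2.2
    have h4 : ‖planeL (b t)‖ ≤ ‖planeL q₂‖ + ‖b t - q₂‖ := by
      have := norm_planeL_apply_le (b t - q₂)
      rw [map_sub] at this
      have h5 := norm_sub_norm_le (planeL (b t)) (planeL q₂)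
      linarith
    have ht0 : 0 ≤ t := ht.1
    have h5 : (1 + 2 * ε) * s * ‖v‖ * t ≤ 2 * s * ‖v‖ * 1 := by
      gcongr
      · linarith
      · exact (hsub ht).2
    change ‖planeL (b t)‖ ≤ R
    rw [hR]
    linarith
  -- The set of times up to which the path stays in C is closed, and it extends to the right: near a
  -- good time the path is still in the open tube, and `hmainC` puts it back into C.
  have hS : Icc (0 : ℝ) 1 ⊆ {τ | ∀ t ∈ Icc 0 τ, p t ∈ C} := by
    refine IsClosed.Icc_subset_of_forall_exists_gt (IsClosed.inter ?_ isClosed_Icc) ?_ ?_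
    · rw [← isOpen_compl_iff, isOpen_iff_mem_nhds]
      intro τ hτ
      change ¬ ∀ t ∈ Icc 0 τ, p t ∈ C at hτ
      push Not at hτ
      obtain ⟨t, ht, htC⟩ := hτ
      have ht0 : 0 < t := lt_of_le_of_ne ht.1 fun h => htC (h ▸ hp0)
      have h6 : ∀ᶠ t' in 𝓝[<] t, p t' ∉ C ∧ 0 < t' := by
        refine Filter.Eventually.filter_mono nhdsWithin_le_nhds ?_
        exact (hp.continuousAt.eventually (hCc.isOpen_compl.mem_nhds htC)).and (lt_mem_nhds ht0)
      obtain ⟨t', ⟨h7, h8⟩, h9⟩ := (h6.and self_mem_nhdsWithin).exists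
      filter_upwards [lt_mem_nhds (lt_of_lt_of_le h9 ht.2)] with τ' hτ'
      exact fun hall => h7 (hall t' ⟨h8.le, hτ'.le⟩)
    · intro t ht
      rw [Icc_self, mem_singleton_iff] at ht
      rw [ht]; exact hp0
    · rintro x ⟨hxS, hx⟩ y hy
      have h6 : ∀ᶠ t in 𝓝 x, p t ∈ lift φ₂ '' tube ε⁻¹ :=
        hp.continuousAt.eventually (hO.mem_nhds (hCO (hxS x ⟨hx.1, le_rfl⟩)))
      obtain ⟨η, hη, hball⟩ := Metric.eventually_nhds_iff.1 h6
      have hy' : x < y := hy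
      refine ⟨min (min y 1) (x + η / 2), ?_, ?_⟩
      · refine hmainC _ ⟨?_, (min_le_left _ _).trans (min_le_right _ _)⟩ ?_
        · exact le_min (le_min (hx.1.trans hy'.le) zero_le_one) (by linarith [hx.1])
        · intro t ht
          rcases le_or_gt t x with h | h
          · exact hCO (hxS t ⟨ht.1, h⟩)
          · refine hball ?_
            rw [Real.dist_eq, abs_of_pos (by linarith)]
            have := ht.2.trans (min_le_right _ _)
            linarith
      · exact ⟨lt_min (lt_min hy' hx.2) (by linarith), (min_le_left _ _).trans (min_le_left _ _)⟩
  refine main 1 (by simp) fun t ht => ?_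
  rw [← hpt t ht]
  exact hCO (hS (right_mem_Icc.2 zero_le_one) t ht)

/-- A circle of the first tube becomes, in the second, a curve with displacement of m units, where m
is an integer whose absolute value lies between (1 - 7 ε) s and (1 + 7 ε) s. The lower bound gives m
≠ 0, so |m| ≥ 1, and the upper bound gives the claim. If s > 2 nothing is to be proved; the margin 6
is 3 s for s ≤ 2. -/
theorem scale_ge (h₁ : FlatTube I ε c₁ φ₁) (h₂ : FlatTube I ε c₂ φ₂) {q₁ q₂ : Cover}
    (he : lift φ₁ q₁ = lift φ₂ q₂) (hq₁ : q₁ ∈ tube ε⁻¹) (hq₂ : ‖planeL q₂‖ + 6 < ε⁻¹) :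
    1 - 7 * ε ≤ Real.sqrt (c₂ / c₁) := by
  set s := Real.sqrt (c₂ / c₁) with hsdef
  have hs0 : 0 < s := h₁.scale_pos h₂
  have hε := h₁.eps_pos
  have hε1 := h₁.eps_le
  rcases lt_or_ge 2 s with hs | hs
  · linarith
  have hpl : ∀ t : ℝ, q₁ + t • circleDirection ∈ tube ε⁻¹ := fun t => by
    rw [mem_tube, planeL_shift]; exact hq₁
  obtain ⟨b, hb, hb0, hbt⟩ := h₁.exists_segment_lift h₂ hs he (v := circleDirection)
    (fun t _ => hpl t) (by rw [← hsdef, norm_circleDirection]; linarith)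
  have hda : ∀ t ∈ Icc (0 : ℝ) 1, HasDerivWithinAt (fun t : ℝ => q₁ + t • circleDirection)
      circleDirection (Icc 0 1) t := fun t _ => by
    simpa using (((hasDerivAt_id t).smul_const circleDirection).const_add q₁).hasDerivWithinAt
  obtain ⟨D, hD⟩ := h₁.exists_curve_transition h₂ hs (ℓ := 1) hda (fun t _ => by simp)
    (fun t _ => hpl t) hb (fun t ht => (hbt t ht).1) (fun t ht => (hbt t ht).2.1)
  obtain ⟨m, -, hm⟩ := h₁.exists_winding h₂ (ℓ := 1) hda (fun t _ => by simp)
    (fun t ht => (hbt t ht).1) (fun t ht => (hbt t ht).2.1) (by simp)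
    (fun t ht => (hD t ht).1) (fun t ht => (hD t ht).2.2.1)
  obtain ⟨hl, hu⟩ := (hD 0 (by simp)).2.1 circleDirection
  rw [norm_circleDirection, mul_one] at hl hu
  have h4 : ‖(m : ℝ) • circleDirection‖ = |(m : ℝ)| := by
    rw [norm_smul, norm_circleDirection, mul_one, Real.norm_eq_abs]
  have h5 := norm_sub_norm_le (D 0 circleDirection) ((m : ℝ) • circleDirection)
  rw [norm_sub_rev] at h5
  have h6 := norm_sub_norm_le ((m : ℝ) • circleDirection) (D 0 circleDirection)
  rw [← hsdef] at *
  rw [h4] at h5 h6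
  have h7 : (1 - 7 * ε) * s ≤ |(m : ℝ)| := by linarith
  have hm0 : 1 ≤ |(m : ℝ)| := by
    have hmne : m ≠ 0 := by
      rintro rfl
      simp only [Int.cast_zero, abs_zero] at h7
      nlinarith
    exact_mod_cast Int.one_le_abs hmne
  nlinarith

/-- Exchanging the tubes inverts the ratio of the scales, so this is `scale_ge` in the opposite
direction. -/
theorem scale_le (h₁ : FlatTube I ε c₁ φ₁) (h₂ : FlatTube I ε c₂ φ₂) {q₁ q₂ : Cover}
    (he : lift φ₁ q₁ = lift φ₂ q₂) (hq₁ : ‖planeL q₁‖ + 6 < ε⁻¹) (hq₂ : q₂ ∈ tube ε⁻¹) :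
    Real.sqrt (c₂ / c₁) ≤ 1 + 8 * ε := by
  have h3 := h₂.scale_ge h₁ he.symm hq₂ hq₁
  have h4 := h₁.sqrt_div_inv h₂
  have hs0 := h₁.scale_pos h₂
  have hε := h₁.eps_pos
  have hε1 := h₁.eps_le
  have h5 : Real.sqrt (c₂ / c₁) * (1 - 7 * ε) ≤ 1 :=
    (mul_le_mul_of_nonneg_left h3 hs0.le).trans_eq h4
  have h6 : 1 ≤ (1 + 8 * ε) * (1 - 7 * ε) := by nlinarith
  have h7 : 0 < 1 - 7 * ε := by linarith
  exact le_of_mul_le_mul_right (h5.trans h6) h7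

end Curves

end FlatTube

end

end CircleCollapse

/-! ### Global transitions between tubes -/

namespace CircleCollapse

noncomputable section

open Bundle

theorem exists_shift_near (q q₁ : Cover) :
    ∃ n : ℤ, ‖q + (n : ℝ) • circleDirection - q₁‖ ≤ 1 + ‖planeL q - planeL q₁‖ := by
  refine ⟨-⌊q 0 - q₁ 0⌋, (cover_norm_le _).trans ?_⟩
  have h3 : (q + ((-⌊q 0 - q₁ 0⌋ : ℤ) : ℝ) • circleDirection - q₁) 0 = Int.fract (q 0 - q₁ 0) := by
    simp only [Int.fract, PiLp.add_apply, PiLp.smul_apply, PiLp.sub_apply,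
      circleDirection_zero_coord, smul_eq_mul, mul_one]
    push_cast; ring
  rw [h3, abs_of_nonneg (Int.fract_nonneg _), map_sub, planeL_shift]
  linarith [Int.fract_lt_one (q 0 - q₁ 0)]

theorem add_shift_mem_tube {r : ℝ} {q : Cover} (a : ℝ) :
    q + a • circleDirection ∈ tube r ↔ q ∈ tube r := by
  rw [mem_tube, mem_tube, planeL_shift]

theorem add_circleDirection_mem_tube {r : ℝ} {q : Cover} :
    q + circleDirection ∈ tube r ↔ q ∈ tube r := by
  simpa using add_shift_mem_tube (r := r) (q := q) 1

theorem shift_int_tube {X : Type*} {f : Cover → X} {r : ℝ}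
    (hf : ∀ q ∈ tube r, f (q + circleDirection) = f q) {q : Cover} (hq : q ∈ tube r) (n : ℤ) :
    f (q + (n : ℝ) • circleDirection) = f q := by
  classical
  have h1 := shift_int (f := fun q => if q ∈ tube r then some (f q) else none) (fun q => by
    by_cases h : q ∈ tube r
    · simp only [add_circleDirection_mem_tube, h, if_true, hf q h]
    · simp only [add_circleDirection_mem_tube, h, if_false]) q n
  simpa only [add_shift_mem_tube, hq, if_true, Option.some.injEq] using h1

theorem norm_heightL_le : ‖heightL‖ ≤ 1 :=
  ContinuousLinearMap.opNorm_le_bound _ zero_le_one fun q => by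
    rw [one_mul, heightL_apply, Real.norm_eq_abs]; exact abs_height_le q

/-- A transition defined on a large tube, with almost constant differential, may be modified away
from a smaller tube so as to be defined on the whole cover. -/
theorem exists_transition_of_local {M : Type*} {Φ₁ Φ₂ : Cover → M} {T₀ : Cover → Cover} {ε σ : ℝ}
    {q₁ : Cover} (hε : 0 < ε) (hε1 : ε ≤ 1 / 10 ^ 8) (hq₁ : q₁ ∈ tube 200)
    (hT : ∀ q ∈ tube 400, ContDiffAt ℝ ∞ T₀ q)
    (hT2 : ∀ q ∈ tube 400, ‖fderiv ℝ (fderiv ℝ T₀) q‖ ≤ 6 * ε) (hσ : σ = 1 ∨ σ = -1)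
    (hshift : ∀ q ∈ tube 400, T₀ (q + circleDirection) = T₀ q + σ • circleDirection)
    (hlow : ∀ u, (1 - 10 * ε) * ‖u‖ ≤ ‖fderiv ℝ T₀ q₁ u‖)
    (hup : ∀ u, ‖fderiv ℝ T₀ q₁ u‖ ≤ (1 + 11 * ε) * ‖u‖)
    (hdir : ‖σ • circleDirection - fderiv ℝ T₀ q₁ circleDirection‖ ≤ 6 * ε)
    (horth : ∀ y, |inner ℝ (fderiv ℝ T₀ q₁ (sliceL y)) (fderiv ℝ T₀ q₁ circleDirection)| ≤
      3 * ε * ‖y‖)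
    (hcomp : ∀ q ∈ tube 200, Φ₂ (T₀ q) = Φ₁ q) :
    ∃ T A, Transition (10 ^ 7 * ε) Φ₁ Φ₂ T A ∧ T q₁ = T₀ q₁ := by
  set L₀ := fderiv ℝ T₀ q₁ with hL₀
  set E₀ := σ • circleDirection - L₀ circleDirection with hE₀
  -- The differential at q₁, corrected so that it maps the circle direction exactly to σ times
  -- itself. This makes the remainder T₀ - L periodic, so that it can be estimated on one period.
  let L : Cover →L[ℝ] Cover := L₀ + heightL.smulRight E₀
  have hLapp : ∀ v, L v = L₀ v + v 0 • E₀ := fun v => rfl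
  have hLdir : L circleDirection = σ • circleDirection := by
    rw [hLapp, circleDirection_zero_coord, one_smul, hE₀]; abel
  have hLs : ∀ y, L (sliceL y) = L₀ (sliceL y) := fun y => by
    rw [hLapp, sliceL_zero_coord, zero_smul, add_zero]
  have hLL₀ : ‖L - L₀‖ ≤ 6 * ε := by
    have : L - L₀ = heightL.smulRight E₀ := by simp [L]
    rw [this, ContinuousLinearMap.norm_smulRight_apply]
    calc ‖heightL‖ * ‖E₀‖ ≤ 1 * (6 * ε) := by
          gcongr
          exact norm_heightL_le
      _ = _ := one_mul _
  have h24 : tube 200 ⊆ tube 400 := fun q hq => by rw [mem_tube] at *; linarith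
  have hq₁4 := h24 hq₁
  have hTd : ∀ q ∈ tube 400, DifferentiableAt ℝ T₀ q := fun q hq =>
    (hT q hq).differentiableAt (by simp)
  have hDshift : ∀ q ∈ tube 400, fderiv ℝ T₀ (q + circleDirection) = fderiv ℝ T₀ q := by
    intro q hq
    have h1 : (fun p => T₀ (p + circleDirection)) =ᶠ[𝓝 q] fun p => T₀ p + σ • circleDirection := by
      filter_upwards [(isOpen_tube 400).mem_nhds hq] with p hp using hshift p hp
    have h2 := h1.fderiv_eq (𝕜 := ℝ)
    rwa [fderiv_comp_add_right, fderiv_add_const] at h2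
  have hdist : ∀ q ∈ tube 400, ∃ n : ℤ, q + (n : ℝ) • circleDirection ∈ tube 400 ∧
      ‖q + (n : ℝ) • circleDirection - q₁‖ ≤ 601 := by
    intro q hq
    obtain ⟨n, hn⟩ := exists_shift_near q q₁
    refine ⟨n, (add_shift_mem_tube _).2 hq, hn.trans ?_⟩
    rw [mem_tube] at hq hq₁
    linarith [norm_sub_le (planeL q) (planeL q₁)]
  -- After an integral shift, q is at distance at most 1 + 400 + 200 = 601 from q₁, and 6 · 601 =
  -- 3606.
  have hDL₀ : ∀ q ∈ tube 400, ‖fderiv ℝ T₀ q - L₀‖ ≤ 3606 * ε := by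
    intro q hq
    obtain ⟨n, hn, hnd⟩ := hdist q hq
    rw [← shift_int_tube hDshift hq n]
    have h1 := (convex_tube 400).norm_image_sub_le_of_norm_fderiv_le (f := fderiv ℝ T₀) (𝕜 := ℝ)
      (fun p hp => ((hT p hp).fderiv_right (m := 1) two_le_infty).differentiableAt
        (by norm_num)) hT2 hq₁4 hn
    calc _ ≤ 6 * ε * ‖q + (n : ℝ) • circleDirection - q₁‖ := h1
      _ ≤ 6 * ε * 601 := by gcongr
      _ = _ := by ring
  let R : Cover → Cover := fun q => T₀ q - L q
  have hR : ∀ q ∈ tube 400, ContDiffAt ℝ ∞ R q := fun q hq =>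
    (hT q hq).sub L.contDiff.contDiffAt
  have hRshift : ∀ q ∈ tube 400, R (q + circleDirection) = R q := by
    intro q hq
    simp only [R, hshift q hq, map_add, hLdir]; abel
  have hRd : ∀ q ∈ tube 400, HasFDerivAt R (fderiv ℝ T₀ q - L) q := fun q hq =>
    (hTd q hq).hasFDerivAt.sub L.hasFDerivAt
  have hRd2 : ∀ q ∈ tube 400, ‖fderiv ℝ T₀ q - L‖ ≤ 3612 * ε := by
    intro q hq
    have h1 : fderiv ℝ T₀ q - L = (fderiv ℝ T₀ q - L₀) - (L - L₀) := by abel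
    rw [h1]
    exact (norm_sub_le _ _).trans (by linarith [hDL₀ q hq])
  have hRR : ∀ q ∈ tube 400, ‖R q - R q₁‖ ≤ 2200000 * ε := by
    intro q hq
    obtain ⟨n, hn, hnd⟩ := hdist q hq
    rw [← shift_int_tube hRshift hq n]
    have h1 := (convex_tube 400).norm_image_sub_le_of_norm_hasFDerivWithin_le
      (fun p hp => (hRd p hp).hasFDerivWithinAt) hRd2 hq₁4 hn
    calc _ ≤ 3612 * ε * ‖q + (n : ℝ) • circleDirection - q₁‖ := h1
      _ ≤ 3612 * ε * 601 := by gcongr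
      _ ≤ _ := by linarith
  obtain ⟨χ, hχs, hχ1, hχe, hχ0, hχd⟩ := exists_cutoff (Metric.ball 0 250) one_pos
  have hχ300 : ∀ q : Cover, χ (planeL q) ≠ 0 → q ∈ tube 300 := by
    intro q hq
    obtain ⟨z, hz, hqz⟩ := Metric.mem_thickening_iff.1 (hχ0 _ hq)
    rw [mem_ball_zero_iff] at hz
    rw [dist_eq_norm] at hqz
    rw [mem_tube]
    linarith [norm_le_norm_add_norm_sub' (planeL q) z]
  let g : Cover → ℝ := fun q => χ (planeL q)
  have hgs : ContDiff ℝ ∞ g := hχs.comp planeL.contDiff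
  have hgd : ∀ q, ‖fderiv ℝ g q‖ ≤ 1 := by
    intro q
    have h1 : HasFDerivAt g ((fderiv ℝ χ (planeL q)).comp planeL) q :=
      ((hχs.differentiable (by simp)) _).hasFDerivAt.comp q planeL.hasFDerivAt
    rw [h1.fderiv]
    refine (ContinuousLinearMap.opNorm_comp_le _ _).trans ?_
    calc _ ≤ (1 : ℝ)⁻¹ * 1 := by
          gcongr
          · exact hχd _
          · exact norm_planeL_le
      _ = 1 := by norm_num
  have hgz : ∀ q ∉ tube 400, ∀ᶠ p in 𝓝 q, g p = 0 := by
    intro q hq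
    rw [mem_tube, not_lt] at hq
    have h1 : ∀ᶠ p in 𝓝 q, 300 < ‖planeL p‖ :=
      planeL.continuous.norm.continuousAt.eventually (lt_mem_nhds (by linarith))
    filter_upwards [h1] with p hp
    by_contra hne
    exact absurd (hχ300 p hne) (by rw [mem_tube]; linarith)
  -- Subtracting R q₁ makes the factor of the derivative of the cutoff small. Then L + R q₁ + Q is
  -- T₀ on the inner tube and affine far out, with differential uniformly close to L.
  let Q : Cover → Cover := fun q => g q • (R q - R q₁)
  have hQs : ContDiff ℝ ∞ Q := by
    rw [contDiff_iff_contDiffAt]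
    intro q
    by_cases hq : q ∈ tube 400
    · exact hgs.contDiffAt.smul ((hR q hq).sub contDiffAt_const)
    · refine (contDiffAt_const (c := (0 : Cover))).congr_of_eventuallyEq ?_
      filter_upwards [hgz q hq] with p hp
      simp [Q, hp]
  have hQd : ∀ q, ‖fderiv ℝ Q q‖ ≤ 2203612 * ε := by
    intro q
    by_cases hq : q ∈ tube 400
    · have h1 : HasFDerivAt Q (g q • (fderiv ℝ T₀ q - L) +
          (fderiv ℝ g q).smulRight (R q - R q₁)) q :=
        ((hgs.differentiable (by simp)) q).hasFDerivAt.smul ((hRd q hq).sub_const _)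
      rw [h1.fderiv]
      refine (norm_add_le _ _).trans ?_
      rw [norm_smul, ContinuousLinearMap.norm_smulRight_apply]
      calc _ ≤ 1 * (3612 * ε) + 1 * (2200000 * ε) := by
            gcongr
            · exact hχ1 _
            · exact hRd2 q hq
            · exact hgd q
            · exact hRR q hq
        _ = _ := by ring
    · have h1 : Q =ᶠ[𝓝 q] fun _ => 0 := by
        filter_upwards [hgz q hq] with p hp
        simp [Q, hp]
      rw [h1.fderiv_eq, fderiv_fun_const, Pi.zero_apply, norm_zero]
      positivity
  have hQshift : ∀ q, Q (q + circleDirection) = Q q := by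
    intro q
    have h1 : g (q + circleDirection) = g q := by simp [g]
    by_cases hq : q ∈ tube 400
    · simp only [Q, h1, hRshift q hq]
    · simp only [Q, h1, (hgz q hq).self_of_nhds, zero_smul]
  let T : Cover → Cover := fun q => L q + R q₁ + Q q
  have hTs : ContDiff ℝ ∞ T := (L.contDiff.add contDiff_const).add hQs
  have hTfd : ∀ q, fderiv ℝ T q = L + fderiv ℝ Q q := fun q =>
    ((L.hasFDerivAt.add_const _).add ((hQs.differentiable (by simp)) q).hasFDerivAt).fderiv
  have hTL : ∀ q, ‖fderiv ℝ T q - L‖ ≤ 2203612 * ε := fun q => by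
    rw [hTfd, add_sub_cancel_left]; exact hQd q
  have hTT₀ : ∀ q ∈ tube 200, T q = T₀ q := by
    intro q hq
    have h1 : g q = 1 := by
      refine hχe _ (Metric.self_subset_thickening one_pos _ ?_)
      rw [mem_ball_zero_iff]
      rw [mem_tube] at hq; linarith
    simp only [T, Q, h1, one_smul, R]; abel
  have hLlow : ∀ u, (1 - 16 * ε) * ‖u‖ ≤ ‖L u‖ := by
    intro u
    have h1 := (L - L₀).le_of_opNorm_le hLL₀ u
    rw [sub_apply] at h1
    linarith [hlow u, norm_sub_norm_le (L₀ u) (L u), norm_sub_rev (L u) (L₀ u)]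
  have hLn : ‖L‖ ≤ 1 + 17 * ε := by
    refine ContinuousLinearMap.opNorm_le_bound _ (by linarith) fun u => ?_
    have h1 := (L - L₀).le_of_opNorm_le hLL₀ u
    rw [sub_apply] at h1
    linarith [hup u, norm_sub_norm_le (L u) (L₀ u)]
  -- L preserves the circle axis, so its planar part depends on the planar part of v only; the
  -- resulting map of the plane is the linear part A.
  have hpl : ∀ v, planeL (L v) = planeL (L (sliceL (planeL v))) := by
    intro v
    conv_lhs => rw [← cover_decomp v]
    rw [map_add, map_smul, hLdir, map_add, map_smul, map_smul, planeL_circleDirection]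
    simp
  -- Used only for the surjectivity of T.
  obtain ⟨G, -, -, hG⟩ := exists_smooth_inverse hTs (a := 1 - 16 * ε) (c := 2203612 * ε)
    (by positivity) (by linarith) hLlow hTL
  refine ⟨T, planeL.comp (L.comp sliceL), ⟨hTs, ?_, fun q => ⟨G q, hG q⟩, fun q hq => ?_,
    fun q => ?_, fun q => ?_, fun y => ?_, fun y => ?_⟩, hTT₀ q₁ hq₁⟩
  · rcases hσ with h | h
    · left; intro q
      simp only [T, hQshift, map_add, hLdir, h, one_smul]; abel
    · right; intro q
      simp only [T, hQshift, map_add, hLdir, h, neg_smul, one_smul]; abel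
  · rw [hTT₀ q hq, hcomp q hq]
  · have h1 : fderiv ℝ T q = L + (fderiv ℝ T q - L) := by abel
    rw [h1]
    refine (norm_add_le _ _).trans ?_
    linarith [hTL q]
  · have h1 : planeL.comp (fderiv ℝ T q) - (planeL.comp (L.comp sliceL)).comp planeL =
        planeL.comp (fderiv ℝ T q - L) := by
      ext1 v
      simp only [sub_apply, ContinuousLinearMap.comp_apply, map_sub]
      rw [← hpl v]
    rw [h1]
    refine (ContinuousLinearMap.opNorm_comp_le _ _).trans ?_
    calc _ ≤ 1 * (2203612 * ε) := by
          gcongr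
          · exact norm_planeL_le
          · exact hTL q
      _ ≤ _ := by linarith
  · have hy := norm_nonneg y
    -- Almost orthogonality of the images of the slice and of the circle direction (3 ε) together
    -- with the error E₀ (7 ε) bounds the height component. Hence the planar part keeps almost the
    -- full norm.
    have h1 : |(L (sliceL y)) 0| ≤ 10 * ε * ‖y‖ := by
      have h2 : inner ℝ (L (sliceL y)) (σ • circleDirection) = σ * (L (sliceL y)) 0 := by
        rw [inner_smul_right, circleDirection, EuclideanSpace.inner_single_right]
        simp
      have h3 : σ • circleDirection = L₀ circleDirection + E₀ := by rw [hE₀]; abel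
      rw [h3, inner_add_right, hLs] at h2
      have h4 : |(L (sliceL y)) 0| = |σ * (L₀ (sliceL y)) 0| := by
        rw [abs_mul, hLs]
        rcases hσ with h | h <;> simp [h]
      rw [h4, ← h2]
      refine (abs_add_le _ _).trans ?_
      have h5 := abs_real_inner_le_norm (L₀ (sliceL y)) E₀
      have h6 := hup (sliceL y)
      rw [norm_sliceL_apply] at h6
      have h7 : ‖L₀ (sliceL y)‖ * ‖E₀‖ ≤ ((1 + 11 * ε) * ‖y‖) * (6 * ε) := by gcongr
      have h8 : (1 + 11 * ε) * ‖y‖ * (6 * ε) ≤ 7 * ε * ‖y‖ := by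
        have h9 : 0 ≤ ε * ‖y‖ := by positivity
        nlinarith
      linarith [horth y]
    have h2 := cover_norm_le (L (sliceL y))
    have h3 := hLlow (sliceL y)
    rw [norm_sliceL_apply] at h3
    have h9 : 0 ≤ ε * ‖y‖ := by positivity
    simp only [ContinuousLinearMap.comp_apply]
    nlinarith
  · have hy := norm_nonneg y
    have h2 := norm_planeL_apply_le (L (sliceL y))
    have h3 := hup (sliceL y)
    rw [norm_sliceL_apply, ← hLs] at h3
    have h9 : 0 ≤ ε * ‖y‖ := by positivity
    simp only [ContinuousLinearMap.comp_apply]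
    nlinarith

variable {H : Type*} [TopologicalSpace H] {I : ModelWithCorners ℝ (EuclideanSpace ℝ (Fin 3)) H}
  {M : Type*} [EMetricSpace M] [ChartedSpace H M]
  [RiemannianBundle (fun x : M => TangentSpace I x)]

namespace FlatTube

variable {ε c c₁ c₂ : ℝ} {φ φ₁ φ₂ : Circle × Plane → M}

theorem inv_gt (h : FlatTube I ε c φ) (hε : ε ≤ 1 / 10 ^ 8) : (10 : ℝ) ^ 7 < ε⁻¹ := by
  rw [lt_inv_comm₀ (by norm_num) h.eps_pos]
  exact hε.trans_lt (by norm_num)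

theorem tubeChart (h : FlatTube I ε c φ) (hε : ε ≤ 1 / 10 ^ 8) : TubeChart (lift φ) where
  shift := lift_shift φ
  inj q q' hq hq' he := by
    have := h.inv_gt hε
    exact (h.lift_eq_iff (by rw [mem_tube]; linarith) (by rw [mem_tube]; linarith)).1 he
  continuousAt q hq := by
    have := h.inv_gt hε
    exact (h.contMDiffAt_lift (by rw [mem_tube]; linarith)).continuousAt

/-- The transition is obtained on a whole tube by lifting, since the tube is convex and hence simply
connected. The scale estimates and the bound for the second derivative then verify the hypotheses of
`exists_transition_of_local`. -/
theorem exists_transition [IsManifold I ∞ M]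
    [IsContMDiffRiemannianBundle I ∞ (EuclideanSpace ℝ (Fin 3)) (fun x : M => TangentSpace I x)]
    (h₁ : FlatTube I ε c₁ φ₁) (h₂ : FlatTube I ε c₂ φ₂) (hε1 : ε ≤ 1 / 10 ^ 8) {q₁ q₂ : Cover}
    (hq₁ : q₁ ∈ tube 200) (hq₂ : q₂ ∈ tube 200) (he : lift φ₁ q₁ = lift φ₂ q₂) :
    ∃ T A, Transition (10 ^ 7 * ε) (lift φ₁) (lift φ₂) T A ∧ T q₁ = q₂ := by
  have hε := h₁.eps_pos
  have hinv := h₁.inv_gt hε1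
  have hsub : ∀ {r : ℝ}, r ≤ 400 → tube r ⊆ tube ε⁻¹ := fun {r} hr q hq => by
    rw [mem_tube] at *; linarith
  rw [mem_tube] at hq₁ hq₂
  have hslow := h₁.scale_ge h₂ he (hsub (by norm_num) hq₁) (by linarith)
  have hsup := h₁.scale_le h₂ he (by linarith) (hsub (by norm_num) hq₂)
  set s := Real.sqrt (c₂ / c₁) with hs
  have hs2 : s ≤ 2 := by linarith
  -- Up to an integral shift, q is joined to q₁ by a segment of length at most 601. The lift of the
  -- segment needs room 3 · 2 · 601 in the second tube, far below its radius, which exceeds 10 ^ 7.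
  have hin : ∀ q ∈ tube 400, lift φ₁ q ∈ lift φ₂ '' tube ε⁻¹ := by
    intro q hq
    obtain ⟨n, hn⟩ := exists_shift_near q q₁
    have hq' : q + (n : ℝ) • circleDirection ∈ tube 400 := (add_shift_mem_tube _).2 hq
    have hv : ‖q + (n : ℝ) • circleDirection - q₁‖ ≤ 601 := by
      rw [mem_tube] at hq
      linarith [norm_sub_le (planeL q) (planeL q₁)]
    obtain ⟨b, -, -, hb⟩ := h₁.exists_segment_lift h₂ hs2 he
      (v := q + (n : ℝ) • circleDirection - q₁) (fun t ht => by
        refine (convex_tube ε⁻¹).add_smul_sub_mem (hsub (by norm_num) hq₁) ?_ ht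
        exact hsub le_rfl hq') (by
        have : 3 * s * ‖q + (n : ℝ) • circleDirection - q₁‖ ≤ 3 * 2 * 601 := by
          have := h₁.scale_pos h₂
          gcongr
        rw [← hs]
        linarith)
    obtain ⟨hb1, hb2, -⟩ := hb 1 (by simp)
    rw [one_smul, add_sub_cancel, shift_int (lift_shift φ₁)] at hb2
    exact ⟨b 1, hb1, hb2.symm⟩
  obtain ⟨T₀, hT₀c, hT₀q, hT₀⟩ := h₂.exists_lift_convex (isOpen_tube 400) (convex_tube 400)
    (h₁.contMDiffOn_lift.continuousOn.mono (hsub le_rfl)) hin (q₁ := q₁) (q₂ := q₂)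
    (by rw [mem_tube]; linarith) (hsub (by norm_num) hq₂) he
  have hq₁4 : q₁ ∈ tube 400 := by rw [mem_tube]; linarith
  have hT : ∀ q ∈ tube 400, ContDiffAt ℝ ∞ T₀ q := by
    intro q hq
    obtain ⟨T, hT, -, -, hTu⟩ := h₁.exists_local_transition h₂ (hsub le_rfl hq) (hT₀ q hq).1
      (hT₀ q hq).2
    have hqn := (isOpen_tube 400).mem_nhds hq
    have h3 : ContinuousAt (fun p => (p, T₀ p)) q :=
      continuousAt_id.prodMk (hT₀c.continuousAt hqn)
    refine hT.congr_of_eventuallyEq ?_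
    filter_upwards [h3.eventually hTu, hqn] with p h4 h5
    exact h4 (hT₀ p h5).2
  have hTe : ∀ q ∈ tube 400, ∀ᶠ p in 𝓝 q, lift φ₂ (T₀ p) = lift φ₁ p := by
    intro q hq
    filter_upwards [(isOpen_tube 400).mem_nhds hq] with p hp using (hT₀ p hp).2.symm
  have hTd : ∀ q ∈ tube 400, DifferentiableAt ℝ T₀ q := fun q hq =>
    (hT q hq).differentiableAt (by simp)
  have hT2 : ∀ q ∈ tube 400, ‖fderiv ℝ (fderiv ℝ T₀) q‖ ≤ 6 * ε := by
    intro q hq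
    refine (h₁.norm_second_fderiv_transition h₂ hs2 (hsub le_rfl hq) (hT₀ q hq).1 (hT q hq)
      (hTe q hq)).trans ?_
    rw [← hs]
    nlinarith
  have hD : ∀ u, (1 - 2 * ε) * s * ‖u‖ ≤ ‖fderiv ℝ T₀ q₁ u‖ ∧
      ‖fderiv ℝ T₀ q₁ u‖ ≤ (1 + 2 * ε) * s * ‖u‖ := fun u =>
    h₁.norm_fderiv_transition h₂ (hsub le_rfl hq₁4) (hT₀ q₁ hq₁4).1 (hTd q₁ hq₁4) (hTe q₁ hq₁4) u
  have hlow : ∀ u, (1 - 10 * ε) * ‖u‖ ≤ ‖fderiv ℝ T₀ q₁ u‖ := fun u => by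
    refine le_trans ?_ (hD u).1
    gcongr
    nlinarith
  have hup : ∀ u, ‖fderiv ℝ T₀ q₁ u‖ ≤ (1 + 11 * ε) * ‖u‖ := fun u => by
    refine (hD u).2.trans ?_
    gcongr
    nlinarith
  have hm : ∀ q ∈ tube 400, ∃ m : ℤ, T₀ (q + circleDirection) = T₀ q + (m : ℝ) • circleDirection :=
    fun q hq => by
      have hq' := add_circleDirection_mem_tube.2 hq
      refine (h₂.lift_eq_iff (hT₀ q hq).1 (hT₀ _ hq').1).1 ?_
      rw [← (hT₀ q hq).2, ← (hT₀ _ hq').2, lift_shift]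
  choose! m hm using hm
  -- The winding number is integral and, being the height increment of a continuous map, takes
  -- values in a connected set; so it is constant.
  have hmc : ∀ q ∈ tube 400, m q = m q₁ := by
    have h1 : IsPreconnected ((fun q => (T₀ (q + circleDirection) - T₀ q) 0) '' tube 400) := by
      refine (convex_tube 400).isPreconnected.image _ ?_
      refine heightL.continuous.comp_continuousOn (ContinuousOn.sub ?_ hT₀c)
      exact hT₀c.comp (by fun_prop) fun q hq => add_circleDirection_mem_tube.2 hq
    have h2 : ∀ q ∈ tube 400, (T₀ (q + circleDirection) - T₀ q) 0 = m q := fun q hq => by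
      rw [hm q hq, add_sub_cancel_left]
      simp
    have h3 : ∀ p ∈ tube 400, ∀ q ∈ tube 400, m q ≤ m p := by
      intro p hp q hq
      by_contra! hlt
      have h5 := h1.Icc_subset ⟨p, hp, h2 p hp⟩ ⟨q, hq, h2 q hq⟩
      have h4 : ((m p : ℝ) + 1 / 2) ∈ Icc (m p : ℝ) (m q : ℝ) := by
        have : ((m p + 1 : ℤ) : ℝ) ≤ m q := by exact_mod_cast hlt
        push_cast at this
        exact ⟨by linarith, by linarith⟩
      obtain ⟨z, hz, hze⟩ := h5 h4
      simp only [h2 z hz] at hze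
      have h6 : ((2 * m z : ℤ) : ℝ) = (2 * m p + 1 : ℤ) := by push_cast; linarith
      have h7 : 2 * m z = 2 * m p + 1 := by exact_mod_cast h6
      omega
    exact fun q hq => le_antisymm (h3 _ hq₁4 _ hq) (h3 _ hq _ hq₁4)
  have hdir : ‖(m q₁ : ℝ) • circleDirection - fderiv ℝ T₀ q₁ circleDirection‖ ≤ 6 * ε := by
    have hseg : segment ℝ q₁ (q₁ + circleDirection) ⊆ tube 400 :=
      (convex_tube 400).segment_subset hq₁4 (add_circleDirection_mem_tube.2 hq₁4)
    have hball : ∀ p ∈ segment ℝ q₁ (q₁ + circleDirection), ‖p - q₁‖ ≤ 1 := by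
      intro p hp
      have := norm_sub_le_of_mem_segment hp
      simpa using this
    have h4 : ∀ p ∈ segment ℝ q₁ (q₁ + circleDirection),
        ‖fderiv ℝ T₀ p - fderiv ℝ T₀ q₁‖ ≤ 6 * ε := by
      intro p hp
      have h1 := (convex_tube 400).norm_image_sub_le_of_norm_fderiv_le (f := fderiv ℝ T₀) (𝕜 := ℝ)
        (fun p hp => ((hT p hp).fderiv_right (m := 1) two_le_infty).differentiableAt
          (by norm_num)) hT2 hq₁4 (hseg hp)
      refine h1.trans ?_
      have := hball p hp
      nlinarith
    have h5 := (convex_segment q₁ (q₁ + circleDirection)).norm_image_sub_le_of_norm_hasFDerivWithin_le'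
      (f := T₀) (φ := fderiv ℝ T₀ q₁) (fun p hp => (hTd p (hseg hp)).hasFDerivAt.hasFDerivWithinAt)
      h4 (left_mem_segment ℝ _ _) (right_mem_segment ℝ _ _)
    rwa [hm q₁ hq₁4, add_sub_cancel_left, add_sub_cancel_left, norm_circleDirection, mul_one] at h5
  -- By `hdir`, `hlow` and `hup`, |m q₁| differs from 1 by at most 17 ε.
  have hσ : (m q₁ : ℝ) = 1 ∨ (m q₁ : ℝ) = -1 := by
    have h4 : ‖(m q₁ : ℝ) • circleDirection‖ = |(m q₁ : ℝ)| := by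
      rw [norm_smul, norm_circleDirection, mul_one, Real.norm_eq_abs]
    have h5 := norm_sub_norm_le (fderiv ℝ T₀ q₁ circleDirection) ((m q₁ : ℝ) • circleDirection)
    rw [norm_sub_rev] at h5
    have h6 := norm_sub_norm_le ((m q₁ : ℝ) • circleDirection) (fderiv ℝ T₀ q₁ circleDirection)
    have h7 := hlow circleDirection
    have h8 := hup circleDirection
    rw [norm_circleDirection] at h7 h8
    rw [h4] at h5 h6
    have h9 : |(m q₁ : ℝ)| < 2 := by linarith
    have h10 : 0 < |(m q₁ : ℝ)| := by linarith
    have h11 : |m q₁| < 2 := by exact_mod_cast h9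
    have h12 : 0 < |m q₁| := by exact_mod_cast h10
    have h13 : |m q₁| = 1 := by omega
    rcases (abs_eq zero_le_one).1 h13 with h | h
    · left; exact_mod_cast h
    · right; exact_mod_cast h
  have horth : ∀ y, |inner ℝ (fderiv ℝ T₀ q₁ (sliceL y)) (fderiv ℝ T₀ q₁ circleDirection)| ≤
      3 * ε * ‖y‖ := by
    intro y
    have h1 := h₁.form_transition h₂ (hT₀ q₁ hq₁4).1 (hTd q₁ hq₁4) (hTe q₁ hq₁4) (sliceL y)
      circleDirection
    have h2 := abs_form_sub_inner_le (h₂.close (hT₀ q₁ hq₁4).1) (fderiv ℝ T₀ q₁ (sliceL y))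
      (fderiv ℝ T₀ q₁ circleDirection)
    have h3 := abs_form_sub_inner_le (h₁.close (hsub le_rfl hq₁4)) (sliceL y) circleDirection
    have h4 : inner ℝ (sliceL y) circleDirection = 0 := by
      rw [circleDirection, EuclideanSpace.inner_single_right]; simp
    rw [h4, sub_zero, norm_sliceL_apply, norm_circleDirection, mul_one] at h3
    have h5 := hup (sliceL y)
    have h6 := hup circleDirection
    rw [norm_sliceL_apply] at h5
    rw [norm_circleDirection, mul_one] at h6
    have hy := norm_nonneg y
    have h7 : ε * ‖fderiv ℝ T₀ q₁ (sliceL y)‖ * ‖fderiv ℝ T₀ q₁ circleDirection‖ ≤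
        ε * ((1 + 11 * ε) * ‖y‖) * (1 + 11 * ε) := by gcongr
    have h8 : ε * ((1 + 11 * ε) * ‖y‖) * (1 + 11 * ε) ≤ (3 / 2) * (ε * ‖y‖) := by
      have h9 : 0 ≤ ε * ‖y‖ := by positivity
      have h10 : (1 + 11 * ε) * (1 + 11 * ε) ≤ 3 / 2 := by nlinarith
      nlinarith
    rw [h1, ← hs] at h2
    have h9 : |s ^ 2 * form I c₁ φ₁ q₁ (sliceL y) circleDirection| ≤ (3 / 2) * (ε * ‖y‖) := by
      rw [abs_mul, abs_of_nonneg (sq_nonneg s)]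
      have h10 : s ^ 2 ≤ 3 / 2 := by
        have := h₁.scale_pos h₂
        rw [← hs] at this
        nlinarith
      exact mul_le_mul h10 h3 (abs_nonneg _) (by norm_num)
    rw [abs_le] at h2 h9 ⊢
    constructor <;> linarith [h2.1, h2.2, h9.1, h9.2]
  obtain ⟨T, A, hTA, hTq⟩ := exists_transition_of_local (Φ₁ := lift φ₁) (Φ₂ := lift φ₂) hε hε1
    (q₁ := q₁) hq₁ hT hT2 hσ (fun q hq => by rw [hm q hq, hmc q hq]) hlow hup hdir horth
    (fun q hq => (hT₀ q (by rw [mem_tube] at *; linarith)).2.symm)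
  exact ⟨T, A, hTA, hTq.trans hT₀q⟩

theorem tubeFamily [IsManifold I ∞ M]
    [IsContMDiffRiemannianBundle I ∞ (EuclideanSpace ℝ (Fin 3)) (fun x : M => TangentSpace I x)]
    {J : Type*} {φ : J → Circle × Plane → M} {c : J → ℝ} (h : ∀ j, FlatTube I ε (c j) (φ j))
    (hε : ε ≤ 1 / 10 ^ 8) : TubeFamily (10 ^ 7 * ε) fun j => lift (φ j) where
  tube j := (h j).tubeChart hε
  transition j k _ _ hq₁ hq₂ he := (h j).exists_transition (h k) hε hq₁ hq₂ he

end FlatTube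

end

end CircleCollapse

/-! ### Colouring and packing: a subfamily with boundedly many colours -/

namespace CircleCollapse

noncomputable section

/-- Vertices are inserted one at a time: the new vertex has at most N neighbours, so one of the N +
1 colours is free. -/
theorem exists_greedy_coloring {J : Type*} [Finite J] {r : J → J → Prop}
    (hr : ∀ j k, r j k → r k j) {N : ℕ}
    (hN : ∀ (j : J) (s : Finset J), (∀ k ∈ s, k ≠ j ∧ r j k) → s.card ≤ N) :
    ∃ color : J → ℕ, (∀ j, color j ≤ N) ∧ ∀ j k, j ≠ k → r j k → color j ≠ color k := by
  classical
  have := Fintype.ofFinite J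
  have key : ∀ s : Finset J, ∃ color : J → ℕ, (∀ j, color j ≤ N) ∧
      ∀ j ∈ s, ∀ k ∈ s, j ≠ k → r j k → color j ≠ color k := by
    intro s
    induction s using Finset.induction_on with
    | empty => exact ⟨fun _ => 0, fun _ => Nat.zero_le _, by simp⟩
    | insert a s ha ih =>
      obtain ⟨color, hc, hcol⟩ := ih
      let nb : Finset J := s.filter fun k => k ≠ a ∧ r a k
      have h1 : (nb.image color).card < (Finset.range (N + 1)).card := by
        rw [Finset.card_range, Nat.lt_succ_iff]
        exact Finset.card_image_le.trans (hN a nb fun k hk => (Finset.mem_filter.1 hk).2)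
      obtain ⟨m, hm, hmn⟩ := Finset.exists_mem_notMem_of_card_lt_card h1
      have hne : ∀ k ∈ s, r a k → color k ≠ m := by
        intro k hk hrk he
        refine hmn (Finset.mem_image.2 ⟨k, Finset.mem_filter.2 ⟨hk, ?_, hrk⟩, he⟩)
        rintro rfl
        exact ha hk
      have hup : ∀ k ∈ s, Function.update color a m k = color k := fun k hk =>
        Function.update_of_ne (by rintro rfl; exact ha hk) _ _
      refine ⟨Function.update color a m, fun j => ?_, ?_⟩
      · by_cases h : j = a
        · rw [h, Function.update_self]
          exact Nat.lt_succ_iff.1 (Finset.mem_range.1 hm)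
        · rw [Function.update_of_ne h]
          exact hc j
      · intro j hj k hk hjk hrk
        rcases Finset.mem_insert.1 hj with rfl | hj' <;> rcases Finset.mem_insert.1 hk with rfl | hk'
        · exact absurd rfl hjk
        · rw [Function.update_self, hup k hk']
          exact (hne k hk' hrk).symm
        · rw [Function.update_self, hup j hj']
          exact hne j hj' (hr _ _ hrk)
        · rw [hup j hj', hup k hk']
          exact hcol j hj' k hk' hjk hrk
  obtain ⟨color, hc, hcol⟩ := key Finset.univ
  exact ⟨color, hc, fun j k => hcol j (Finset.mem_univ _) k (Finset.mem_univ _)⟩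

/-- A separated set that is maximal for inclusion. The relation is not symmetric in the application,
hence both orders. -/
theorem exists_maximal_separated {J : Type*} [Finite J] (r : J → J → Prop) :
    ∃ S : Set J, (∀ j ∈ S, ∀ k ∈ S, j ≠ k → ¬ (r j k ∨ r k j)) ∧
      ∀ x, ∃ j ∈ S, x = j ∨ r j x ∨ r x j := by
  obtain ⟨S, hS⟩ := (Set.toFinite {S : Set J |
    ∀ j ∈ S, ∀ k ∈ S, j ≠ k → ¬ (r j k ∨ r k j)}).exists_maximal ⟨∅, by simp⟩
  refine ⟨S, hS.prop, fun x => ?_⟩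
  by_contra! h
  have hx : x ∉ S := fun hx => (h x hx).1 rfl
  have h1 : insert x S ∈ {S : Set J | ∀ j ∈ S, ∀ k ∈ S, j ≠ k → ¬ (r j k ∨ r k j)} := by
    intro j hj k hk hjk
    rcases hj with rfl | hj <;> rcases hk with rfl | hk
    · exact absurd rfl hjk
    · exact fun h' => h'.elim (h k hk).2.2 (h k hk).2.1
    · exact fun h' => h'.elim (h j hj).2.1 (h j hj).2.2
    · exact hS.prop j hj k hk hjk
  exact hx (hS.le_of_ge h1 (subset_insert _ _) (mem_insert _ _))

/-- Finitely many balls of radius 1/2 cover the disk, and each contains at most one point of a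
1-separated set. -/
theorem exists_packing_bound : ∃ N : ℕ, ∀ s : Finset Plane, (∀ y ∈ s, ‖y‖ ≤ 110) →
    (∀ y ∈ s, ∀ y' ∈ s, y ≠ y' → 1 ≤ ‖y - y'‖) → s.card ≤ N := by
  obtain ⟨t, -, htf, ht⟩ := (isCompact_closedBall (0 : Plane) 110).finite_cover_balls
    (e := 1 / 2) (by norm_num)
  refine ⟨htf.toFinset.card, fun s hs hsep => ?_⟩
  have h1 : ∀ y ∈ s, ∃ x ∈ t, ‖y - x‖ < 1 / 2 := fun y hy => by
    obtain ⟨x, hx, hxy⟩ := mem_iUnion₂.1 (ht (mem_closedBall_zero_iff.2 (hs y hy)))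
    exact ⟨x, hx, by rwa [Metric.mem_ball, dist_eq_norm] at hxy⟩
  choose! f hf hfy using h1
  refine Finset.card_le_card_of_injOn f (fun y hy => htf.mem_toFinset.2 (hf y hy)) ?_
  intro y hy y' hy' he
  by_contra hne
  have h2 := hfy y hy
  have h3 := hfy y' hy'
  rw [← he] at h3
  have h4 : ‖y - y'‖ ≤ ‖y - f y‖ + ‖y' - f y‖ := by
    rw [← sub_sub_sub_cancel_right y y' (f y)]
    exact norm_sub_le _ _
  linarith [hsep y hy y' hy' hne]

/-- The number of points of mutual distance at least `1` in a disk of radius `110` does not exceed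
this number. -/
def packingBound : ℕ := exists_packing_bound.choose

/-- The ratio of the quality of a fibration to the quality of the transitions. -/
def fibrationRatio : ℝ := (360 * (packingBound + 1 : ℝ)) ^ (packingBound + 1)

theorem one_le_fibrationRatio : 1 ≤ fibrationRatio := by
  refine one_le_pow₀ ?_
  have : (0 : ℝ) ≤ packingBound := by positivity
  linarith

variable {M : Type*} [TopologicalSpace M] {J : Type*} {Φ : J → Cover → M} {κ : ℝ}

theorem TubeFamily.comp {J' : Type*} (hΦ : TubeFamily κ Φ) (f : J' → J) :
    TubeFamily κ fun j => Φ (f j) :=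
  ⟨fun _ => hΦ.tube _, fun _ _ => hΦ.transition _ _⟩

theorem TubeFamily.exists_dist_le (hΦ : TubeFamily κ Φ) (hκ : κ ≤ 1 / 100) {j k : J}
    {q₁ q₂ q : Cover} (hq₁ : ‖planeL q₁‖ < 200) (hq₂ : ‖planeL q₂‖ < 200) (hq : ‖planeL q‖ < 200)
    (he : Φ j q₁ = Φ k q₂) :
    ∃ p, Φ k p = Φ j q ∧ ‖planeL p - planeL q₂‖ ≤ (1 + 1 / 50) * ‖planeL q - planeL q₁‖ + 1 / 100 := by
  obtain ⟨T, A, hT, hTq⟩ := hΦ.transition j k q₁ q₂ hq₁ hq₂ he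
  refine ⟨T q, hT.comp_eq q hq, ?_⟩
  have h1 := hT.plane_dist_le q q₁
  rw [hTq] at h1
  have := norm_nonneg (planeL q - planeL q₁)
  nlinarith

/-- A finite family of tubes has a subfamily which is fibred and covers the central parts of all
of them. -/
theorem TubeFamily.exists_subfamily_isFibration [T2Space M] [Finite J] (hΦ : TubeFamily κ Φ)
    (hκ0 : 0 ≤ κ) (hκ : fibrationRatio * κ ≤ 1 / 100) :
    ∃ (S : Set J) (V : Set M) (F : M → Set M),
      IsFibration (fun j : S => Φ j) (fibrationRatio * κ) V F ∧
      ∀ j q, ‖planeL q‖ < 1 → Φ j q ∈ V := by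
  classical
  have hκ1 : κ ≤ 1 / 100 := by nlinarith [one_le_fibrationRatio]
  have hz : ‖planeL (0 : Cover)‖ = 0 := by simp
  -- The centre of tube k lies, as seen in tube j, within 2 of the axis.
  let r : J → J → Prop := fun j k => ∃ q, ‖planeL q‖ < 2 ∧ Φ j q = Φ k 0
  obtain ⟨S, hSsep, hSmax⟩ := exists_maximal_separated r
  let adj : S → S → Prop := fun j k =>
    ∃ q q', ‖planeL q‖ < 50 ∧ ‖planeL q'‖ < 50 ∧ Φ j q = Φ k q'
  obtain ⟨color, hcol, hcolne⟩ := exists_greedy_coloring (r := adj) (N := packingBound)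
    (fun j k ⟨q, q', hq, hq', he⟩ => ⟨q', q, hq', hq, he.symm⟩) (fun j s hs => by
      -- The centres of the neighbours of j are seen in tube j, within 50 + 1.02 · 50 + 0.01 < 110
      -- of the axis.
      have h1 : ∀ k ∈ s, ∃ p, Φ j p = Φ k 0 ∧ ‖planeL p‖ ≤ 110 := by
        intro k hk
        obtain ⟨q, q', hq, hq', he⟩ := (hs k hk).2
        obtain ⟨p, hp, hpd⟩ := hΦ.exists_dist_le hκ1 (q := 0) (by linarith) (by linarith)
          (by rw [hz]; norm_num) he.symm
        refine ⟨p, hp, ?_⟩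
        rw [map_zero, zero_sub, norm_neg] at hpd
        linarith [norm_le_norm_add_norm_sub' (planeL p) (planeL q)]
      choose! p hp hpn using h1
      -- If the two centres were closer than 1 in tube j, then in tube k the centre of l would be
      -- within 1.02 + 0.01 < 2 of the axis, against the separation.
      have h2 : ∀ k ∈ s, ∀ l ∈ s, k ≠ l → 1 ≤ ‖planeL (p k) - planeL (p l)‖ := by
        intro k hk l hl hkl
        by_contra! hlt
        obtain ⟨z, hz1, hz2⟩ := hΦ.exists_dist_le hκ1 (q₂ := 0) (q := p l)
          (by linarith [hpn k hk]) (by rw [hz]; norm_num) (by linarith [hpn l hl]) (hp k hk)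
        rw [norm_sub_rev] at hlt
        rw [map_zero, sub_zero] at hz2
        refine hSsep k k.2 l l.2 (fun h => hkl (Subtype.ext h)) (Or.inl ⟨z, by linarith, ?_⟩)
        rw [hz1, hp l hl]
      rw [← Finset.card_image_of_injOn (f := fun k => planeL (p k)) (s := s)]
      · refine exists_packing_bound.choose_spec _ ?_ ?_
        · intro y hy
          obtain ⟨k, hk, rfl⟩ := Finset.mem_image.1 hy
          exact hpn k hk
        · intro y hy y' hy' hne
          obtain ⟨k, hk, rfl⟩ := Finset.mem_image.1 hy
          obtain ⟨l, hl, rfl⟩ := Finset.mem_image.1 hy'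
          exact h2 k hk l hl fun h => hne (by rw [h])
      · intro k hk l hl he
        by_contra hne
        have h3 := h2 k hk l hl hne
        simp only at he
        rw [he, sub_self, norm_zero] at h3
        linarith)
  obtain ⟨V, F, hF, hV⟩ := exists_isFibration packingBound (hΦ.comp (fun j : S => (j : J))) hκ0 hκ
    color hcol (fun k k' hc hne q q' hq hq' he => hcolne k k' hne ⟨q, q', hq, hq', he⟩ hc)
  refine ⟨S, V, F, hF, fun x q hq => ?_⟩
  -- By maximality every unit tube lies in the part of radius less than 5 of a selected tube: the
  -- planar distances are at most 2 + 1.03 or 1.02 · 3 + 0.01.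
  obtain ⟨j, hj, hjx⟩ := hSmax x
  rcases hjx with rfl | ⟨q', hq', he⟩ | ⟨q', hq', he⟩
  · exact hV ⟨x, hj⟩ q (by linarith)
  · obtain ⟨p, hp, hpd⟩ := hΦ.exists_dist_le hκ1 (q := q) (by rw [hz]; norm_num) (by linarith)
      (by linarith) he.symm
    rw [map_zero, sub_zero] at hpd
    rw [← hp]
    exact hV ⟨j, hj⟩ p (by linarith [norm_le_norm_add_norm_sub' (planeL p) (planeL q')])
  · obtain ⟨p, hp, hpd⟩ := hΦ.exists_dist_le hκ1 (q := q) (by linarith) (by rw [hz]; norm_num)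
      (by linarith) he
    rw [map_zero, sub_zero] at hpd
    rw [← hp]
    exact hV ⟨j, hj⟩ p (by linarith [norm_sub_le (planeL q) (planeL q')])

section Manifold

open Bundle

variable {H : Type*} [TopologicalSpace H] {I : ModelWithCorners ℝ (EuclideanSpace ℝ (Fin 3)) H}
  {M : Type*} [EMetricSpace M] [ChartedSpace H M] [IsManifold I ∞ M]
  [RiemannianBundle (fun x : M => TangentSpace I x)]
  [IsContMDiffRiemannianBundle I ∞ (EuclideanSpace ℝ (Fin 3)) (fun x : M => TangentSpace I x)]

/-- Compactness reduces to finitely many unit tubes. Their number is arbitrary and does not enter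
the estimate, which depends on `packingBound` only. -/
theorem exists_isFibration_of_isCompact {ε : ℝ} (hε : 0 < ε) (hε1 : ε ≤ 1 / 10 ^ 8)
    (hεr : fibrationRatio * (10 ^ 7 * ε) ≤ 1 / 100) {K : Set M} (hK : IsCompact K)
    (hKφ : ∀ x ∈ K, ∃ φ : Circle × Plane → M, IsProductStructureAt I ε φ x) :
    ∃ (n : ℕ) (S : Set (Fin n)) (φ : S → Circle × Plane → M) (c : S → ℝ) (V : Set M)
      (F : M → Set M), (∀ j, FlatTube I ε (c j) (φ j)) ∧
      IsFibration (fun j => lift (φ j)) (fibrationRatio * (10 ^ 7 * ε)) V F ∧ K ⊆ V := by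
  have h1 : ∀ x : K, ∃ (φ : Circle × Plane → M) (c : ℝ), FlatTube I ε c φ ∧
      ∃ q, planeL q = 0 ∧ lift φ q = x := by
    intro x
    obtain ⟨φ, hφ, z, hz⟩ := hKφ x x.2
    obtain ⟨c, hc⟩ := hφ.exists_flatTube hε (by linarith)
    obtain ⟨q, hq⟩ := coverMap_surjective (z, 0)
    refine ⟨φ, c, hc, q, congrArg Prod.snd hq, ?_⟩
    rw [lift_eq_comp, Function.comp_apply, hq, hz]
  choose φ c hφ q hq hqx using h1
  have hopen : ∀ x : K, IsOpen (lift (φ x) '' tube 1) := fun x => by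
    have := (hφ x).inv_gt hε1
    exact (hφ x).isOpen_image_lift (isOpen_tube 1) fun p hp => by rw [mem_tube] at *; linarith
  obtain ⟨t, ht⟩ := hK.elim_finite_subcover _ hopen fun x hx =>
    mem_iUnion.2 ⟨⟨x, hx⟩, q ⟨x, hx⟩, by rw [mem_tube, hq, norm_zero]; norm_num, hqx _⟩
  let f : Fin t.card → K := fun i => t.equivFin.symm i
  obtain ⟨S, V, F, hF, hV⟩ := (FlatTube.tubeFamily (fun i => hφ (f i)) hε1
    ).exists_subfamily_isFibration (by positivity) hεr
  refine ⟨t.card, S, fun j => φ (f j), fun j => c (f j), V, F, fun j => hφ _, hF, fun x hx => ?_⟩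
  obtain ⟨k, hk, p, hp, rfl⟩ := mem_iUnion₂.1 (ht hx)
  have h2 := hV (t.equivFin ⟨k, hk⟩) p hp
  simp only [f, Equiv.symm_apply_apply] at h2
  exact h2

end Manifold

end

end CircleCollapse

/-! ### The leaf space of a foliation by circles -/

namespace CircleCollapse

noncomputable section

open Bundle

variable {H : Type v} [TopologicalSpace H] {I : ModelWithCorners ℝ (EuclideanSpace ℝ (Fin 3)) H}
  {M : Type u} [EMetricSpace M] [ChartedSpace H M]

variable (I) in
/-- A smooth parametrization of an open subset of `V ⊆ M` by `S¹ × W`, where `W` is open in the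
plane, which takes the circles `S¹ × {y}` to the sets `F x`. -/
structure FibParam (V : Set M) (F : M → Set M) where
  toFun : Circle × Plane → M
  inv : M → Circle × Plane
  base : Set Plane
  isOpen_base : IsOpen base
  isOpen_image : IsOpen (toFun '' (univ ×ˢ base))
  contMDiffOn : ContMDiffOn ((𝓡 1).prod (𝓡 2)) I ∞ toFun (univ ×ˢ base)
  contMDiffOn_inv : ContMDiffOn I ((𝓡 1).prod (𝓡 2)) ∞ inv (toFun '' (univ ×ˢ base))
  left_inv : ∀ z y, y ∈ base → inv (toFun (z, y)) = (z, y)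
  mem : ∀ z y, y ∈ base → toFun (z, y) ∈ V
  fiber_eq : ∀ z y, y ∈ base → F (toFun (z, y)) = toFun '' (univ ×ˢ {y})

variable (I M) in
/-- A partition of an open subset of `M` into smooth circles which is locally a product. -/
structure CircleFoliation where
  V : TopologicalSpace.Opens M
  F : M → Set M
  exists_param : ∀ x ∈ V, ∃ P : FibParam I (V : Set M) F, x ∈ P.toFun '' (univ ×ˢ P.base)

namespace FibParam

variable {V : Set M} {F : M → Set M} (P : FibParam I V F)

/-- The open set parametrized by `P`. -/
def image : Set M := P.toFun '' (univ ×ˢ P.base)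

theorem mem_image {x : M} : x ∈ P.image ↔ ∃ z y, y ∈ P.base ∧ P.toFun (z, y) = x := by
  constructor
  · rintro ⟨⟨z, y⟩, h, rfl⟩
    exact ⟨z, y, h.2, rfl⟩
  · rintro ⟨z, y, h, rfl⟩
    exact ⟨(z, y), ⟨trivial, h⟩, rfl⟩

theorem inv_snd_mem {x : M} (hx : x ∈ P.image) : (P.inv x).2 ∈ P.base := by
  obtain ⟨z, y, hy, rfl⟩ := P.mem_image.1 hx
  rw [P.left_inv z y hy]; exact hy

theorem right_inv {x : M} (hx : x ∈ P.image) : P.toFun (P.inv x) = x := by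
  obtain ⟨z, y, hy, rfl⟩ := P.mem_image.1 hx
  rw [P.left_inv z y hy]

theorem mem_fiber_iff {x x' : M} (hx : x ∈ P.image) :
    x' ∈ F x ↔ ∃ z, P.toFun (z, (P.inv x).2) = x' := by
  obtain ⟨z, y, hy, rfl⟩ := P.mem_image.1 hx
  rw [P.fiber_eq z y hy, P.left_inv z y hy]
  constructor
  · rintro ⟨⟨w, y'⟩, h, rfl⟩
    obtain rfl : y' = y := h.2
    exact ⟨w, rfl⟩
  · rintro ⟨w, rfl⟩
    exact ⟨(w, y), ⟨trivial, rfl⟩, rfl⟩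

theorem continuousAt_inv {x : M} (hx : x ∈ P.image) : ContinuousAt P.inv x :=
  P.contMDiffOn_inv.continuousOn.continuousAt (P.isOpen_image.mem_nhds hx)

theorem continuousAt_toFun {z : Circle} {y : Plane} (hy : y ∈ P.base) :
    ContinuousAt P.toFun (z, y) :=
  P.contMDiffOn.continuousOn.continuousAt
    ((isOpen_univ.prod P.isOpen_base).mem_nhds ⟨trivial, hy⟩)

theorem contMDiffAt_inv {x : M} (hx : x ∈ P.image) :
    ContMDiffAt I ((𝓡 1).prod (𝓡 2)) ∞ P.inv x :=
  P.contMDiffOn_inv.contMDiffAt (P.isOpen_image.mem_nhds hx)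

theorem contMDiffAt_toFun {z : Circle} {y : Plane} (hy : y ∈ P.base) :
    ContMDiffAt ((𝓡 1).prod (𝓡 2)) I ∞ P.toFun (z, y) :=
  P.contMDiffOn.contMDiffAt ((isOpen_univ.prod P.isOpen_base).mem_nhds ⟨trivial, hy⟩)

end FibParam

namespace CircleFoliation

variable (Q : CircleFoliation I M)

/-- The product charts of the foliation. -/
abbrev Param : Type _ := FibParam I (Q.V : Set M) Q.F

theorem F_eq_of_mem {x y : M} (hx : x ∈ Q.V) (hy : y ∈ Q.F x) : y ∈ Q.V ∧ Q.F y = Q.F x := by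
  obtain ⟨P, hP⟩ := Q.exists_param x hx
  obtain ⟨w, t, ht, rfl⟩ := P.mem_image.1 hP
  obtain ⟨z, rfl⟩ := (P.mem_fiber_iff hP).1 hy
  rw [P.left_inv w t ht]
  exact ⟨P.mem z t ht, by rw [P.fiber_eq z t ht, P.fiber_eq w t ht]⟩

theorem mem_self {x : M} (hx : x ∈ Q.V) : x ∈ Q.F x := by
  obtain ⟨P, hP⟩ := Q.exists_param x hx
  exact (P.mem_fiber_iff hP).2 ⟨(P.inv x).1, P.right_inv hP⟩

theorem isCompact_F {x : M} (hx : x ∈ Q.V) : IsCompact (Q.F x) := by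
  obtain ⟨P, hP⟩ := Q.exists_param x hx
  obtain ⟨w, t, ht, rfl⟩ := P.mem_image.1 hP
  rw [P.fiber_eq w t ht]
  exact (isCompact_univ.prod isCompact_singleton).image_of_continuousOn
    (P.contMDiffOn.continuousOn.mono (prod_mono le_rfl (singleton_subset_iff.2 ht)))

/-- The leaf space. -/
def Base : Type u := Quotient (Setoid.ker fun x : Q.V => Q.F x)

instance : TopologicalSpace Q.Base :=
  inferInstanceAs (TopologicalSpace (Quotient (Setoid.ker fun x : Q.V => Q.F x)))

/-- The projection to the leaf space. -/
def proj (x : Q.V) : Q.Base := Quotient.mk (Setoid.ker fun x : Q.V => Q.F x) x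

variable {Q}

theorem proj_eq_iff {x y : Q.V} : Q.proj x = Q.proj y ↔ Q.F x = Q.F y :=
  Quotient.eq (r := Setoid.ker fun x : Q.V => Q.F x)

theorem proj_surjective : Function.Surjective Q.proj := Quotient.mk_surjective

theorem continuous_proj : Continuous Q.proj := continuous_quotient_mk'

theorem proj_eq_iff_mem {x y : Q.V} : Q.proj x = Q.proj y ↔ (y : M) ∈ Q.F x := by
  rw [proj_eq_iff]
  exact ⟨fun h => h ▸ Q.mem_self y.2, fun h => (Q.F_eq_of_mem x.2 h).2.symm⟩

theorem fiber_proj (x : Q.V) : fiber Q.proj (Q.proj x) = Q.F x := by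
  ext y
  constructor
  · rintro ⟨y, hy, rfl⟩
    exact proj_eq_iff_mem.1 (Eq.symm hy)
  · intro hy
    exact ⟨⟨y, (Q.F_eq_of_mem x.2 hy).1⟩, (proj_eq_iff_mem (y := ⟨y, _⟩).2 hy).symm, rfl⟩

/-- If the leaf of y meets an open set at the parameter z of a product chart, then so do the nearby
leaves, at the same z. -/
theorem isOpenMap_proj : IsOpenMap Q.proj := by
  intro U hU
  have h0 : IsOpen (Q.proj ⁻¹' (Q.proj '' U)) := by
    rw [isOpen_iff_mem_nhds]
    rintro y ⟨x, hx, hxy⟩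
    obtain ⟨P, hP⟩ := Q.exists_param y y.2
    obtain ⟨z, hz⟩ := (P.mem_fiber_iff hP).1 (proj_eq_iff_mem.1 hxy.symm)
    have hb := P.inv_snd_mem hP
    obtain ⟨O, hO, rfl⟩ := isOpen_induced_iff.1 hU
    have h1 : ContinuousAt (fun y' : Q.V => P.toFun (z, (P.inv y').2)) y := by
      have h2 : ContinuousAt (fun y' : Q.V => (z, (P.inv y').2)) y :=
        continuousAt_const.prodMk (continuousAt_snd.comp
          ((P.continuousAt_inv hP).comp continuousAt_subtype_val))
      exact ContinuousAt.comp (f := fun y' : Q.V => (z, (P.inv y').2)) (P.continuousAt_toFun hb) h2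
    have h3 : ∀ᶠ y' : Q.V in 𝓝 y, P.toFun (z, (P.inv y').2) ∈ O :=
      h1.eventually (hO.mem_nhds (hz.symm ▸ hx : P.toFun (z, (P.inv y).2) ∈ O))
    have h4 : ∀ᶠ y' : Q.V in 𝓝 y, (y' : M) ∈ P.image :=
      continuousAt_subtype_val.eventually (P.isOpen_image.mem_nhds hP)
    filter_upwards [h3, h4] with y' h5 h6
    refine ⟨⟨_, P.mem z _ (P.inv_snd_mem h6)⟩, h5, ?_⟩
    exact (proj_eq_iff_mem.2 ((P.mem_fiber_iff h6).2 ⟨z, rfl⟩)).symm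
  exact h0

theorem isOpenQuotientMap_proj : IsOpenQuotientMap Q.proj :=
  ⟨proj_surjective, continuous_proj, isOpenMap_proj⟩

/-- A leaf is compact, so it is separated by open sets from a point off it. By compactness of the
circle, nearby leaves stay inside the neighborhood N of the first leaf. -/
instance : T2Space Q.Base := by
  rw [t2Space_iff_of_isOpenQuotientMap isOpenQuotientMap_proj, ← isOpen_compl_iff,
    isOpen_iff_mem_nhds]
  rintro ⟨x, y⟩ hxy
  have hne : (y : M) ∉ Q.F x := fun h => hxy (proj_eq_iff_mem.2 h)
  obtain ⟨N, O, hN, hO, hxN, hyO, hNO⟩ := (SeparatedNhds.of_isCompact_isCompact (Q.isCompact_F x.2)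
    (isCompact_singleton (x := (y : M))) (disjoint_singleton_right.2 hne))
  obtain ⟨P, hP⟩ := Q.exists_param x x.2
  have hb := P.inv_snd_mem hP
  have h1 : ∀ᶠ t in 𝓝 (P.inv x).2, ∀ z ∈ (univ : Set Circle), P.toFun (z, t) ∈ N := by
    refine isCompact_univ.eventually_forall_of_forall_eventually fun z _ => ?_
    have h2 : ContinuousAt (fun p : Plane × Circle => P.toFun (p.2, p.1)) ((P.inv x).2, z) :=
      ContinuousAt.comp (f := fun p : Plane × Circle => (p.2, p.1)) (P.continuousAt_toFun hb)
        continuous_swap.continuousAt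
    exact h2.eventually (hN.mem_nhds (hxN ((P.mem_fiber_iff hP).2 ⟨z, rfl⟩)))
  have h3 : ∀ᶠ x' : Q.V in 𝓝 x, (x' : M) ∈ P.image :=
    continuousAt_subtype_val.eventually (P.isOpen_image.mem_nhds hP)
  have h4 : ∀ᶠ x' : Q.V in 𝓝 x, ∀ z ∈ (univ : Set Circle), P.toFun (z, (P.inv x').2) ∈ N :=
    (continuousAt_snd.comp ((P.continuousAt_inv hP).comp
      continuousAt_subtype_val)).eventually h1
  have h5 : ∀ᶠ y' : Q.V in 𝓝 y, (y' : M) ∈ O :=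
    continuousAt_subtype_val.eventually (hO.mem_nhds (hyO rfl))
  filter_upwards [(h3.and h4).prod_nhds h5] with p hp he
  obtain ⟨⟨h6, h7⟩, h8⟩ := hp
  obtain ⟨z, hz⟩ := (P.mem_fiber_iff h6).1 (proj_eq_iff_mem.1 he)
  exact hNO.le_bot ⟨hz ▸ h7 z trivial, h8⟩

theorem secondCountableTopology_base (h : SecondCountableTopology Q.V) :
    SecondCountableTopology Q.Base :=
  isOpenQuotientMap_proj.isQuotientMap.secondCountableTopology isOpenMap_proj

section Coord

variable (P : Q.Param)

/-- The domain of a chart of the leaf space. -/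
def domain : Set Q.Base := Q.proj '' {x | (x : M) ∈ P.image}

theorem isOpen_domain : IsOpen (domain P) :=
  isOpenMap_proj _ (P.isOpen_image.preimage continuous_subtype_val)

theorem proj_mem_domain {x : Q.V} : Q.proj x ∈ domain P ↔ (x : M) ∈ P.image := by
  refine ⟨?_, fun h => ⟨x, h, rfl⟩⟩
  rintro ⟨y, hy, he⟩
  obtain ⟨z, hz⟩ := (P.mem_fiber_iff hy).1 (proj_eq_iff_mem.1 he)
  exact P.mem_image.2 ⟨z, _, P.inv_snd_mem hy, hz⟩

open Classical in
/-- The coordinate of the leaf space given by a product chart. -/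
def coord (b : Q.Base) : Plane :=
  if h : ∃ x : Q.V, (x : M) ∈ P.image ∧ Q.proj x = b then (P.inv h.choose).2 else 0

theorem coord_proj {x : Q.V} (hx : (x : M) ∈ P.image) : coord P (Q.proj x) = (P.inv x).2 := by
  have h : ∃ y : Q.V, (y : M) ∈ P.image ∧ Q.proj y = Q.proj x := ⟨x, hx, rfl⟩
  obtain ⟨h1, h2⟩ := h.choose_spec
  rw [coord, dif_pos h]
  obtain ⟨z, hz⟩ := (P.mem_fiber_iff h1).1 (proj_eq_iff_mem.1 h2)
  rw [← hz, P.left_inv z _ (P.inv_snd_mem h1)]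

open Classical in
/-- The leaf with a given coordinate. -/
def leaf (b₀ : Q.Base) (y : Plane) : Q.Base :=
  if h : y ∈ P.base then Q.proj ⟨P.toFun (1, y), P.mem 1 y h⟩ else b₀

theorem leaf_eq (b₀ : Q.Base) {y : Plane} (h : y ∈ P.base) (z : Circle) :
    leaf P b₀ y = Q.proj ⟨P.toFun (z, y), P.mem z y h⟩ := by
  rw [leaf, dif_pos h]
  refine proj_eq_iff.2 ?_
  simp only [P.fiber_eq _ y h]

theorem leaf_inv (b₀ : Q.Base) {x : Q.V} (hx : (x : M) ∈ P.image) :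
    leaf P b₀ (P.inv x).2 = Q.proj x := by
  rw [leaf_eq P b₀ (P.inv_snd_mem hx) (P.inv x).1]
  exact congrArg Q.proj (Subtype.ext (P.right_inv hx))

/-- The chart of the leaf space given by a product chart. -/
def chart (b₀ : Q.Base) : OpenPartialHomeomorph Q.Base Plane where
  toFun := coord P
  invFun := leaf P b₀
  source := domain P
  target := P.base
  map_source' := by
    rintro _ ⟨x, hx, rfl⟩
    rw [coord_proj P hx]
    exact P.inv_snd_mem hx
  map_target' y hy := by
    rw [leaf_eq P b₀ hy 1, proj_mem_domain]
    exact P.mem_image.2 ⟨1, y, hy, rfl⟩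
  left_inv' := by
    rintro _ ⟨x, hx, rfl⟩
    rw [coord_proj P hx, leaf_inv P b₀ hx]
  right_inv' y hy := by
    rw [leaf_eq P b₀ hy 1, coord_proj P (P.mem_image.2 ⟨1, y, hy, rfl⟩), P.left_inv 1 y hy]
  open_source := isOpen_domain P
  open_target := P.isOpen_base
  continuousOn_toFun := by
    rintro _ ⟨x, hx, rfl⟩
    refine ContinuousAt.continuousWithinAt ?_
    rw [isOpenQuotientMap_proj.continuousAt_comp_iff.symm]
    have h1 : ContinuousAt (fun y : Q.V => (P.inv y).2) x :=
      continuousAt_snd.comp ((P.continuousAt_inv hx).comp continuousAt_subtype_val)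
    refine h1.congr ?_
    filter_upwards [continuousAt_subtype_val.eventually (P.isOpen_image.mem_nhds hx)] with y hy
    exact (coord_proj P hy).symm
  continuousOn_invFun := by
    rw [continuousOn_iff_continuous_domRestrict]
    have h1 : Continuous fun y : P.base => Q.proj ⟨P.toFun (1, y), P.mem 1 y y.2⟩ := by
      refine continuous_proj.comp (Continuous.subtype_mk ?_ _)
      refine P.contMDiffOn.continuousOn.comp_continuous (by fun_prop) fun y => ⟨trivial, y.2⟩
    refine h1.congr fun y => ?_
    exact (leaf_eq P b₀ y.2 1).symm

end Coord

/-- The value b₀ off the base is a filler that belongs to the data of a chart, so the atlas admits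
every choice of it. -/
instance : ChartedSpace Plane Q.Base where
  atlas := {e | ∃ (P : Q.Param) (b₀ : Q.Base), e = chart P b₀}
  chartAt b := chart (Q.exists_param b.out b.out.2).choose b
  mem_chart_source b := by
    have h := (Q.exists_param b.out b.out.2).choose_spec
    have h1 : Q.proj b.out = b := Quotient.out_eq b
    have h2 := (proj_mem_domain _).2 h
    rw [h1] at h2
    exact h2
  chart_mem_atlas b := ⟨_, b, rfl⟩

/-- A leaf with coordinate y is met at the point 1 of the circle in P, and its coordinate is read
off in P'; this is a composition of smooth maps. -/
theorem contDiffOn_transition (P P' : Q.Param) (b₀ b₀' : Q.Base) :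
    ContDiffOn ℝ ∞ ((chart P b₀).symm.trans (chart P' b₀'))
      ((chart P b₀).symm.trans (chart P' b₀')).source := by
  intro y hy
  refine ContDiffAt.contDiffWithinAt ?_
  rw [OpenPartialHomeomorph.trans_source] at hy
  obtain ⟨hy1, hy2⟩ := hy
  have hy1 : y ∈ P.base := hy1
  have hy2 : leaf P b₀ y ∈ domain P' := hy2
  rw [leaf_eq P b₀ hy1 1, proj_mem_domain] at hy2
  have h1 : ContMDiffAt (𝓡 2) ((𝓡 1).prod (𝓡 2)) ∞ (fun t : Plane => ((1 : Circle), t)) y :=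
    contMDiffAt_const.prodMk contMDiffAt_id
  have h2 : ContMDiffAt (𝓡 2) I ∞ (fun t : Plane => P.toFun ((1 : Circle), t)) y :=
    ContMDiffAt.comp y (P.contMDiffAt_toFun hy1) h1
  have h3 : ContMDiffAt (𝓡 2) (𝓡 2) ∞ (fun t : Plane => (P'.inv (P.toFun ((1 : Circle), t))).2) y :=
    contMDiffAt_snd.comp y (ContMDiffAt.comp y (P'.contMDiffAt_inv hy2) h2)
  refine (contMDiffAt_iff_contDiffAt.1 h3).congr_of_eventuallyEq ?_
  filter_upwards [P.isOpen_base.mem_nhds hy1,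
    h2.continuousAt.eventually (P'.isOpen_image.mem_nhds hy2)] with t ht1 ht2
  change coord P' (leaf P b₀ t) = _
  rw [leaf_eq P b₀ ht1 1]
  exact coord_proj P' (x := ⟨P.toFun (1, t), P.mem 1 t ht1⟩) ht2

instance : IsManifold (𝓡 2) ∞ Q.Base := by
  refine isManifold_of_contDiffOn _ _ _ ?_
  rintro _ _ ⟨P, b₀, rfl⟩ ⟨P', b₀', rfl⟩
  simpa using contDiffOn_transition P P' b₀ b₀'

theorem chart_mem_maximalAtlas (P : Q.Param) (b₀ : Q.Base) :
    chart P b₀ ∈ IsManifold.maximalAtlas (𝓡 2) ∞ Q.Base :=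
  IsManifold.subset_maximalAtlas ⟨P, b₀, rfl⟩

theorem contMDiffOn_coord (P : Q.Param) : ContMDiffOn (𝓡 2) (𝓡 2) ∞ (coord P) (domain P) := by
  intro b hb
  exact contMDiffOn_of_mem_maximalAtlas (chart_mem_maximalAtlas P b) b hb

theorem contMDiffAt_proj (x : Q.V) : ContMDiffAt I (𝓡 2) ∞ Q.proj x := by
  obtain ⟨P, hP⟩ := Q.exists_param x x.2
  have h1 : ContMDiffAt I (𝓡 2) ∞ (fun y : Q.V => (P.inv y).2) x :=
    contMDiffAt_snd.comp x (ContMDiffAt.comp x (P.contMDiffAt_inv hP)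
      contMDiff_subtype_val.contMDiffAt)
  have h2 : ContMDiffAt (𝓡 2) (𝓡 2) ∞ (leaf P (Q.proj x)) (P.inv x).2 :=
    (contMDiffOn_symm_of_mem_maximalAtlas (chart_mem_maximalAtlas P (Q.proj x))).contMDiffAt
      (P.isOpen_base.mem_nhds (P.inv_snd_mem hP))
  refine (ContMDiffAt.comp x h2 h1).congr_of_eventuallyEq ?_
  filter_upwards [continuousAt_subtype_val.eventually (P.isOpen_image.mem_nhds hP)] with y hy
  exact (leaf_inv P _ hy).symm

/-- A map into an open subset of a manifold is smooth if it is smooth as a map into the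
manifold. -/
theorem contMDiffAt_of_val {E' : Type*} [NormedAddCommGroup E'] [NormedSpace ℝ E'] {H' : Type*}
    [TopologicalSpace H'] {J : ModelWithCorners ℝ E' H'} {N : Type*} [TopologicalSpace N]
    [ChartedSpace H' N] {U : TopologicalSpace.Opens M} {f : N → U} {x : N}
    (h : ContMDiffAt J I ∞ (fun y => (f y : M)) x) : ContMDiffAt J I ∞ f x := by
  rw [contMDiffAt_iff_target] at h ⊢
  exact ⟨Topology.IsInducing.subtypeVal.continuousAt_iff.2 h.1, h.2⟩

open Classical in
/-- The local trivialization given by a product chart. -/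
def trivialization (P : Q.Param) (x₀ : Q.V) : Trivialization Circle Q.proj where
  toFun x := (Q.proj x, (P.inv x).1)
  invFun p := if h : coord P p.1 ∈ P.base then ⟨P.toFun (p.2, coord P p.1), P.mem _ _ h⟩ else x₀
  source := {x | (x : M) ∈ P.image}
  target := domain P ×ˢ univ
  baseSet := domain P
  map_source' x hx := ⟨⟨x, hx, rfl⟩, trivial⟩
  map_target' := by
    rintro ⟨b, z⟩ ⟨⟨x, hx, rfl⟩, -⟩
    have h := P.inv_snd_mem hx
    simp only [coord_proj P hx, dif_pos h]
    exact P.mem_image.2 ⟨z, _, h, rfl⟩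
  left_inv' x hx := by
    have h := P.inv_snd_mem hx
    simp only [coord_proj P hx, dif_pos h]
    exact Subtype.ext (P.right_inv hx)
  right_inv' := by
    rintro ⟨b, z⟩ ⟨⟨x, hx, rfl⟩, -⟩
    have h := P.inv_snd_mem hx
    simp only [coord_proj P hx, dif_pos h, P.left_inv z _ h]
    refine Prod.ext ?_ rfl
    exact (proj_eq_iff_mem.2 ((P.mem_fiber_iff hx).2 ⟨z, rfl⟩)).symm
  open_source := P.isOpen_image.preimage continuous_subtype_val
  open_target := (isOpen_domain P).prod isOpen_univ
  continuousOn_toFun x hx := by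
    refine ContinuousAt.continuousWithinAt (continuous_proj.continuousAt.prodMk ?_)
    exact continuousAt_fst.comp ((P.continuousAt_inv hx).comp continuousAt_subtype_val)
  continuousOn_invFun := by
    rintro ⟨b, z⟩ ⟨hb, -⟩
    have hc : ∀ b ∈ domain P, coord P b ∈ P.base := fun b hb => (chart P b).map_source hb
    refine ContinuousAt.continuousWithinAt (Topology.IsInducing.subtypeVal.continuousAt_iff.2 ?_)
    have h1 : ContinuousAt (fun p : Q.Base × Circle => (p.2, coord P p.1)) (b, z) :=
      continuousAt_snd.prodMk (((contMDiffOn_coord P).continuousOn.continuousAt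
        ((isOpen_domain P).mem_nhds hb)).comp continuousAt_fst)
    have h2 : ContinuousAt (fun p : Q.Base × Circle => P.toFun (p.2, coord P p.1)) (b, z) :=
      ContinuousAt.comp (f := fun p : Q.Base × Circle => (p.2, coord P p.1))
        (P.continuousAt_toFun (hc b hb)) h1
    refine h2.congr ?_
    filter_upwards [((isOpen_domain P).prod isOpen_univ).mem_nhds
      (show (b, z) ∈ domain P ×ˢ univ from ⟨hb, trivial⟩)] with p hp
    simp only [Function.comp_apply, dif_pos (hc _ hp.1)]
  open_baseSet := isOpen_domain P
  source_eq := by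
    ext x
    exact (proj_mem_domain P).symm
  target_eq := rfl
  proj_toFun _ _ := rfl

open Classical in
theorem isSmoothCircleFibration_proj : IsSmoothCircleFibration I Q.V Q.proj := by
  intro b
  obtain ⟨x₀, rfl⟩ := proj_surjective b
  obtain ⟨P, hP⟩ := Q.exists_param x₀ x₀.2
  refine ⟨trivialization P x₀, (proj_mem_domain P).2 hP, fun x hx => ?_, ?_⟩
  · refine ContMDiffAt.contMDiffWithinAt ((contMDiffAt_proj x).prodMk ?_)
    have hx : (x : M) ∈ P.image := hx
    exact contMDiffAt_fst.comp x (ContMDiffAt.comp x (P.contMDiffAt_inv hx)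
      contMDiff_subtype_val.contMDiffAt)
  · rintro ⟨b, z⟩ ⟨hb, -⟩
    have hc : ∀ b ∈ domain P, coord P b ∈ P.base := fun b hb => (chart P b).map_source hb
    refine ContMDiffAt.contMDiffWithinAt (contMDiffAt_of_val ?_)
    have h1 : ContMDiffAt ((𝓡 2).prod (𝓡 1)) ((𝓡 1).prod (𝓡 2)) ∞
        (fun p : Q.Base × Circle => (p.2, coord P p.1)) (b, z) :=
      contMDiffAt_snd.prodMk (ContMDiffAt.comp (b, z) ((contMDiffOn_coord P).contMDiffAt
        ((isOpen_domain P).mem_nhds hb)) contMDiffAt_fst)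
    have h2 : ContMDiffAt ((𝓡 2).prod (𝓡 1)) I ∞
        (fun p : Q.Base × Circle => P.toFun (p.2, coord P p.1)) (b, z) :=
      ContMDiffAt.comp (b, z) (P.contMDiffAt_toFun (hc b hb)) h1
    refine h2.congr_of_eventuallyEq ?_
    filter_upwards [((isOpen_domain P).prod isOpen_univ).mem_nhds
      (show (b, z) ∈ domain P ×ˢ univ from ⟨hb, trivial⟩)] with p hp
    change (((if h : coord P p.1 ∈ P.base then
      ⟨P.toFun (p.2, coord P p.1), P.mem _ _ h⟩ else x₀ : Q.V)) : M) = _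
    rw [dif_pos (hc _ hp.1)]

end CircleFoliation

end

end CircleCollapse

/-! ### From charts of a fibration to smooth product charts -/

namespace CircleCollapse

noncomputable section

open Bundle

/-- The argument of z / z₀ is smooth near z = z₀, so the branch of the angle centered there gives a
global section that is smooth at the given point. -/
theorem exists_coverMap_section (q : Cover) : ∃ σ : Circle × Plane → Cover,
    ContMDiffAt ((𝓡 1).prod (𝓡 2)) 𝓘(ℝ, Cover) ∞ σ (coverMap q) ∧ σ (coverMap q) = q ∧
      ∀ p, coverMap (σ p) = p := by
  have hpi := Real.pi_pos
  set z₀ := Circle.exp (2 * Real.pi * q 0) with hz₀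
  let θ : Circle → ℝ := fun z => q 0 + Complex.arg ((z * z₀⁻¹ : Circle) : ℂ) / (2 * Real.pi)
  have := finrank_real_complex_fact'
  have hθ : ContMDiffAt (𝓡 1) 𝓘(ℝ, ℝ) ∞ θ z₀ := by
    have h1 : ContMDiffAt (𝓡 1) 𝓘(ℝ, ℂ) ∞ (fun z : Circle => ((z * z₀⁻¹ : Circle) : ℂ)) z₀ := by
      have h2 : ContMDiff (𝓡 1) (𝓡 1) ∞ (fun z : Circle => z * z₀⁻¹) :=
        contMDiff_id.mul contMDiff_const
      have h3 : ContMDiff (𝓡 1) 𝓘(ℝ, ℂ) ∞ (fun z : Circle => (z : ℂ)) := contMDiff_coe_sphere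
      exact (h3.comp h2).contMDiffAt
    have h2 : ContDiffAt ℝ ∞ (fun w : ℂ => q 0 + Complex.arg w / (2 * Real.pi)) 1 := by
      have h3 : ContDiffAt ℝ ∞ (fun w : ℂ => Complex.log w) 1 :=
        (Complex.contDiffAt_log (n := ∞) Complex.one_mem_slitPlane).restrict_scalars ℝ
      have h4 : ContDiffAt ℝ ∞ (fun w : ℂ => (Complex.log w).im) 1 :=
        Complex.imCLM.contDiff.contDiffAt.comp _ h3
      simp only [Complex.log_im] at h4
      exact contDiffAt_const.add (h4.div_const _)
    refine ContMDiffAt.comp z₀ (g := fun w : ℂ => q 0 + Complex.arg w / (2 * Real.pi)) ?_ h1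
    rw [mul_inv_cancel, Circle.coe_one]
    exact h2.contMDiffAt
  have hθe : ∀ z, Circle.exp (2 * Real.pi * θ z) = z := by
    intro z
    have h1 : 2 * Real.pi * θ z = 2 * Real.pi * q 0 + Complex.arg ((z * z₀⁻¹ : Circle) : ℂ) := by
      simp only [θ]; field_simp
    rw [h1, Circle.exp_add, Circle.exp_arg, ← hz₀, mul_comm z, mul_inv_cancel_left]
  refine ⟨fun p => θ p.1 • circleDirection + sliceL p.2, ?_, ?_, fun p => Prod.ext ?_ ?_⟩
  · have h1 : ContMDiffAt ((𝓡 1).prod (𝓡 2)) 𝓘(ℝ, ℝ) ∞ (fun p : Circle × Plane => θ p.1)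
        (coverMap q) := ContMDiffAt.comp (g := θ) (coverMap q) hθ contMDiffAt_fst
    exact (h1.smul contMDiffAt_const).add
      (ContMDiffAt.comp (coverMap q) sliceL.contDiff.contMDiff.contMDiffAt contMDiffAt_snd)
  · refine cover_ext ?_ ?_
    · simp [coverMap, θ, ← hz₀]
    · simp [coverMap]
  · simp only [coverMap, PiLp.add_apply, PiLp.smul_apply, circleDirection_zero_coord, smul_eq_mul,
      mul_one, sliceL_zero_coord, add_zero, hθe]
  · simp [coverMap]

/-- The map of `S¹ × ℝ²` with a given lift to the cover. -/
def unlift {X : Type*} (f : Cover → X) (p : Circle × Plane) : X :=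
  f (coverMap_surjective p).choose

theorem unlift_coverMap {X : Type*} {f : Cover → X} (hf : ∀ q, f (q + circleDirection) = f q)
    (q : Cover) : unlift f (coverMap q) = f q := by
  obtain ⟨n, hn⟩ := coverMap_eq_iff.1 (coverMap_surjective (coverMap q)).choose_spec
  conv_rhs => rw [hn]
  exact (shift_int hf _ n).symm

theorem FibChart.tube_of_mem {M : Type*} {Φ : Cover → M} {V : Set M} {F : M → Set M} {δ ρ : ℝ} {q₀ : Cover}
    {h : Cover → Plane} (H : FibChart Φ V F δ q₀ h ρ) (hδ : δ ≤ 1 / 2) {q : Cover}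
    (hq : ‖h q - h q₀‖ < ρ) : ‖planeL q‖ < ‖planeL q₀‖ + 2 := by
  have h1 := H.near.close q
  have h2 := H.near.close q₀
  have h3 := H.le_one
  have h4 : ‖planeL q - planeL q₀‖ ≤ ‖h q - planeL q‖ + ‖h q - h q₀‖ + ‖h q₀ - planeL q₀‖ := by
    have h5 : planeL q - planeL q₀ = -(h q - planeL q) + (h q - h q₀) + (h q₀ - planeL q₀) := by
      abel
    rw [h5]
    refine (norm_add₃_le).trans ?_
    rw [norm_neg]
  linarith [norm_le_norm_add_norm_sub' (planeL q) (planeL q₀)]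

variable {H : Type v} [TopologicalSpace H] {I : ModelWithCorners ℝ (EuclideanSpace ℝ (Fin 3)) H}
  {M : Type u} [EMetricSpace M] [ChartedSpace H M]

theorem contMDiffAt_unlift {f : Cover → M} (hf : ∀ q, f (q + circleDirection) = f q) {q : Cover}
    (h : ContMDiffAt 𝓘(ℝ, Cover) I ∞ f q) :
    ContMDiffAt ((𝓡 1).prod (𝓡 2)) I ∞ (unlift f) (coverMap q) := by
  obtain ⟨σ, hσ, hσq, hσc⟩ := exists_coverMap_section q
  have h1 : unlift f = f ∘ σ := by
    ext1 p
    conv_lhs => rw [← hσc p]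
    rw [unlift_coverMap hf, Function.comp_apply]
  rw [h1]
  exact ContMDiffAt.comp _ (by rwa [hσq]) hσ

namespace CircleFoliation

/-- The kernel of the differential of the projection to the leaf space, in a product chart. -/
theorem fderiv_eq_zero_of_mfderiv_proj [IsManifold I ∞ M] {Q : CircleFoliation I M} (P : Q.Param)
    {Φ : Cover → M}
    {h : Cover → Plane} {q : Cover} (hΦ : MDifferentiableAt 𝓘(ℝ, Cover) I Φ q)
    (hq : Φ q ∈ P.image) (hP : ∀ᶠ q' in 𝓝 q, (P.inv (Φ q')).2 = h q') (hV : Φ q ∈ Q.V)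
    {v : TangentSpace I (⟨Φ q, hV⟩ : Q.V)}
    (hv : mfderiv I (𝓡 2) Q.proj ⟨Φ q, hV⟩ v = 0) {u : Cover}
    (hu : (mfderiv I I (Subtype.val : Q.V → M) ⟨Φ q, hV⟩ v : EuclideanSpace ℝ (Fin 3)) =
      mfderiv 𝓘(ℝ, Cover) I Φ q u) : fderiv ℝ h q u = 0 := by
  let G : M → Plane := fun y => (P.inv y).2
  have hG : MDifferentiableAt I (𝓡 2) G (Φ q) :=
    (contMDiffAt_snd.comp _ (P.contMDiffAt_inv hq)).mdifferentiableAt (by simp)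
  -- The planar coordinate of a product chart factors through the projection to the leaf space, so
  -- its differential kills the kernel of the differential of the projection; in the tube this
  -- coordinate is h.
  have h1 : G ∘ Subtype.val =ᶠ[𝓝 (⟨Φ q, hV⟩ : Q.V)] coord P ∘ Q.proj := by
    filter_upwards [continuousAt_subtype_val.eventually (P.isOpen_image.mem_nhds hq)] with y hy
    exact (coord_proj P hy).symm
  have hc : MDifferentiableAt (𝓡 2) (𝓡 2) (coord P) (Q.proj (⟨Φ q, hV⟩ : Q.V)) :=
    ((contMDiffOn_coord P).contMDiffAt ((isOpen_domain P).mem_nhds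
      ((proj_mem_domain P).2 hq))).mdifferentiableAt (by simp)
  have h2 := h1.mfderiv_eq (I := I) (I' := 𝓡 2)
  rw [mfderiv_comp (⟨Φ q, hV⟩ : Q.V) (I' := I) (g := G) hG (contMDiff_subtype_val.mdifferentiableAt (n := ∞) (by simp)),
    mfderiv_comp (⟨Φ q, hV⟩ : Q.V) hc ((contMDiffAt_proj _).mdifferentiableAt (by simp))] at h2
  have h3 : (mfderiv I (𝓡 2) G (Φ q))
      (mfderiv I I (Subtype.val : Q.V → M) (⟨Φ q, hV⟩ : Q.V) v) = 0 := by
    have h4 := congrArg (fun L : EuclideanSpace ℝ (Fin 3) →L[ℝ] Plane => L v) h2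
    refine h4.trans ?_
    change mfderiv (𝓡 2) (𝓡 2) (coord P) (Q.proj (⟨Φ q, hV⟩ : Q.V)) (mfderiv I (𝓡 2) Q.proj (⟨Φ q, hV⟩ : Q.V) v) = 0
    rw [hv]
    exact map_zero (mfderiv (𝓡 2) (𝓡 2) (coord P) (Q.proj (⟨Φ q, hV⟩ : Q.V)))
  have h5 : G ∘ Φ =ᶠ[𝓝 q] h := hP
  have h6 := h5.mfderiv_eq (I := 𝓘(ℝ, Cover)) (I' := 𝓡 2)
  rw [mfderiv_comp q hG hΦ, mfderiv_eq_fderiv] at h6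
  have h7 := congrArg (fun L : Cover →L[ℝ] Plane => L u) h6
  refine h7.symm.trans ?_
  refine Eq.trans ?_ h3
  exact congrArg (mfderiv I (𝓡 2) G (Φ q)) hu.symm

end CircleFoliation

variable [RiemannianBundle (fun x : M => TangentSpace I x)]

/-- Straightening turns the level sets of h into vertical lines and commutes with the unit shift, so
the lift of φ after the inverse of the straightening descends to S¹ × ball. Its inverse is smooth
because the lift of φ has smooth local inverses. -/
theorem FlatTube.exists_fibParam [IsManifold I ∞ M] {ε c : ℝ} {φ : Circle × Plane → M}
    (hφ : FlatTube I ε c φ)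
    (hε : ε ≤ 1 / 10 ^ 8) {V : Set M} {F : M → Set M} {δ ρ : ℝ} {q₀ : Cover} {h : Cover → Plane}
    (H : FibChart (lift φ) V F δ q₀ h ρ) (hδ : δ ≤ 1 / 2) (hq₀ : ‖planeL q₀‖ < 150) :
    ∃ P : FibParam I V F, ∀ q, ‖h q - h q₀‖ < ρ →
      lift φ q ∈ P.image ∧ (P.inv (lift φ q)).2 = h q := by
  have hδ1 : δ < 1 := by linarith
  have hinv := hφ.inv_gt hε
  have hchart := hφ.tubeChart hε
  set K := H.near.homeo hδ1 with hK
  have hKap : ∀ q, K q = NearPlane.straighten h q := fun q => rfl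
  have hKsh : ∀ q, lift φ (K.symm (q + circleDirection)) = lift φ (K.symm q) := fun q => by
    rw [H.near.homeo_symm_shift hδ1, lift_shift]
  have hcK : ∀ q, coverMap (K (q + circleDirection)) = coverMap (K q) := fun q => by
    rw [← coverMap_shift (K q)]
    congr 1
    refine cover_ext ?_ ?_
    · simp [hKap, NearPlane.straighten]
    · simp [hKap, NearPlane.straighten, H.near.shift]
  let base := Metric.ball (h q₀) ρ
  have hbase : ∀ {y}, y ∈ base ↔ ‖y - h q₀‖ < ρ := by
    intro y; simp [base, dist_eq_norm]
  let ψ := unlift fun q => lift φ (K.symm q)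
  have hψ : ∀ q, ψ (coverMap q) = lift φ (K.symm q) := unlift_coverMap hKsh
  have hψK : ∀ q, ψ (coverMap (K q)) = lift φ q := fun q => by
    rw [hψ, K.symm_apply_apply]
  have htube : ∀ q, h q ∈ base → q ∈ tube 200 := fun q hq => by
    have := H.tube_of_mem hδ (hbase.1 hq)
    rw [mem_tube]; linarith
  have htε : ∀ q, h q ∈ base → q ∈ tube ε⁻¹ := fun q hq => by
    have := htube q hq
    rw [mem_tube] at *; linarith
  have hsurj : ∀ p : Circle × Plane, ∃ q, coverMap (K q) = p ∧ h q = p.2 := by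
    intro p
    obtain ⟨q, rfl⟩ := coverMap_surjective p
    refine ⟨K.symm q, by rw [K.apply_symm_apply], ?_⟩
    rw [H.near.apply_homeo_symm hδ1]; rfl
  have hinj : InjOn ψ (univ ×ˢ base) := by
    intro p hp p' hp' he
    obtain ⟨q, rfl, hq⟩ := hsurj p
    obtain ⟨q', rfl, hq'⟩ := hsurj p'
    rw [hψK, hψK] at he
    obtain ⟨n, rfl⟩ := hchart.inj q q' (htube q (hq ▸ hp.2)) (htube q' (hq' ▸ hp'.2)) he
    exact (shift_int (f := fun q => coverMap (K q)) hcK q n).symm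
  have himage : ψ '' (univ ×ˢ base) = lift φ '' (h ⁻¹' base) := by
    ext x
    constructor
    · rintro ⟨p, hp, rfl⟩
      obtain ⟨q, rfl, hq⟩ := hsurj p
      exact ⟨q, by rw [mem_preimage, hq]; exact hp.2, (hψK q).symm⟩
    · rintro ⟨q, hq, rfl⟩
      refine ⟨coverMap (K q), ⟨trivial, ?_⟩, hψK q⟩
      have : (coverMap (K q)).2 = h q := NearPlane.planeL_straighten q
      rw [this]; exact hq
  have hpre : IsOpen (h ⁻¹' base) := Metric.isOpen_ball.preimage H.near.contDiff.continuous
  have hψs : ∀ q, h q ∈ base → ContMDiffAt ((𝓡 1).prod (𝓡 2)) I ∞ ψ (coverMap (K q)) := by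
    intro q hq
    refine contMDiffAt_unlift hKsh (ContMDiffAt.comp (g := lift φ) (K q) ?_
      (H.near.contDiff_homeo_symm hδ1).contMDiff.contMDiffAt)
    rw [K.symm_apply_apply]
    exact hφ.contMDiffAt_lift (htε q hq)
  let inv := Function.invFunOn ψ (univ ×ˢ base)
  have hleft : ∀ p ∈ univ ×ˢ base, inv (ψ p) = p := fun p hp => hinj.leftInvOn_invFunOn hp
  have hinvs : ∀ q, h q ∈ base → ContMDiffAt I ((𝓡 1).prod (𝓡 2)) ∞ inv (lift φ q) := by
    intro q hq
    obtain ⟨S, hS, hSq, -, hSr⟩ := exists_local_inverse (hφ.contMDiffAt_lift (htε q hq))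
      (hφ.injective_mfderiv_lift (htε q hq))
    have h1 : ContMDiffAt I ((𝓡 1).prod (𝓡 2)) ∞ (fun x => coverMap (K (S x))) (lift φ q) :=
      ContMDiffAt.comp _ contMDiff_coverMap.contMDiffAt
        (ContMDiffAt.comp _ H.near.contDiff_straighten.contMDiff.contMDiffAt hS)
    refine h1.congr_of_eventuallyEq ?_
    have h2 : ∀ᶠ x in 𝓝 (lift φ q), S x ∈ h ⁻¹' base :=
      hS.continuousAt.eventually (hpre.mem_nhds (by rwa [hSq]))
    filter_upwards [h2, hSr] with x h3 h4
    have h5 : ψ (coverMap (K (S x))) = x := by rw [hψK, h4]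
    have h6 := hleft (coverMap (K (S x))) ⟨trivial, by
      have : (coverMap (K (S x))).2 = h (S x) := NearPlane.planeL_straighten _
      rw [this]; exact h3⟩
    rwa [h5] at h6
  refine ⟨⟨ψ, inv, base, Metric.isOpen_ball, ?_, ?_, ?_, ?_, ?_, ?_⟩, fun q hq => ?_⟩
  · rw [himage]
    exact hφ.isOpen_image_lift hpre fun q hq => htε q hq
  · intro p hp
    obtain ⟨q, rfl, hq⟩ := hsurj p
    exact (hψs q (hq ▸ hp.2)).contMDiffWithinAt
  · rw [himage]
    rintro _ ⟨q, hq, rfl⟩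
    exact (hinvs q hq).contMDiffWithinAt
  · exact fun z y hy => hleft (z, y) ⟨trivial, hy⟩
  · intro z y hy
    obtain ⟨q, hqp, hq⟩ := hsurj (z, y)
    rw [← hqp, hψK]
    exact (H.chart q (hbase.1 (hq ▸ hy))).1
  · intro z y hy
    obtain ⟨q, hqp, hq⟩ := hsurj (z, y)
    rw [← hqp, hψK, (H.chart q (hbase.1 (hq ▸ hy))).2]
    ext x
    constructor
    · rintro ⟨q', hq', rfl⟩
      refine ⟨coverMap (K q'), ⟨trivial, ?_⟩, hψK q'⟩
      have : (coverMap (K q')).2 = h q' := NearPlane.planeL_straighten q'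
      rw [mem_singleton_iff, this]
      exact hq'.trans hq
    · rintro ⟨p, hp, rfl⟩
      obtain ⟨q', rfl, hq'⟩ := hsurj p
      refine ⟨q', ?_, (hψK q').symm⟩
      have h7 : (coverMap (K q')).2 = y := hp.2
      exact hq'.trans (h7.trans hq.symm)
  · have h8 : (coverMap (K q)).2 = h q := NearPlane.planeL_straighten q
    refine ⟨(Set.ext_iff.1 himage _).2 ⟨q, hbase.2 hq, rfl⟩, ?_⟩
    have h6 := hleft (coverMap (K q)) ⟨trivial, h8.symm ▸ hbase.2 hq⟩
    rw [hψK] at h6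
    exact (congrArg Prod.snd h6).trans h8

end

end CircleCollapse

/-! ### Leaves as curves, the smooth foliation, and the fundamental group -/

namespace CircleCollapse

noncomputable section

open Bundle

namespace NearPlane

variable {δ : ℝ} {h : Cover → Plane}

theorem norm_planeL_le_of_fderiv_eq_zero (H : NearPlane δ h) {q u : Cover} (hu : fderiv ℝ h q u = 0) :
    ‖planeL u‖ ≤ δ * ‖u‖ := by
  have h1 := ContinuousLinearMap.le_of_opNorm_le _ (H.fderiv_le q) u
  rwa [sub_apply, hu, zero_sub, norm_neg] at h1

/-- The level set of `h` over `y`, parametrized by height. -/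
def leafCurve (H : NearPlane δ h) (hδ : δ < 1) (y : Plane) (t : ℝ) : Cover :=
  (H.homeo hδ).symm (t • circleDirection + sliceL y)

variable (H : NearPlane δ h) (hδ : δ < 1) (y : Plane)

theorem contDiff_leafCurve : ContDiff ℝ ∞ (H.leafCurve hδ y) :=
  (H.contDiff_homeo_symm hδ).comp ((contDiff_id.smul contDiff_const).add contDiff_const)

theorem apply_leafCurve (t : ℝ) : h (H.leafCurve hδ y t) = y := by
  rw [leafCurve, H.apply_homeo_symm hδ]; simp

theorem leafCurve_zero_coord (t : ℝ) : H.leafCurve hδ y t 0 = t := by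
  rw [leafCurve, H.homeo_symm_zero_coord hδ]; simp

theorem leafCurve_add_one (t : ℝ) :
    H.leafCurve hδ y (t + 1) = H.leafCurve hδ y t + circleDirection := by
  rw [leafCurve, leafCurve, ← H.homeo_symm_shift hδ]
  congr 1
  rw [add_smul, one_smul]; abel

theorem eq_leafCurve {q : Cover} (hq : h q = y) : H.leafCurve hδ y (q 0) = q :=
  H.eq_of_height hδ (H.leafCurve_zero_coord hδ y _) ((H.apply_leafCurve hδ y _).trans hq.symm)

/-- The tangent a has height component 1 and is killed by dh, so ‖planeL a‖ ≤ δ ‖a‖ ≤ δ (1 + ‖planeL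
a‖), and δ ≤ 1/2 gives 2 δ. -/
theorem norm_deriv_leafCurve_sub_le (hδ2 : δ ≤ 1 / 2) (t : ℝ) :
    ‖deriv (H.leafCurve hδ y) t - circleDirection‖ ≤ 2 * δ := by
  set a := deriv (H.leafCurve hδ y) t with ha
  have hd : HasDerivAt (H.leafCurve hδ y) a t :=
    (((H.contDiff_leafCurve hδ y).differentiable (by simp)) t).hasDerivAt
  have h1 : fderiv ℝ h (H.leafCurve hδ y t) a = 0 := by
    have h2 := (H.differentiable (H.leafCurve hδ y t)).hasFDerivAt.comp_hasDerivAt t hd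
    have h3 : h ∘ H.leafCurve hδ y = fun _ => y := funext fun t => H.apply_leafCurve hδ y t
    rw [h3] at h2
    exact h2.unique (hasDerivAt_const t y)
  have h0 : a 0 = 1 := by
    have h2 := heightL.hasFDerivAt.comp_hasDerivAt t hd
    have h3 : heightL ∘ H.leafCurve hδ y = fun t => t :=
      funext fun t => H.leafCurve_zero_coord hδ y t
    rw [h3] at h2
    exact h2.unique (hasDerivAt_id t)
  have h2 := H.norm_planeL_le_of_fderiv_eq_zero h1
  have h3 := cover_norm_le a
  rw [h0, abs_one] at h3
  have h4 : a - circleDirection = sliceL (planeL a) := by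
    rw [sub_eq_iff_eq_add', ← cover_decomp a, h0]
    simp
  rw [h4, norm_sliceL_apply]
  have h5 := H.nonneg
  have h6 := norm_nonneg (planeL a)
  nlinarith

theorem norm_planeL_leafCurve_sub_le (t : ℝ) : ‖planeL (H.leafCurve hδ y t) - y‖ ≤ δ := by
  have h1 := H.close (H.leafCurve hδ y t)
  rwa [H.apply_leafCurve, norm_sub_rev] at h1

end NearPlane

variable {H : Type v} [TopologicalSpace H] {I : ModelWithCorners ℝ (EuclideanSpace ℝ (Fin 3)) H}
  {M : Type u} [EMetricSpace M] [ChartedSpace H M]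
  [RiemannianBundle (fun x : M => TangentSpace I x)]

/-- A fibration close to the circles of the tubes is a smooth foliation by circles. -/
theorem exists_circleFoliation [IsManifold I ∞ M] {J : Type*} [Finite J]
    {φ : J → Circle × Plane → M} {c : J → ℝ}
    {ε δ : ℝ} (hφ : ∀ j, FlatTube I ε (c j) (φ j)) (hε : ε ≤ 1 / 10 ^ 8) (hδ : δ ≤ 1 / 2)
    {V : Set M} {F : M → Set M} (hF : IsFibration (fun j => lift (φ j)) δ V F) :
    ∃ Q : CircleFoliation I M, (Q.V : Set M) = V ∧ SecondCountableTopology Q.V ∧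
      ∀ x ∈ Q.V, ∃ (j : J) (q : Cover) (h : Cover → Plane) (ρ : ℝ) (P : Q.Param),
        ‖planeL q‖ < 10 ∧ lift (φ j) q = x ∧ FibChart (lift (φ j)) (Q.V : Set M) Q.F δ q h ρ ∧
        ∀ q', ‖h q' - h q‖ < ρ →
          lift (φ j) q' ∈ P.image ∧ (P.inv (lift (φ j) q')).2 = h q' := by
  have hP : ∀ x ∈ V, ∃ (j : J) (q : Cover) (h : Cover → Plane) (ρ : ℝ) (P : FibParam I V F),
      ‖planeL q‖ < 10 ∧ lift (φ j) q = x ∧ FibChart (lift (φ j)) V F δ q h ρ ∧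
        ∀ q', ‖h q' - h q‖ < ρ →
          lift (φ j) q' ∈ P.image ∧ (P.inv (lift (φ j) q')).2 = h q' := by
    intro x hx
    obtain ⟨j, q, h, ρ, hq, hqx, hc⟩ := hF x hx
    obtain ⟨P, hP⟩ := (hφ j).exists_fibParam hε hc hδ (by linarith)
    exact ⟨j, q, h, ρ, P, hq, hqx, hc, hP⟩
  have hVo : IsOpen V := by
    rw [isOpen_iff_mem_nhds]
    intro x hx
    obtain ⟨j, q, h, ρ, P, hq, hqx, hc, hP⟩ := hP x hx
    have h1 : x ∈ P.image := hqx ▸ (hP q (by simpa using hc.pos)).1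
    filter_upwards [P.isOpen_image.mem_nhds h1] with y hy
    obtain ⟨⟨z, t⟩, ht, rfl⟩ := hy
    exact P.mem z t ht.2
  refine ⟨⟨⟨V, hVo⟩, F, fun x hx => ?_⟩, rfl, ?_, hP⟩
  · obtain ⟨j, q, h, ρ, P, hq, hqx, hc, hP⟩ := hP x hx
    exact ⟨P, hqx ▸ (hP q (by simpa using hc.pos)).1⟩
  -- M itself need not be second countable, but V is covered by finitely many compact parts of
  -- tubes.
  · have hsep : TopologicalSpace.IsSeparable V := by
      refine (TopologicalSpace.IsSeparable.iUnion
        (s := fun j => lift (φ j) '' {q | ‖planeL q‖ ≤ 10}) fun j => ?_).mono ?_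
      · have := (hφ j).inv_gt hε
        exact ((hφ j).isCompact_image_lift (by linarith)).isSeparable
      · intro x hx
        obtain ⟨j, q, h, ρ, hq, hqx, -⟩ := hF x hx
        exact mem_iUnion.2 ⟨j, q, hq.le, hqx⟩
    exact hsep.secondCountableTopology

/-- Otherwise the intermediate value theorem would yield a half-integral value. -/
theorem eq_of_int_valued {X : Type*} [TopologicalSpace X] {s : Set X} (hs : IsPreconnected s)
    {f : X → ℝ} (hf : ContinuousOn f s) {m : X → ℤ} (hm : ∀ x ∈ s, f x = m x) {x y : X}
    (hx : x ∈ s) (hy : y ∈ s) : m x = m y := by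
  have h1 := hs.image f hf
  have h3 : ∀ p ∈ s, ∀ q ∈ s, m q ≤ m p := by
    intro p hp q hq
    by_contra! hlt
    have h5 := h1.Icc_subset ⟨p, hp, hm p hp⟩ ⟨q, hq, hm q hq⟩
    have h4 : ((m p : ℝ) + 1 / 2) ∈ Icc (m p : ℝ) (m q : ℝ) := by
      have : ((m p + 1 : ℤ) : ℝ) ≤ m q := by exact_mod_cast hlt
      push_cast at this
      exact ⟨by linarith, by linarith⟩
    obtain ⟨z, hz, hze⟩ := h5 h4
    rw [hm z hz] at hze
    have h6 : ((2 * m z : ℤ) : ℝ) = (2 * m p + 1 : ℤ) := by push_cast; linarith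
    have h7 : 2 * m z = 2 * m p + 1 := by exact_mod_cast h6
    omega
  exact le_antisymm (h3 _ hy _ hx) (h3 _ hx _ hy)

/-- A closed curve which winds around a tube once generates the fundamental group of the tube. -/
theorem FlatTube.generatesFundamentalGroup {ε c : ℝ} {φ : Circle × Plane → M}
    (hφ : FlatTube I ε c φ) {F : Set M} (hF : F ⊆ φ '' circleTimesBall ε⁻¹) {b : ℝ → Cover}
    (hb : Continuous b) (hbt : ∀ t, b t ∈ tube ε⁻¹) {m : ℤ} (hm : m * m = 1)
    (hb1 : ∀ t, b (t + 1) = b t + (m : ℝ) • circleDirection)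
    (hbF : F = range fun t => lift φ (b t)) : GeneratesFundamentalGroup hF := by
  rintro ⟨x, hx⟩ γ
  obtain ⟨g, hg⟩ := Path.Homotopic.Quotient.mk_surjective γ.toPath
  obtain ⟨t₀, rfl⟩ : x ∈ range fun t => lift φ (b t) := hbF ▸ hx
  have hbint : ∀ (n : ℤ) (t : ℝ), b (t + n) = b t + (n * m : ℝ) • circleDirection := by
    intro n
    induction n using Int.induction_on with
    | zero => intro t; simp
    | succ n ih =>
      intro t
      push_cast at ih ⊢
      rw [← add_assoc, hb1, ih, add_mul, add_smul, one_mul, add_assoc]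
    | pred n ih =>
      intro t
      have h1 := hb1 (t + ((-(n : ℤ) - 1 : ℤ) : ℝ))
      have h2 : t + ((-(n : ℤ) - 1 : ℤ) : ℝ) + 1 = t + ((-(n : ℤ) : ℤ) : ℝ) := by
        push_cast; ring
      rw [h2, ih] at h1
      rw [← sub_eq_iff_eq_add] at h1
      rw [← h1, add_sub_assoc, ← sub_smul]
      congr 2
      push_cast; ring
  have hgc : Continuous fun t : ℝ => (g.extend t : M) := continuous_subtype_val.comp g.continuous_extend
  obtain ⟨G, hG, hG0, hGx⟩ := hφ.exists_lift hgc (fun t => by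
    rw [image_tube]; exact (g.extend t).2) (x₀ := 0) (hbt t₀) (by
    rw [g.extend_zero]; rfl)
  obtain ⟨n, hn⟩ : ∃ n : ℤ, G 1 = b t₀ + (n : ℝ) • circleDirection := by
    refine (hφ.lift_eq_iff (hbt t₀) (hGx 1).1).1 ?_
    rw [← (hGx 1).2, g.extend_one]; rfl
  -- The given loop lifts to a path displaced by n turns. Running along the fiber for the time n m
  -- gives the displacement n m m = n, hence the same endpoints in the cover.
  let f : C(unitInterval, F) := ⟨fun t => ⟨lift φ (b (t₀ + n * m * t)), by
      exact (Set.ext_iff.1 hbF _).2 (mem_range_self _)⟩, by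
    refine Continuous.subtype_mk ?_ _
    refine hφ.contMDiffOn_lift.continuousOn.comp_continuous
      (hb.comp (by fun_prop)) fun t => hbt _⟩
  have hend : b (t₀ + n * m) = b t₀ + (n : ℝ) • circleDirection := by
    have h1 := hbint (n * m) t₀
    push_cast at h1
    rw [h1]
    congr 2
    have : (m : ℝ) * m = 1 := by exact_mod_cast hm
    rw [mul_assoc, this, mul_one]
  let fp : Path (⟨lift φ (b t₀), hx⟩ : F) ⟨lift φ (b t₀), hx⟩ := ⟨f, by
    apply Subtype.ext
    simp [f], by
    apply Subtype.ext
    change lift φ (b (t₀ + n * m * (1 : ℝ))) = lift φ (b t₀)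
    rw [mul_one, hend, shift_int (lift_shift φ)]⟩
  refine ⟨FundamentalGroup.fromPath (Path.Homotopic.Quotient.mk fp), ?_⟩
  have hsc : ContractibleSpace (tube ε⁻¹) := (convex_tube _).contractibleSpace ⟨_, hbt 0⟩
  let G' : Path (⟨b t₀, hbt t₀⟩ : tube ε⁻¹) ⟨G 1, (hGx 1).1⟩ :=
    ⟨⟨fun t => ⟨G t, (hGx t).1⟩, by fun_prop⟩, Subtype.ext (by simpa using hG0), rfl⟩
  let B' : Path (⟨b t₀, hbt t₀⟩ : tube ε⁻¹) ⟨G 1, (hGx 1).1⟩ :=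
    ⟨⟨fun t => ⟨b (t₀ + n * m * t), hbt _⟩, by fun_prop⟩, Subtype.ext (by simp),
      Subtype.ext (by simp [hend, hn])⟩
  -- The tube in the cover is convex, so paths with equal endpoints are homotopic there, and the
  -- homotopy is pushed down to the image of φ.
  have hhom : B'.Homotopic G' := SimplyConnectedSpace.paths_homotopic _ _
  let Λ : C(tube ε⁻¹, φ '' circleTimesBall ε⁻¹) :=
    ⟨fun q => ⟨lift φ q, by rw [← image_tube]; exact ⟨q, q.2, rfl⟩⟩, by
      refine Continuous.subtype_mk ?_ _
      exact hφ.contMDiffOn_lift.continuousOn.comp_continuous continuous_subtype_val fun q => q.2⟩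
  have h1 := hhom.map Λ
  have h2 : (⟨lift φ (b t₀), hF hx⟩ : φ '' circleTimesBall ε⁻¹) = Λ ⟨G 1, (hGx 1).1⟩ := by
    apply Subtype.ext
    change lift φ (b t₀) = lift φ (G 1)
    rw [hn, shift_int (lift_shift φ)]
  have h3 : ((fp.map (continuous_inclusion hF)).Homotopic g) := by
    obtain ⟨K⟩ := h1
    refine ⟨(K.pathCast rfl h2).cast ?_ ?_⟩
    · ext t; rfl
    · ext t
      change lift φ (G t) = _
      rw [← (hGx t).2, g.extend_apply t.2]
  refine Eq.trans ?_ hg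
  exact (Path.Homotopic.Quotient.eq.2 h3)

end

end CircleCollapse

/-! ### Fibers seen in an arbitrary tube -/

namespace CircleCollapse

noncomputable section

open Bundle

/-- A relative error η forces the cosine to be at least (1 - η) / (1 + η) ≥ 1 - 4 η, which is C for
η = (1 - C) / 4. The minimum with the supplementary angle absorbs the sign of k. Truncation at π
keeps the cosine decreasing. -/
theorem exists_angle_bound {ε' : ℝ} (hε' : 0 < ε') : ∃ η : ℝ, 0 < η ∧
    ∀ {E : Type} [NormedAddCommGroup E] [InnerProductSpace ℝ E] (w t : E) (k : ℝ), k • t ≠ 0 →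
      ‖w - k • t‖ ≤ η * ‖k • t‖ →
      min (InnerProductGeometry.angle w t) (Real.pi - InnerProductGeometry.angle w t) ≤ ε' := by
  set C := Real.cos (min ε' Real.pi) with hC
  have hpi := Real.pi_pos
  have h0 : 0 < min ε' Real.pi := lt_min hε' hpi
  have hC1 : C < 1 := by
    have := Real.cos_lt_cos_of_nonneg_of_le_pi le_rfl (min_le_right ε' Real.pi) h0
    rwa [Real.cos_zero] at this
  refine ⟨(1 - C) / 4, by linarith, ?_⟩
  intro E _ _ w t k hkt hw
  have hCm : -1 ≤ C := Real.neg_one_le_cos _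
  have key : InnerProductGeometry.angle w (k • t) ≤ ε' := by
    set z := k • t with hz
    set η := (1 - C) / 4 with hη
    have hη1 : η ≤ 1 / 2 := by linarith
    have hη0 : 0 < η := by linarith
    have hzpos : 0 < ‖z‖ := norm_pos_iff.2 hkt
    have h1 : (1 - η) * ‖z‖ ^ 2 ≤ inner ℝ w z := by
      have h2 : inner ℝ w z = ‖z‖ ^ 2 + inner ℝ (w - z) z := by
        rw [inner_sub_left, real_inner_self_eq_norm_sq]; ring
      have h3 := (abs_le.1 (abs_real_inner_le_norm (w - z) z)).1
      have h4 : ‖w - z‖ * ‖z‖ ≤ η * ‖z‖ * ‖z‖ := by gcongr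
      nlinarith
    have h2 : ‖w‖ ≤ (1 + η) * ‖z‖ := by
      have := norm_le_norm_add_norm_sub' w z
      linarith
    have hwpos : 0 < ‖w‖ := by
      by_contra! h
      have h3 : w = 0 := norm_eq_zero.1 (le_antisymm h (norm_nonneg _))
      rw [h3, inner_zero_left] at h1
      nlinarith [sq_nonneg ‖z‖, pow_pos hzpos 2]
    have h3 : C ≤ Real.cos (InnerProductGeometry.angle w z) := by
      rw [InnerProductGeometry.cos_angle, le_div_iff₀ (by positivity)]
      have h5 : C = 1 - 4 * η := by rw [hη]; ring
      rcases le_or_gt C 0 with h | h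
      · have : 0 ≤ (1 - η) * ‖z‖ ^ 2 := by
          have : 0 ≤ 1 - η := by linarith
          positivity
        nlinarith [mul_pos hwpos hzpos]
      · calc C * (‖w‖ * ‖z‖) ≤ C * ((1 + η) * ‖z‖ * ‖z‖) := by gcongr
          _ = (C * (1 + η)) * ‖z‖ ^ 2 := by ring
          _ ≤ (1 - η) * ‖z‖ ^ 2 := by
            gcongr
            nlinarith
          _ ≤ _ := h1
    have h4 : InnerProductGeometry.angle w z ≤ min ε' Real.pi := by
      by_contra! hlt
      have h5 := Real.cos_lt_cos_of_nonneg_of_le_pi h0.le (InnerProductGeometry.angle_le_pi w z) hlt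
      linarith
    exact h4.trans (min_le_left _ _)
  rcases lt_trichotomy k 0 with hk | hk | hk
  · refine (min_le_right _ _).trans ?_
    rw [InnerProductGeometry.angle_smul_right_of_neg _ _ hk, InnerProductGeometry.angle_neg_right]
      at key
    exact key
  · exact absurd (by rw [hk, zero_smul]) hkt
  · rw [InnerProductGeometry.angle_smul_right_of_pos _ _ hk] at key
    exact (min_le_left _ _).trans key

variable {H : Type v} [TopologicalSpace H] {I : ModelWithCorners ℝ (EuclideanSpace ℝ (Fin 3)) H}
  {M : Type u} [EMetricSpace M] [ChartedSpace H M]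

theorem injective_mfderiv_val (U : TopologicalSpace.Opens M) (x : U) :
    Function.Injective (mfderiv I I (Subtype.val : U → M) x) := by
  classical
  let r : M → U := fun y => if h : y ∈ U then ⟨y, h⟩ else x
  have hr : ∀ᶠ y in 𝓝 (x : M), ((r y : U) : M) = y := by
    filter_upwards [U.isOpen.mem_nhds x.2] with y hy
    have hy : y ∈ U := hy
    simp only [r, dif_pos hy]
  have hrs : ContMDiffAt I I ∞ r (x : M) :=
    CircleFoliation.contMDiffAt_of_val (contMDiffAt_id.congr_of_eventuallyEq hr)
  have h1 : r ∘ (Subtype.val : U → M) = id := by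
    ext y
    simp [r]
  have h2 := mfderiv_comp x (I' := I) (g := r) (f := (Subtype.val : U → M))
    (hrs.mdifferentiableAt (by simp)) (contMDiff_subtype_val.mdifferentiableAt (n := ∞) (by simp))
  rw [h1, mfderiv_id] at h2
  intro v w hvw
  have h3 := fun v => congrArg
    (fun L : EuclideanSpace ℝ (Fin 3) →L[ℝ] EuclideanSpace ℝ (Fin 3) => L v) h2
  have h4 := h3 v
  have h5 := h3 w
  refine h4.trans (Eq.trans ?_ h5.symm)
  exact congrArg (mfderiv I I r (x : M)) hvw

theorem CircleFoliation.fderiv_eq_zero_of_mfderiv_proj' [IsManifold I ∞ M]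
    {Q : CircleFoliation I M} (P : Q.Param) {Φ : Cover → M}
    {h : Cover → Plane} {q : Cover} (hΦ : MDifferentiableAt 𝓘(ℝ, Cover) I Φ q)
    (hq : Φ q ∈ P.image) (hP : ∀ᶠ q' in 𝓝 q, (P.inv (Φ q')).2 = h q') {x : M} (hx : x = Φ q)
    (hV : x ∈ Q.V) {v : TangentSpace I (⟨x, hV⟩ : Q.V)}
    (hv : mfderiv I (𝓡 2) Q.proj ⟨x, hV⟩ v = 0) {u : Cover}
    (hu : (mfderiv I I (Subtype.val : Q.V → M) ⟨x, hV⟩ v : EuclideanSpace ℝ (Fin 3)) =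
      mfderiv 𝓘(ℝ, Cover) I Φ q u) : fderiv ℝ h q u = 0 := by
  subst hx
  exact CircleFoliation.fderiv_eq_zero_of_mfderiv_proj P hΦ hq hP hV hv hu

variable [RiemannianBundle (fun x : M => TangentSpace I x)]

namespace FlatTube

variable {ε c : ℝ} {φ : Circle × Plane → M}

theorem norm_sq_mfderiv (h : FlatTube I ε c φ) {q : Cover} (hq : q ∈ tube ε⁻¹) (u : Cover) :
    (1 - ε) * ‖u‖ ^ 2 ≤ c * ‖(mfderiv 𝓘(ℝ, Cover) I (lift φ) q u : TangentSpace I (lift φ q))‖ ^ 2 ∧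
    c * ‖(mfderiv 𝓘(ℝ, Cover) I (lift φ) q u : TangentSpace I (lift φ q))‖ ^ 2 ≤
      (1 + ε) * ‖u‖ ^ 2 := by
  rw [← real_inner_self_eq_norm_sq (F := TangentSpace I (lift φ q)), ← pullbackMetric_apply,
    ← form_apply]
  exact ⟨le_form_self (h.close hq) u, form_self_le (h.close hq) u⟩

theorem surjective_mfderiv_lift (h : FlatTube I ε c φ) {q : Cover} (hq : q ∈ tube ε⁻¹) :
    Function.Surjective (mfderiv 𝓘(ℝ, Cover) I (lift φ) q) := by
  have key : ∀ L : Cover →L[ℝ] Cover, Function.Injective L → Function.Surjective L := fun L hL =>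
    LinearMap.injective_iff_surjective.1 (show Function.Injective (L : Cover →ₗ[ℝ] Cover) from hL)
  exact key _ (h.injective_mfderiv_lift hq)

variable {c₁ : ℝ} {φ₁ : Circle × Plane → M}

/-- A fiber, which is a level set in the tube `φ₁`, lifted to an arbitrary tube containing it. -/
theorem exists_leaf_lift [IsManifold I ∞ M]
    [IsContMDiffRiemannianBundle I ∞ (EuclideanSpace ℝ (Fin 3)) (fun x : M => TangentSpace I x)]
    (h₁ : FlatTube I ε c₁ φ₁) (h₂ : FlatTube I ε c φ) (hε1 : ε ≤ 1 / 10 ^ 8) {δ : ℝ}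
    {h : Cover → Plane} (Hh : NearPlane δ h) (hδ : δ ≤ 1 / 100) {q₁ q₂ : Cover}
    (hq₁ : ‖planeL q₁‖ ≤ 50) (hq₂ : q₂ ∈ tube ε⁻¹) (he : lift φ₁ q₁ = lift φ q₂)
    (hF : lift φ₁ '' {q | h q = h q₁} ⊆ φ '' circleTimesBall ε⁻¹) :
    ∃ (b : ℝ → Cover) (D : Cover →L[ℝ] Cover) (m : ℤ), Continuous b ∧ (∀ t, b t ∈ tube ε⁻¹) ∧
      m * m = 1 ∧ (∀ t, b (t + 1) = b t + (m : ℝ) • circleDirection) ∧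
      (lift φ₁ '' {q | h q = h q₁} = range fun t => lift φ (b t)) ∧
      (∀ x ∈ lift φ₁ '' {q | h q = h q₁}, ∃ t, ‖planeL (b t) - planeL q₂‖ ≤ 12 * ε + 3 * δ ∧
        x = lift φ (b t)) ∧
      ‖D circleDirection - (m : ℝ) • circleDirection‖ ≤ 6 * ε ∧ (∀ u, ‖D u‖ ≤ 11 / 10 * ‖u‖) ∧
      ∀ u, (mfderiv 𝓘(ℝ, Cover) I (lift φ₁) q₁ u : EuclideanSpace ℝ (Fin 3)) =
        mfderiv 𝓘(ℝ, Cover) I (lift φ) q₂ (D u) := by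
  have hε := h₁.eps_pos
  have hinv := h₁.inv_gt hε1
  have hδ0 := Hh.nonneg
  have hδ1 : δ < 1 := by linarith
  set y := h q₁ with hy
  have hy50 : ‖y‖ ≤ 51 := by
    have h1 := Hh.close q₁
    linarith [norm_le_norm_add_norm_sub' y (planeL q₁)]
  -- The fiber in the first tube, parametrized by height and starting at q₁; b is its lift to the
  -- second tube, starting at q₂.
  let a : ℝ → Cover := fun t => Hh.leafCurve hδ1 y (q₁ 0 + t)
  let a' : ℝ → Cover := fun t => deriv (Hh.leafCurve hδ1 y) (q₁ 0 + t)
  have ha0 : a 0 = q₁ := by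
    simp only [a, add_zero]
    exact Hh.eq_leafCurve hδ1 y rfl
  have hal : ∀ t, h (a t) = y := fun t => Hh.apply_leafCurve hδ1 y _
  have had : ∀ t, HasDerivAt a (a' t) t := fun t =>
    HasDerivAt.comp_const_add (q₁ 0) t
      (((Hh.contDiff_leafCurve hδ1 y).differentiable (by simp)) _).hasDerivAt
  have hadw : ∀ t ∈ Icc (0 : ℝ) 1, HasDerivWithinAt a (a' t) (Icc 0 1) t := fun t _ =>
    (had t).hasDerivWithinAt
  have ha'e : ∀ t, ‖a' t - circleDirection‖ ≤ 2 * δ := fun t =>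
    Hh.norm_deriv_leafCurve_sub_le hδ1 y (by linarith) _
  have ha'n : ∀ t, ‖a' t‖ ≤ 51 / 50 := fun t => by
    have := norm_le_norm_add_norm_sub' (a' t) circleDirection
    rw [norm_circleDirection] at this
    linarith [ha'e t]
  have hat : ∀ t, a t ∈ tube ε⁻¹ := fun t => by
    have h1 := Hh.norm_planeL_leafCurve_sub_le hδ1 y (q₁ 0 + t)
    rw [mem_tube]
    linarith [norm_le_norm_add_norm_sub' (planeL (a t)) y]
  have ha1 : ∀ t, a (t + 1) = a t + circleDirection := fun t => by
    simp only [a]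
    rw [← add_assoc, Hh.leafCurve_add_one hδ1]
  have hac : Continuous a := continuous_iff_continuousAt.2 fun t => (had t).continuousAt
  obtain ⟨b, hb, hb0, hbx⟩ := h₂.exists_lift (p := fun t : ℝ => lift φ₁ (a t))
    (h₁.contMDiffOn_lift.continuousOn.comp_continuous hac hat) (fun t => by
      rw [image_tube]; exact hF ⟨a t, hal t, rfl⟩) (x₀ := 0) hq₂ (by rw [ha0, he])
  have hbt := fun t => (hbx t).1
  have hbe := fun t => (hbx t).2
  set s := Real.sqrt (c / c₁) with hs
  have hs0 : 0 < s := h₁.scale_pos h₂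
  have hs1 : s ≤ 1 + 8 * ε := h₁.scale_le h₂ he (by linarith) hq₂
  obtain ⟨D, hD⟩ := h₁.exists_curve_transition h₂ (by rw [← hs]; linarith) (ℓ := 51 / 50) hadw
    (fun t _ => ha'n t) (fun t _ => hat t) hb.continuousOn (fun t _ => hbt t) (fun t _ => hbe t)
  obtain ⟨m, hm1, hm⟩ := h₁.exists_winding h₂ (ℓ := 51 / 50) hadw (fun t _ => ha'n t)
    (fun t _ => hbt t) (fun t _ => hbe t) (by simpa using ha1 0)
    (fun t ht => (hD t ht).1) (fun t ht => (hD t ht).2.2.1)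
  rw [← hs] at hD hm
  have hεs : ε * s ≤ ε * (1 + 1 / 100) := by
    gcongr
    linarith
  have hm6 : ‖(m : ℝ) • circleDirection - D 0 circleDirection‖ ≤ 6 * ε := by
    refine hm.trans ?_
    nlinarith
  have hmm : m * m = 1 := by
    obtain ⟨hl, hu⟩ := (hD 0 (by simp)).2.1 circleDirection
    rw [norm_circleDirection, mul_one] at hl hu
    have h4 : ‖(m : ℝ) • circleDirection‖ = |(m : ℝ)| := by
      rw [norm_smul, norm_circleDirection, mul_one, Real.norm_eq_abs]
    have h5 := norm_sub_norm_le (D 0 circleDirection) ((m : ℝ) • circleDirection)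
    rw [norm_sub_rev] at h5
    have h6 := norm_sub_norm_le ((m : ℝ) • circleDirection) (D 0 circleDirection)
    rw [h4] at h5 h6
    have h9 : |(m : ℝ)| < 2 := by nlinarith
    have h10 : 0 < |(m : ℝ)| := by nlinarith
    have h11 : |m| < 2 := by exact_mod_cast h9
    have h12 : 0 < |m| := by exact_mod_cast h10
    have h13 : |m| = 1 := by omega
    rw [← abs_mul_abs_self, h13, one_mul]
  -- The number of turns is known at time 0 and, as a continuous integral function of time, is
  -- constant.
  have hbshift : ∀ t, b (t + 1) = b t + (m : ℝ) • circleDirection := by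
    have h3 : ∀ t, ∃ n : ℤ, b (t + 1) = b t + (n : ℝ) • circleDirection := fun t => by
      refine (h₂.lift_eq_iff (hbt t) (hbt (t + 1))).1 ?_
      rw [← hbe, ← hbe, ha1, lift_shift]
    choose n hn using h3
    have h4 : ∀ t ∈ (univ : Set ℝ), (b (t + 1) - b t) 0 = n t := fun t _ => by
      rw [hn, add_sub_cancel_left]; simp
    have h5 : ContinuousOn (fun t => (b (t + 1) - b t) 0) univ := by
      refine (heightL.continuous.comp (Continuous.sub ?_ hb)).continuousOn
      exact hb.comp (by fun_prop)
    have h6 : n 0 = m := by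
      have h7 := h4 0 trivial
      rw [zero_add, hm1, add_sub_cancel_left] at h7
      simp only [PiLp.smul_apply, circleDirection_zero_coord, smul_eq_mul, mul_one] at h7
      exact_mod_cast h7.symm
    intro t
    rw [hn, eq_of_int_valued isPreconnected_univ h5 h4 (mem_univ t) (mem_univ 0), h6]
  have hDe : ∀ t ∈ Icc (0 : ℝ) 1, ‖D t circleDirection - (m : ℝ) • circleDirection‖ ≤ 12 * ε := by
    intro t ht
    have h3 := (D t - D 0).le_of_opNorm_le (hD t ht).2.2.1 circleDirection
    rw [sub_apply, norm_circleDirection, mul_one] at h3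
    have h4 : D t circleDirection - (m : ℝ) • circleDirection =
      (D t circleDirection - D 0 circleDirection) -
        ((m : ℝ) • circleDirection - D 0 circleDirection) := by abel
    rw [h4]
    refine (norm_sub_le _ _).trans ?_
    have h5 : 5 * ε * s * (51 / 50) * t ≤ 5 * ε * s * (51 / 50) * 1 := by
      gcongr
      exact ht.2
    nlinarith
  have hDn : ∀ t ∈ Icc (0 : ℝ) 1, ∀ u, ‖D t u‖ ≤ 11 / 10 * ‖u‖ := by
    intro t ht u
    refine ((hD t ht).2.1 u).2.trans ?_
    gcongr
    nlinarith
  -- The planar velocity splits into the planar part of the image of the circle direction (12 ε) and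
  -- the image of the tilt of the fiber (11/10 · 2 δ ≤ 3 δ). One period suffices, since it already
  -- covers the fiber.
  have hplane : ∀ t ∈ Icc (0 : ℝ) 1, ‖planeL (b t) - planeL q₂‖ ≤ 12 * ε + 3 * δ := by
    intro t ht
    have h3 := (convex_Icc (0 : ℝ) 1).norm_image_sub_le_of_norm_hasDerivWithin_le
      (f := fun t => planeL (b t)) (f' := fun t => planeL (D t (a' t))) (C := 12 * ε + 3 * δ)
      (fun x hx => planeL.hasFDerivAt.comp_hasDerivWithinAt x (hD x hx).1) (fun x hx => by
        have h4 : planeL (D x (a' x)) = planeL (D x circleDirection - (m : ℝ) • circleDirection) +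
            planeL (D x (a' x - circleDirection)) := by
          rw [← map_add, map_sub]
          simp only [map_add, map_sub, map_smul, planeL_circleDirection, smul_zero]
          abel
        rw [h4]
        refine (norm_add_le _ _).trans ?_
        have h5 := norm_planeL_apply_le (D x circleDirection - (m : ℝ) • circleDirection)
        have h6 := norm_planeL_apply_le (D x (a' x - circleDirection))
        have h7 := hDn x hx (a' x - circleDirection)
        linarith [hDe x hx, ha'e x]) (left_mem_Icc.2 zero_le_one) ht
    rw [sub_zero, hb0, Real.norm_eq_abs, abs_of_nonneg ht.1] at h3
    refine h3.trans (mul_le_of_le_one_right (by linarith) ht.2)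
  have hleaf : ∀ q, h q = y → ∃ t ∈ Icc (0 : ℝ) 1, lift φ₁ q = lift φ (b t) := by
    intro q hq
    refine ⟨Int.fract (q 0 - q₁ 0), ⟨Int.fract_nonneg _, (Int.fract_lt_one _).le⟩, ?_⟩
    rw [← hbe]
    have h3 : a (Int.fract (q 0 - q₁ 0)) =
        q + ((-⌊q 0 - q₁ 0⌋ : ℤ) : ℝ) • circleDirection := by
      have h4 : h (q + ((-⌊q 0 - q₁ 0⌋ : ℤ) : ℝ) • circleDirection) = y := by
        rw [shift_int Hh.shift, hq]
      rw [← Hh.eq_leafCurve hδ1 y h4]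
      simp only [a]
      congr 1
      simp only [Int.fract, PiLp.add_apply, PiLp.smul_apply, circleDirection_zero_coord,
        smul_eq_mul, mul_one]
      push_cast; ring
    rw [h3, shift_int (lift_shift φ₁)]
  refine ⟨b, D 0, m, hb, hbt, hmm, hbshift, ?_, ?_, ?_, hDn 0 (by simp), ?_⟩
  · ext x
    constructor
    · rintro ⟨q, hq, rfl⟩
      obtain ⟨t, -, ht⟩ := hleaf q hq
      exact ⟨t, ht.symm⟩
    · rintro ⟨t, rfl⟩
      exact ⟨a t, hal t, hbe t⟩
  · rintro _ ⟨q, hq, rfl⟩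
    obtain ⟨t, ht, htq⟩ := hleaf q hq
    exact ⟨t, hplane t ht, htq⟩
  · rw [norm_sub_rev]; exact hm6
  · intro u
    have h3 := (hD 0 (by simp)).2.2.2 u
    rw [ha0, hb0] at h3
    exact h3

/-- The tangent of a fiber is close to the circle direction of the tube. -/
theorem norm_mfderiv_sub_le (h₂ : FlatTube I ε c φ) {δ : ℝ} (hδ0 : 0 ≤ δ) (hδ : δ ≤ 1 / 100)
    {q₂ : Cover} (hq₂ : q₂ ∈ tube ε⁻¹) {D : Cover →L[ℝ] Cover} {m : ℤ} (hm : m * m = 1)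
    (hDe : ‖D circleDirection - (m : ℝ) • circleDirection‖ ≤ 6 * ε)
    (hDn : ∀ u, ‖D u‖ ≤ 11 / 10 * ‖u‖) {u : Cover} (hu : ‖planeL u‖ ≤ δ * ‖u‖) (hu0 : u ≠ 0) :
    ∃ k : ℝ, k • (mfderiv 𝓘(ℝ, Cover) I (lift φ) q₂ circleDirection : TangentSpace I (lift φ q₂))
        ≠ 0 ∧
      ‖(mfderiv 𝓘(ℝ, Cover) I (lift φ) q₂ (D u) : TangentSpace I (lift φ q₂)) -
        k • (mfderiv 𝓘(ℝ, Cover) I (lift φ) q₂ circleDirection : TangentSpace I (lift φ q₂))‖ ≤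
      (12 * ε + 4 * δ) * ‖k • (mfderiv 𝓘(ℝ, Cover) I (lift φ) q₂ circleDirection :
        TangentSpace I (lift φ q₂))‖ := by
  have hε := h₂.eps_pos
  have hε1 := h₂.eps_le
  -- The height component of u is carried to the circle direction of the second tube with the sign m
  -- = ±1.
  set k : ℝ := u 0 * m with hk
  have hm1 : |(m : ℝ)| = 1 := by
    have h1 : (m : ℝ) * m = 1 := by exact_mod_cast hm
    have h2 : |(m : ℝ)| * |(m : ℝ)| = 1 := by rw [abs_mul_abs_self, h1]
    nlinarith [abs_nonneg (m : ℝ)]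
  have hku : |k| = |u 0| := by rw [hk, abs_mul, hm1, mul_one]
  have hupos : 0 < ‖u‖ := norm_pos_iff.2 hu0
  have hnu := cover_norm_le u
  have hu1 : ‖u‖ ≤ 103 / 100 * |u 0| := by nlinarith
  have hkpos : 0 < |k| := by rw [hku]; nlinarith
  have hk0 : k ≠ 0 := abs_pos.1 hkpos
  have herr : ‖D u - k • circleDirection‖ ≤ (6 * ε + 2 * δ) * |k| := by
    have h1 : D u - k • circleDirection =
        u 0 • (D circleDirection - (m : ℝ) • circleDirection) + D (sliceL (planeL u)) := by
      conv_lhs => rw [← cover_decomp u]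
      rw [map_add, map_smul, hk, smul_sub, smul_smul]
      simp
      abel
    rw [h1]
    refine (norm_add_le _ _).trans ?_
    rw [norm_smul, Real.norm_eq_abs, ← hku]
    have h2 := hDn (sliceL (planeL u))
    rw [norm_sliceL_apply] at h2
    have h3 : |k| * ‖D circleDirection - (m : ℝ) • circleDirection‖ ≤ |k| * (6 * ε) := by gcongr
    have h4 : δ * ‖u‖ ≤ δ * (103 / 100 * |k|) := by
      rw [hku]; gcongr
    nlinarith [mul_nonneg hδ0 hkpos.le]
  let L : Cover →L[ℝ] TangentSpace I (lift φ q₂) := mfderiv 𝓘(ℝ, Cover) I (lift φ) q₂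
  have hL : ∀ w, (1 - ε) * ‖w‖ ^ 2 ≤ c * ‖L w‖ ^ 2 ∧ c * ‖L w‖ ^ 2 ≤ (1 + ε) * ‖w‖ ^ 2 :=
    fun w => h₂.norm_sq_mfderiv hq₂ w
  have hc := h₂.pos
  refine ⟨k, ?_, ?_⟩
  · change k • L circleDirection ≠ 0
    rw [← map_smul]
    intro h0
    have h1 := (hL (k • circleDirection)).1
    rw [h0, norm_zero, norm_smul, norm_circleDirection, mul_one, Real.norm_eq_abs] at h1
    have h2 : 0 < (1 - ε) * |k| ^ 2 := by
      have : 0 < 1 - ε := by linarith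
      positivity
    norm_num at h1
    rw [sq_abs] at h2
    linarith
  · change ‖L (D u) - k • L circleDirection‖ ≤ (12 * ε + 4 * δ) * ‖k • L circleDirection‖
    rw [← map_smul, ← map_sub]
    have h1 := (hL (D u - k • circleDirection)).2
    have h2 := (hL (k • circleDirection)).1
    rw [norm_smul, norm_circleDirection, mul_one, Real.norm_eq_abs] at h2
    refine abs_le_of_sq_le_sq' ?_ (by positivity) |>.2
    have h3 : ‖D u - k • circleDirection‖ ^ 2 ≤ ((6 * ε + 2 * δ) * |k|) ^ 2 := by gcongr
    -- The factor 2 between 6 ε + 2 δ and 12 ε + 4 δ absorbs the distortion of the metric: its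
    -- square 4 is 2 from 1 + ε ≤ 2 times 2 from 1 - ε ≥ 1/2.
    have h4 : c * ‖L (D u - k • circleDirection)‖ ^ 2 ≤
        c * ((12 * ε + 4 * δ) * ‖L (k • circleDirection)‖) ^ 2 := by
      have h5 : (1 + ε) * ‖D u - k • circleDirection‖ ^ 2 ≤
          2 * ((6 * ε + 2 * δ) * |k|) ^ 2 := by
        have : (1 + ε) ≤ 2 := by linarith
        gcongr
      have h6 : 2 * ((6 * ε + 2 * δ) * |k|) ^ 2 = 2 * (6 * ε + 2 * δ) ^ 2 * |k| ^ 2 := by ring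
      have h7 : |k| ^ 2 ≤ 2 * (c * ‖L (k • circleDirection)‖ ^ 2) := by
        have : (1 / 2 : ℝ) * |k| ^ 2 ≤ (1 - ε) * |k| ^ 2 := by gcongr; linarith
        linarith
      calc _ ≤ 2 * (6 * ε + 2 * δ) ^ 2 * |k| ^ 2 := by linarith
        _ ≤ 2 * (6 * ε + 2 * δ) ^ 2 * (2 * (c * ‖L (k • circleDirection)‖ ^ 2)) := by gcongr
        _ = _ := by ring
    exact le_of_mul_le_mul_left h4 hc

end FlatTube

end

end CircleCollapse

/-! ### Lengths of circles and diameters of fibers -/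

namespace CircleCollapse

noncomputable section

open Bundle MeasureTheory

variable {H : Type v} [TopologicalSpace H] {I : ModelWithCorners ℝ (EuclideanSpace ℝ (Fin 3)) H}
  {M : Type u} [EMetricSpace M] [ChartedSpace H M]
  [RiemannianBundle (fun x : M => TangentSpace I x)]

namespace FlatTube

variable {ε c : ℝ} {φ : Circle × Plane → M}

theorem mfderiv_lift_comp (h : FlatTube I ε c φ) {a : ℝ → Cover} {a' : Cover} {t : ℝ}
    (ha : HasDerivAt a a' t) (hat : a t ∈ tube ε⁻¹) :
    (mfderiv 𝓘(ℝ, ℝ) I (fun t => lift φ (a t)) t 1 : EuclideanSpace ℝ (Fin 3)) =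
      mfderiv 𝓘(ℝ, Cover) I (lift φ) (a t) a' := by
  have h1 := mfderiv_comp t (I := 𝓘(ℝ, ℝ)) (h.mdifferentiableAt_lift hat)
    ha.differentiableAt.mdifferentiableAt
  have h2 := congrArg (fun L : ℝ →L[ℝ] EuclideanSpace ℝ (Fin 3) => L 1) h1
  refine h2.trans ?_
  change (mfderiv 𝓘(ℝ, Cover) I (lift φ) (a t)) (mfderiv 𝓘(ℝ, ℝ) 𝓘(ℝ, Cover) a t 1) = _
  rw [mfderiv_eq_fderiv]
  congr 1
  exact ha.deriv

theorem enorm_mfderiv_lift_comp_le (h : FlatTube I ε c φ) {a : ℝ → Cover} {a' : Cover} {t L : ℝ}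
    (ha : HasDerivAt a a' t) (hat : a t ∈ tube ε⁻¹) (hL : ‖a'‖ ≤ L) :
    ‖(mfderiv 𝓘(ℝ, ℝ) I (fun t => lift φ (a t)) t 1 : TangentSpace I (lift φ (a t)))‖ₑ ≤
      ENNReal.ofReal (Real.sqrt ((1 + ε) / c) * L) := by
  have hc := h.pos
  have hε := h.eps_pos
  have hL0 : 0 ≤ L := (norm_nonneg _).trans hL
  rw [← ofReal_norm]
  refine ENNReal.ofReal_le_ofReal ?_
  have h1 : (mfderiv 𝓘(ℝ, ℝ) I (fun t => lift φ (a t)) t 1 : TangentSpace I (lift φ (a t))) =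
    mfderiv 𝓘(ℝ, Cover) I (lift φ) (a t) a' := h.mfderiv_lift_comp ha hat
  rw [h1]
  have h2 := (h.norm_sq_mfderiv hat a').2
  refine le_of_sq_le_sq ?_ (by positivity)
  rw [mul_pow, Real.sq_sqrt (by positivity), div_mul_eq_mul_div, le_div_iff₀ hc, mul_comm]
  refine h2.trans ?_
  gcongr

theorem le_enorm_mfderiv_lift_comp (h : FlatTube I ε c φ) {a : ℝ → Cover} {a' : Cover} {t : ℝ}
    (ha : HasDerivAt a a' t) (hat : a t ∈ tube ε⁻¹) (hL : ‖a'‖ = 1) :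
    ENNReal.ofReal (Real.sqrt ((1 - ε) / c)) ≤
    ‖(mfderiv 𝓘(ℝ, ℝ) I (fun t => lift φ (a t)) t 1 : TangentSpace I (lift φ (a t)))‖ₑ := by
  have hc := h.pos
  have hε := h.eps_pos
  rw [← ofReal_norm]
  refine ENNReal.ofReal_le_ofReal ?_
  have h1 : (mfderiv 𝓘(ℝ, ℝ) I (fun t => lift φ (a t)) t 1 : TangentSpace I (lift φ (a t))) =
    mfderiv 𝓘(ℝ, Cover) I (lift φ) (a t) a' := h.mfderiv_lift_comp ha hat
  rw [h1]
  have h2 := (h.norm_sq_mfderiv hat a').1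
  rw [hL, one_pow, mul_one] at h2
  refine Real.sqrt_le_iff.2 ⟨norm_nonneg _, ?_⟩
  rw [div_le_iff₀ hc, mul_comm]
  exact h2

theorem le_circleLength (h : FlatTube I ε c φ) {y : Plane} (hy : y ∈ Metric.ball (0 : Plane) ε⁻¹) :
    ENNReal.ofReal (Real.sqrt ((1 - ε) / c)) ≤ circleLength I φ y := by
  let a : ℝ → Cover := fun t => t • circleDirection + sliceL y
  have ha : ∀ t, HasDerivAt a circleDirection t := fun t => by
    simpa [a] using ((hasDerivAt_id t).smul_const circleDirection).add_const (sliceL y)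
  have hpl : ∀ t, planeL (a t) = y := fun t => by simp [a]
  have hat : ∀ t, a t ∈ tube ε⁻¹ := fun t => by
    rw [mem_tube, hpl]; simpa using hy
  have hcurve : (fun t : ℝ => φ (Circle.exp (2 * Real.pi * t), y)) = fun t => lift φ (a t) := by
    funext t
    rw [lift_eq_comp]
    simp only [Function.comp_apply, coverMap, hpl]
    simp [a]
  rw [circleLength, hcurve, pathELength_eq_lintegral_mfderiv_Icc]
  calc ENNReal.ofReal (Real.sqrt ((1 - ε) / c))
      = ∫⁻ _ in Icc (0 : ℝ) 1, ENNReal.ofReal (Real.sqrt ((1 - ε) / c)) := by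
        rw [setLIntegral_const, Real.volume_Icc]; simp
    _ ≤ _ := lintegral_mono fun t =>
        h.le_enorm_mfderiv_lift_comp (ha t) (hat t) norm_circleDirection

theorem edist_lift_le [IsRiemannianManifold I M] (h : FlatTube I ε c φ) {a : ℝ → Cover} {L : ℝ}
    (ha : ContDiff ℝ ∞ a) (hL : ∀ t, ‖deriv a t‖ ≤ L) (hat : ∀ t, a t ∈ tube ε⁻¹) {t₁ t₂ : ℝ}
    (h1 : t₁ ≤ t₂) (h2 : t₂ ≤ t₁ + 1) :
    edist (lift φ (a t₁)) (lift φ (a t₂)) ≤ ENNReal.ofReal (Real.sqrt ((1 + ε) / c) * L) := by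
  rw [IsRiemannianManifold.out (I := I) (lift φ (a t₁))]
  have hs : ContMDiffOn 𝓘(ℝ, ℝ) I 1 (fun t => lift φ (a t)) (Icc t₁ t₂) := fun t _ =>
    ((((h.contMDiffAt_lift (hat t)).comp t ha.contMDiff.contMDiffAt).of_le
      (by exact_mod_cast le_top)).contMDiffWithinAt)
  refine (riemannianEDist_le_pathELength hs rfl rfl h1).trans ?_
  rw [pathELength_eq_lintegral_mfderiv_Icc]
  calc _ ≤ ∫⁻ _ in Icc t₁ t₂, ENNReal.ofReal (Real.sqrt ((1 + ε) / c) * L) :=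
        lintegral_mono fun t => h.enorm_mfderiv_lift_comp_le
          (ha.differentiable (by simp) t).hasDerivAt (hat t) (hL t)
    _ ≤ _ := by
      rw [setLIntegral_const, Real.volume_Icc]
      refine mul_le_of_le_one_right' ?_
      rw [← ENNReal.ofReal_one]
      exact ENNReal.ofReal_le_ofReal (by linarith)

/-- Any two points of the fiber are joined by an arc of it of height at most 1, along which the
Euclidean speed is at most 1 + 2 δ. -/
theorem ediam_levelSet_le [IsRiemannianManifold I M] (hφ : FlatTube I ε c φ) {δ : ℝ}
    {h : Cover → Plane} (Hh : NearPlane δ h) (hδ : δ ≤ 1 / 2) {y : Plane} (hy : ‖y‖ + 1 < ε⁻¹) :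
    Metric.ediam (lift φ '' {q | h q = y}) ≤
      ENNReal.ofReal (Real.sqrt ((1 + ε) / c) * (1 + 2 * δ)) := by
  have hδ1 : δ < 1 := by linarith
  have hat : ∀ t, Hh.leafCurve hδ1 y t ∈ tube ε⁻¹ := fun t => by
    have h1 := Hh.norm_planeL_leafCurve_sub_le hδ1 y t
    rw [mem_tube]
    linarith [norm_le_norm_add_norm_sub' (planeL (Hh.leafCurve hδ1 y t)) y]
  have hL : ∀ t, ‖deriv (Hh.leafCurve hδ1 y) t‖ ≤ 1 + 2 * δ := fun t => by
    have h1 := norm_le_norm_add_norm_sub' (deriv (Hh.leafCurve hδ1 y) t) circleDirection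
    rw [norm_circleDirection] at h1
    linarith [Hh.norm_deriv_leafCurve_sub_le hδ1 y hδ t]
  refine Metric.ediam_le ?_
  rintro _ ⟨q₁, hq₁, rfl⟩ _ ⟨q₂, hq₂, rfl⟩
  have h1 : lift φ q₂ = lift φ (Hh.leafCurve hδ1 y (q₁ 0 + Int.fract (q₂ 0 - q₁ 0))) := by
    have h4 : h (q₂ + ((-⌊q₂ 0 - q₁ 0⌋ : ℤ) : ℝ) • circleDirection) = y := by
      rw [shift_int Hh.shift]; exact hq₂
    have h5 := Hh.eq_leafCurve hδ1 y h4
    have h6 : (q₂ + ((-⌊q₂ 0 - q₁ 0⌋ : ℤ) : ℝ) • circleDirection) 0 =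
        q₁ 0 + Int.fract (q₂ 0 - q₁ 0) := by
      simp only [Int.fract, PiLp.add_apply, PiLp.smul_apply, circleDirection_zero_coord,
        smul_eq_mul, mul_one]
      push_cast; ring
    rw [← h6, h5, shift_int (lift_shift φ)]
  rw [h1]
  have h2 := Hh.eq_leafCurve hδ1 y hq₁
  rw [← congrArg (lift φ) h2]
  exact hφ.edist_lift_le (Hh.contDiff_leafCurve hδ1 y) hL hat
    (by linarith [Int.fract_nonneg (q₂ 0 - q₁ 0)]) (by linarith [Int.fract_lt_one (q₂ 0 - q₁ 0)])

/-- The diameter is at most about 1 / √c₁, the length of a circle at least about 1 / √c, and c₁ / c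
is at least (99/100)² by `scale_ge`; the factor 2 leaves ample room. -/
theorem ediam_levelSet_le_circleLength [IsManifold I ∞ M] [IsRiemannianManifold I M]
    [IsContMDiffRiemannianBundle I ∞ (EuclideanSpace ℝ (Fin 3)) (fun x : M => TangentSpace I x)]
    {c₁ : ℝ} {φ₁ : Circle × Plane → M} (h₁ : FlatTube I ε c₁ φ₁) (h₂ : FlatTube I ε c φ)
    (hε1 : ε ≤ 1 / 10 ^ 8) {δ : ℝ} {h : Cover → Plane} (Hh : NearPlane δ h) (hδ : δ ≤ 1 / 100)
    {q₁ q₂ : Cover} (hq₁ : ‖planeL q₁‖ ≤ 50) (hq₂ : q₂ ∈ tube ε⁻¹)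
    (he : lift φ₁ q₁ = lift φ q₂) {y : Plane} (hy : y ∈ Metric.ball (0 : Plane) ε⁻¹) :
    Metric.ediam (lift φ₁ '' {q | h q = h q₁}) ≤ 2 * circleLength I φ y := by
  have hinv := h₁.inv_gt hε1
  have hε := h₁.eps_pos
  have hδ0 := Hh.nonneg
  have hc₁ := h₁.pos
  have hc := h₂.pos
  have hy50 : ‖h q₁‖ ≤ 51 := by
    have h1 := Hh.close q₁
    linarith [norm_le_norm_add_norm_sub' (h q₁) (planeL q₁)]
  refine (h₁.ediam_levelSet_le Hh (by linarith) (by linarith)).trans ?_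
  have hs := h₂.scale_ge h₁ he.symm hq₂ (by linarith)
  have hs2 : (99 / 100 : ℝ) ^ 2 * c ≤ c₁ := by
    have h3 : (99 / 100 : ℝ) ≤ Real.sqrt (c₁ / c) := by linarith
    rw [Real.le_sqrt' (by norm_num), le_div_iff₀ hc] at h3
    exact h3
  calc _ ≤ ENNReal.ofReal (2 * Real.sqrt ((1 - ε) / c)) := by
        refine ENNReal.ofReal_le_ofReal ?_
        have h1ε : 0 ≤ 1 - ε := by linarith
        refine le_of_sq_le_sq ?_ (by positivity)
        rw [mul_pow, mul_pow, Real.sq_sqrt (by positivity), Real.sq_sqrt (by positivity),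
          div_mul_eq_mul_div, mul_div_assoc', div_le_div_iff₀ hc₁ hc]
        have h5 : (1 + ε) * (1 + 2 * δ) ^ 2 ≤ 2 := by
          calc (1 + ε) * (1 + 2 * δ) ^ 2 ≤ (1 + 1 / 100) * (1 + 2 * (1 / 100)) ^ 2 := by
                gcongr
                linarith
            _ ≤ 2 := by norm_num
        have h6 : (3 : ℝ) ≤ 2 ^ 2 * (1 - ε) := by linarith
        nlinarith
    _ = 2 * ENNReal.ofReal (Real.sqrt ((1 - ε) / c)) := by
        rw [ENNReal.ofReal_mul (by norm_num)]; simp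
    _ ≤ _ := by
        gcongr
        exact h₂.le_circleLength hy

end FlatTube

end

end CircleCollapse

/-! ### Verticality of the fibers -/

namespace CircleCollapse

noncomputable section

open Bundle

variable {H : Type v} [TopologicalSpace H] {I : ModelWithCorners ℝ (EuclideanSpace ℝ (Fin 3)) H}
  {M : Type u} [EMetricSpace M] [ChartedSpace H M] [IsManifold I ∞ M]
  [RiemannianBundle (fun x : M => TangentSpace I x)]
  [IsContMDiffRiemannianBundle I ∞ (EuclideanSpace ℝ (Fin 3)) (fun x : M => TangentSpace I x)]

variable {ε δ ε' η c c₁ ρ : ℝ} {φ φ₁ : Circle × Plane → M} {Q : CircleFoliation I M}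
  {P : Q.Param} {h : Cover → Plane} {q₀ : Cover}

/-- The angle between a fiber and the circles of a tube which contains the fiber. -/
theorem FlatTube.angle_le (h₁ : FlatTube I ε c₁ φ₁) (h₂ : FlatTube I ε c φ)
    (hε1 : ε ≤ 1 / 10 ^ 8) (hεδ : ε ≤ δ) (hδ : δ ≤ 1 / 100)
    (hη : ∀ {E : Type} [NormedAddCommGroup E] [InnerProductSpace ℝ E] (w t : E) (k : ℝ), k • t ≠ 0 →
      ‖w - k • t‖ ≤ η * ‖k • t‖ →
      min (InnerProductGeometry.angle w t) (Real.pi - InnerProductGeometry.angle w t) ≤ ε')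
    (hδη : 16 * δ ≤ η)
    (hc : FibChart (lift φ₁) (Q.V : Set M) Q.F δ q₀ h ρ) (hq₀ : ‖planeL q₀‖ < 10)
    (hP : ∀ q', ‖h q' - h q₀‖ < ρ →
      lift φ₁ q' ∈ P.image ∧ (P.inv (lift φ₁ q')).2 = h q')
    (hF : Q.F (lift φ₁ q₀) ⊆ φ '' circleTimesBall ε⁻¹) {q : Cover} (hq : q ∈ tube ε⁻¹)
    (hqF : lift φ q ∈ Q.F (lift φ₁ q₀)) (hV : lift φ q ∈ Q.V)
    (v : TangentSpace I (⟨lift φ q, hV⟩ : Q.V))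
    (hv : mfderiv I (𝓡 2) Q.proj ⟨lift φ q, hV⟩ v = 0) (hv0 : v ≠ 0) :
    let w : TangentSpace I (lift φ q) := mfderiv I I (Subtype.val : Q.V → M) ⟨lift φ q, hV⟩ v
    let t : TangentSpace I (lift φ q) := mfderiv 𝓘(ℝ, Cover) I (lift φ) q circleDirection
    min (InnerProductGeometry.angle w t) (Real.pi - InnerProductGeometry.angle w t) ≤ ε' := by
  intro w t
  have hinv := h₁.inv_gt hε1
  rw [hc.fiber_eq] at hqF hF
  obtain ⟨q₁, hq₁, he⟩ := hqF
  have hq₁ : h q₁ = h q₀ := hq₁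
  rw [← hq₁] at hF
  have hρ : ‖h q₁ - h q₀‖ < ρ := by rw [hq₁, sub_self, norm_zero]; exact hc.pos
  have hq₁12 := hc.tube_of_mem (by linarith) hρ
  have hq₁t : q₁ ∈ tube ε⁻¹ := by rw [mem_tube]; linarith
  obtain ⟨b, D, m, -, -, hm, -, -, -, hDe, hDn, hD⟩ :=
    h₁.exists_leaf_lift h₂ hε1 hc.near hδ (by linarith) hq he hF
  obtain ⟨u, hu⟩ := h₁.surjective_mfderiv_lift hq₁t w
  have hw : w ≠ 0 := fun h0 => hv0 (injective_mfderiv_val Q.V ⟨lift φ q, hV⟩ (by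
    rw [map_zero]; exact h0))
  have hu0 : u ≠ 0 := by
    rintro rfl
    exact hw (hu.symm.trans (map_zero _))
  have hnear : ∀ᶠ q' in 𝓝 q₁, ‖h q' - h q₀‖ < ρ :=
    (((hc.near.contDiff.continuous.sub continuous_const).norm).isOpen_preimage _
      isOpen_Iio).mem_nhds hρ
  -- The tangent of the fiber, pulled back to the first tube, lies in the kernel of dh and is
  -- therefore almost in the circle direction there.
  have hhu : fderiv ℝ h q₁ u = 0 :=
    CircleFoliation.fderiv_eq_zero_of_mfderiv_proj' P (h₁.mdifferentiableAt_lift hq₁t)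
      (hP q₁ hρ).1 (hnear.mono fun q' hq' => (hP q' hq').2) he.symm hV hv hu.symm
  obtain ⟨k, hk0, hk⟩ := h₂.norm_mfderiv_sub_le hc.near.nonneg hδ hq hm hDe hDn
    (hc.near.norm_planeL_le_of_fderiv_eq_zero hhu) hu0
  have hwD : w = mfderiv 𝓘(ℝ, Cover) I (lift φ) q (D u) := hu.symm.trans (hD u)
  refine hη (E := TangentSpace I (lift φ q)) w t k hk0 ?_
  rw [hwD]
  refine hk.trans ?_
  gcongr
  linarith

/-- A fiber of the fibration is nearly vertical in each tube which contains it. -/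
theorem FlatTube.isNearlyVertical (h₁ : FlatTube I ε c₁ φ₁) (h₂ : FlatTube I ε c φ)
    (hε1 : ε ≤ 1 / 10 ^ 8) (hεδ : ε ≤ δ) (hδ : δ ≤ 1 / 100)
    (hη : ∀ {E : Type} [NormedAddCommGroup E] [InnerProductSpace ℝ E] (w t : E) (k : ℝ), k • t ≠ 0 →
      ‖w - k • t‖ ≤ η * ‖k • t‖ →
      min (InnerProductGeometry.angle w t) (Real.pi - InnerProductGeometry.angle w t) ≤ ε')
    (hδη : 16 * δ ≤ η) (hδε' : 16 * δ ≤ ε')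
    (hc : FibChart (lift φ₁) (Q.V : Set M) Q.F δ q₀ h ρ) (hq₀ : ‖planeL q₀‖ < 10)
    (hP : ∀ q', ‖h q' - h q₀‖ < ρ →
      lift φ₁ q' ∈ P.image ∧ (P.inv (lift φ₁ q')).2 = h q')
    {x : Q.V} (hx : lift φ₁ q₀ = x) (hF : fiber Q.proj (Q.proj x) ⊆ φ '' circleTimesBall ε⁻¹) :
    IsNearlyVertical I ε ε' φ Q.proj (Q.proj x) ∧ GeneratesFundamentalGroup hF := by
  have hfib : fiber Q.proj (Q.proj x) = lift φ₁ '' {q | h q = h q₀} := by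
    rw [CircleFoliation.fiber_proj, ← hx, hc.fiber_eq]
  have hF1 := hF
  rw [hfib, ← image_tube] at hF1
  obtain ⟨q₂, hq₂, he⟩ := hF1 ⟨q₀, rfl, rfl⟩
  have hF2 := hF
  rw [hfib] at hF2
  obtain ⟨b, D, m, hb, hbt, hm, hb1, hbF, hbn, -⟩ :=
    h₁.exists_leaf_lift h₂ hε1 hc.near hδ (by linarith) hq₂ he.symm hF2
  refine ⟨⟨?_, planeL q₂, by simpa using mem_tube.1 hq₂, ?_⟩,
    h₂.generatesFundamentalGroup hF hb hbt hm hb1 (hfib.trans hbF)⟩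
  · intro q hV hq hqb v hv hv0
    refine h₁.angle_le h₂ hε1 hεδ hδ hη hδη hc hq₀ hP ?_ hq ?_ hV v hv hv0
    · rw [hc.fiber_eq]; exact hF2
    · rw [hc.fiber_eq, ← hfib]
      exact ⟨_, hqb, rfl⟩
  · rw [hfib]
    intro y hy
    obtain ⟨s, hs, rfl⟩ := hbn y hy
    refine ⟨coverMap (b s), ⟨mem_univ _, by simpa [coverMap] using mem_tube.1 (hbt s), ?_⟩, rfl⟩
    rw [Metric.mem_closedBall, dist_eq_norm]
    exact hs.trans (by linarith [h₁.eps_pos])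

end

end CircleCollapse

/-! ### The choice of ε₁ and the assembly -/

open Bundle CircleCollapse in
theorem mainTheorem6 : ∀ ε' : ℝ, 0 < ε' → ∃ ε₁ : ℝ, 0 < ε₁ ∧ ∀ ε : ℝ, 0 < ε → ε < ε₁ →
    ∀ {H : Type v} [TopologicalSpace H] (I : ModelWithCorners ℝ (EuclideanSpace ℝ (Fin 3)) H)
      {M : Type u} [EMetricSpace M] [ChartedSpace H M] [IsManifold I ∞ M]
      [RiemannianBundle (fun x : M => TangentSpace I x)]
      [IsContMDiffRiemannianBundle I ∞ (EuclideanSpace ℝ (Fin 3))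
        (fun x : M => TangentSpace I x)]
      [IsRiemannianManifold I M]
      (K : Set M), IsCompact K →
      (∀ x ∈ K, ∃ φ : Circle × Plane → M, IsProductStructureAt I ε φ x) →
      ∃ V : TopologicalSpace.Opens M, K ⊆ V ∧
      ∃ (B : Type u) (_ : TopologicalSpace B) (_ : ChartedSpace Plane B),
        T2Space B ∧ SecondCountableTopology B ∧ IsManifold (𝓡 2) ∞ B ∧
        ∃ p : V → B, IsSmoothCircleFibration I V p ∧
          ∀ b : B,
            (∀ φ : Circle × Plane → M, IsProductStructure I ε φ →
              ∀ h : fiber p b ⊆ φ '' circleTimesBall ε⁻¹,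
                IsNearlyVertical I ε ε' φ p b ∧ GeneratesFundamentalGroup h) ∧
            (∀ x ∈ fiber p b, ∀ φ : Circle × Plane → M, IsProductStructureAt I ε φ x →
              ∀ y ∈ Metric.ball (0 : Plane) ε⁻¹,
                Metric.ediam (fiber p b) ≤ 2 * circleLength I φ y) := by
  intro ε' hε'
  obtain ⟨η, hη0, hη⟩ := exists_angle_bound hε'
  have hR := one_le_fibrationRatio
  -- A bound for the final closeness δ = `fibrationRatio` * (10 ^ 7 * ε): 1/100 for the geometric
  -- estimates, and 16 δ ≤ min η ε' because ε ≤ δ bounds the tilt 12 ε + 4 δ and the drift 12 ε + 3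
  -- δ by 16 δ.
  set σ : ℝ := min (1 / 100) (min η ε' / 16) with hσ
  have hσ0 : 0 < σ := by positivity
  refine ⟨min (1 / 10 ^ 8) (σ / (fibrationRatio * 10 ^ 7)), by positivity, ?_⟩
  intro ε hε hεlt H _ I M _ _ _ _ _ _ K hK hKφ
  have hε1 : ε ≤ 1 / 10 ^ 8 := (hεlt.trans_le (min_le_left _ _)).le
  have hδσ : fibrationRatio * (10 ^ 7 * ε) ≤ σ := by
    have h1 := (hεlt.trans_le (min_le_right _ _)).le
    rw [le_div_iff₀ (by positivity)] at h1
    linarith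
  have hδ : fibrationRatio * (10 ^ 7 * ε) ≤ 1 / 100 := hδσ.trans (min_le_left _ _)
  have hmin : 16 * (fibrationRatio * (10 ^ 7 * ε)) ≤ min η ε' := by
    have h1 : σ ≤ min η ε' / 16 := min_le_right _ _
    linarith
  have hεδ : ε ≤ fibrationRatio * (10 ^ 7 * ε) := by nlinarith
  obtain ⟨n, S, φ, c, V, F, hφ, hF, hKV⟩ :=
    exists_isFibration_of_isCompact hε hε1 hδ hK hKφ
  obtain ⟨Q, rfl, hQ, hchart⟩ := exists_circleFoliation hφ hε1 (by linarith) hF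
  refine ⟨Q.V, hKV, Q.Base, inferInstance, inferInstance, inferInstance,
    CircleFoliation.secondCountableTopology_base hQ, inferInstance, Q.proj, Q.isSmoothCircleFibration_proj, ?_⟩
  intro b
  obtain ⟨x, rfl⟩ := CircleFoliation.proj_surjective b
  obtain ⟨j, q, h, ρ, P, hq, hqx, hc, hP⟩ := hchart x x.2
  refine ⟨fun ψ hψ hsub => ?_, fun y hy ψ hψ z hz => ?_⟩
  · obtain ⟨c', hψ'⟩ := hψ.exists_flatTube hε (by linarith)
    exact (hφ j).isNearlyVertical hψ' hε1 hεδ hδ hη (hmin.trans (min_le_left _ _))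
      (hmin.trans (min_le_right _ _)) hc hq hP hqx hsub
  · obtain ⟨hψ, w, rfl⟩ := hψ
    obtain ⟨c', hψ'⟩ := hψ.exists_flatTube hε (by linarith)
    have hfib : fiber Q.proj (Q.proj x) = lift (φ j) '' {q' | h q' = h q} := by
      rw [CircleFoliation.fiber_proj, ← hqx, hc.fiber_eq]
    rw [hfib] at hy ⊢
    obtain ⟨q₁, hq₁, he⟩ := hy
    have hq₁ : h q₁ = h q := hq₁
    obtain ⟨q₂, hq₂⟩ := coverMap_surjective (w, (0 : Plane))
    have hq₂t : q₂ ∈ tube ε⁻¹ := by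
      have h1 : planeL q₂ = 0 := congrArg Prod.snd hq₂
      rw [mem_tube, h1, norm_zero]
      positivity
    rw [← hq₁]
    refine (hφ j).ediam_levelSet_le_circleLength hψ' hε1 hc.near hδ ?_ hq₂t ?_ hz
    · have h1 := hc.tube_of_mem (by linarith) (q := q₁)
        (by rw [hq₁, sub_self, norm_zero]; exact hc.pos)
      linarith
    · rw [he, ← hq₂]; rfl
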